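/- **Setting.** $K\ge 1$ agents and a server act in independent copies of an episodic MDP with horizon $H\ge1$, rewards in $[0,R]$, discount $\gamma\in(0,1)$ and a common initial distribution. Policies $\pi_\theta>0$, $\theta\in\mathbb R^d$, satisfy $\|\nabla_\theta\log\pi_\theta\|\le G$ and $\|\nabla^2_\theta\log\pi_\theta\|\le M$. Let $p(\cdot|\theta)$ be the trajectory law, $J(\theta)=\mathbb E_{\tau\sim p(\cdot|\theta)}\sum_h\gamma^h\mathcal R(s_h,a_h)$, and let $g(\tau|\theta)$ be the REINFORCE estimator with baseline $C_b$ or the GPOMDP estimator with baselines $C_{b_h}$, where $|C_{b_h}|\le\gamma^h|C_b|$. Assume $\|g(\tau|\theta)-\nabla J(\theta)\|\le\sigma$ for $\tau\sim p(\cdot|\theta)$, all $\theta$, and $\mathrm{Var}_{\tau\sim p(\cdot|\theta_1)}(p(\tau|\theta_2)/p(\tau|\theta_1))\le W$ for all $\theta_1,\theta_2$. Put $L=HR(M+HG^2)/(1-\gamma)$, $L_g=HM(R+|C_b|)/(1-\gamma)$, $C_g=HG(R+|C_b|)/(1-\gamma)$, $C_w=H(2HG^2+M)(W+1)$, $\Phi=L_g+C_g^2C_w$,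 $\Psi=(L\Phi)^{1/3}$, $V=2\log(2K/\delta)$. **Algorithm (FedPG-BR).** At most $\alpha K$ agents, $0\le\alpha<1/2$, are Byzantine. Start from any $\tilde\theta_0$. In round $t=1,\dots,T$, with $\theta_0=\tilde\theta_{t-1}$, every agent samples $B$ trajectories from $p(\cdot|\theta_0)$; a good agent sends the average $\mu^{(k)}$ of $g(\cdot|\theta_0)$ over them, a Byzantine agent sends any vector (possibly depending on all trajectories of the agents, on the past, and on private randomness). For a threshold $r$, let $S$ be the set of agents whose vector is within $r$ of more than $K/2$ of the vectors, let $\mu^{mom}$ be a vector from $S$ closest to the mean over $S$, and accept the agents whose vector is within $r$ of $\mu^{mom}$ (none if $S=\emptyset$). The server does this with $r=2\sigma\sqrt{V/B}$ and, if fewer than $(1-\alpha)K$ agents are accepted, again with $r=2\sigma$; $\mu_t$ is the average over the accepted agents. Then it draws $N_t$ with $P(N_t=n)=\Gamma^n(1-\Gamma)$, $\Gamma=B/(B+1)$, and for $n<N_t$ draws $\tau\sim p(\cdot|\theta_n)$ and sets $\theta_{n+1}=\theta_n+\eta\big(g(\tau|\theta_n)-\tfrac{p(\tau|\theta_0)}{p(\tau|\theta_n)}g(\tau|\theta_0)+\mu_t\big)$;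 $\tilde\theta_t=\theta_{N_t}$. The output $\tilde\theta_a$ is uniform on $\tilde\theta_1,\dots,\tilde\theta_T$. Call $(B,\eta,\delta)$ *admissible* if $B\ge 1$ is an integer with $B\ge4\Phi L^{-2}$, $0<\eta\le\frac1{2\Psi B^{2/3}}$, $\delta\in(0,1)$, $e^{\delta B/(2(1-2\delta))}\le 2K/\delta\le e^{B/2}$ and $\delta\le\frac1{5KB}$. **Claim.** Let $\mathbb E[Traj]$ be the expected number of trajectories sampled by an agent in the $T$ rounds; the bounds hold even if the $N_t$ trajectories drawn by the server are added. Below, constants $C$ depend only on $H,R,\gamma,G,M,W,\sigma,C_b$ and on the further quantities named. (i) Fix $\kappa>0$ and $\alpha_0<1/2$. There is $C$ such that for all $K\ge1$, $0\le\alpha\le\alpha_0$ and $\varepsilon>0$ with $\varepsilon K\log(2K)\le\kappa$ there are $T\ge1$ and admissible $(B,\eta,\delta)$ for which FedPG-BR reaches $\mathbb E\|\nabla J(\tilde\theta_a)\|^2\le\varepsilon$ (for every such problem, every $\tilde\theta_0$ and every Byzantine behaviour), with $V\le C\log(2+K/\varepsilon)$ and $$\mathbb E[Traj]\le C\Big(\frac1{\varepsilon^{5/3}K^{2/3}}+\frac{\alpha^{4/3}V^{2/3}}{\varepsilon^{5/3}}\Big),$$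 that is, $O\big(\frac1{\varepsilon^{5/3}K^{2/3}}+\frac{\alpha^{4/3}}{\varepsilon^{5/3}}\big)$ when the confidence factor $V$ is counted among the constants. (ii) Fix $\kappa>0$. For $\alpha=0$ there is $C$ such that for all $K\ge1$ and $\varepsilon>0$ with $\varepsilon K\log(2K)\le\kappa$ the same is achieved with $\mathbb E[Traj]\le C/(\varepsilon^{5/3}K^{2/3})$. (iii) Fix $\kappa>0$. For $K=1$ there is $C$ such that for all $0\le\alpha<1/2$ and $0<\varepsilon\le\kappa$ the same is achieved with $\mathbb E[Traj]\le C/\varepsilon^{5/3}$. -/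

import Mathlib

open MeasureTheory ProbabilityTheory
open scoped ENNReal

universe u v w

noncomputable section

namespace FedPG

/-- The parameter space `ℝ^d` with the Euclidean norm. -/
abbrev Param (d : ℕ) := EuclideanSpace ℝ (Fin d)

/-- A trajectory `(s₀, a₀), …, (s_{H-1}, a_{H-1})`. -/
abbrev Traj (S A : Type*) (H : ℕ) := Fin H → S × A

/-- The numerical constants of the problem: horizon `H`, reward bound `R`, discount `γ`, bounds `G`
and `M` on the first and second derivatives of the log-policy, bound `W` on the variance of the
importance weights, bound `σ` on the deviation of the gradient estimator, bound `Cb` on the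
baseline. -/
structure Constants where
  H : ℕ
  R : ℝ
  γ : ℝ
  G : ℝ
  M : ℝ
  W : ℝ
  σ : ℝ
  Cb : ℝ
  one_le_H : 1 ≤ H
  R_pos : 0 < R
  γ_pos : 0 < γ
  γ_lt_one : γ < 1
  G_pos : 0 < G
  M_pos : 0 < M
  W_nonneg : 0 ≤ W
  σ_nonneg : 0 ≤ σ
  Cb_nonneg : 0 ≤ Cb

namespace Constants

variable (c : Constants)

/-- `L = HR(M + HG²)/(1-γ)`. -/
def L : ℝ := c.H * c.R * (c.M + c.H * c.G ^ 2) / (1 - c.γ)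

/-- `L_g = HM(R + |C_b|)/(1-γ)`. -/
def Lg : ℝ := c.H * c.M * (c.R + c.Cb) / (1 - c.γ)

/-- `C_g = HG(R + |C_b|)/(1-γ)`. -/
def Cg : ℝ := c.H * c.G * (c.R + c.Cb) / (1 - c.γ)

/-- `C_w = H(2HG² + M)(W + 1)`. -/
def Cw : ℝ := c.H * (2 * c.H * c.G ^ 2 + c.M) * (c.W + 1)

/-- `Φ = L_g + C_g² C_w`. -/
def Phi : ℝ := c.Lg + c.Cg ^ 2 * c.Cw

/-- `Ψ = (L (L_g + C_g² C_w))^{1/3}`. -/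
def Psi : ℝ := (c.L * (c.Lg + c.Cg ^ 2 * c.Cw)) ^ (1 / 3 : ℝ)

end Constants

/-- The two policy gradient estimators, with their baselines (one number `C_b` for REINFORCE, one
number `C_{b_h}` for each step `h` for GPOMDP). -/
inductive Estimator (H : ℕ) where
  | reinforce (b : ℝ)
  | gpomdp (b : Fin H → ℝ)

/-- The baseline is of size `C`: `|C_b| ≤ C`, respectively `|C_{b_h}| ≤ γ^h C` for all `h`. -/
def Estimator.BaselineBound {H : ℕ} (γ C : ℝ) : Estimator H → Prop
  | .reinforce b => |b| ≤ C
  | .gpomdp b => ∀ h, |b h| ≤ γ ^ (h : ℕ) * C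

/-- An episodic Markov decision process with state space `S` and action space `A`, a policy class
parameterized by `ℝ^d`, and a gradient estimator. The policy `π_θ(· | s)` has the density
`policy θ s` with respect to the reference measure `ref` on the action space (the counting measure
in the discrete case, Lebesgue measure in the continuous case). -/
structure Setting (S A : Type*) [MeasurableSpace S] [MeasurableSpace A] (d H : ℕ) where
  start : Measure S
  trans : Kernel (S × A) S
  reward : S → A → ℝ
  ref : Measure A
  policy : Param d → S → A → ℝ
  est : Estimator H

section Trajectories

variable {S A : Type*} [MeasurableSpace S] [MeasurableSpace A] {d H : ℕ}

/-- The law of an `n`-step trajectory from the state `s`, when actions are drawn from the density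
`p` with respect to `ν` and states from the kernel `P`. -/
def trajFrom (P : Kernel (S × A) S) (ν : Measure A) (p : S → A → ℝ) :
    (n : ℕ) → S → Measure (Traj S A n)
  | 0, _ => Measure.dirac Fin.elim0
  | n + 1, s =>
      (ν.withDensity fun a => ENNReal.ofReal (p s a)).bind fun a =>
        (P (s, a)).bind fun s' =>
          (trajFrom P ν p n s').map fun τ => (Fin.cons (s, a) τ : Traj S A (n + 1))

namespace Setting

variable (X : Setting S A d H)

/-- The trajectory distribution `p(· | θ)`. -/
def trajLaw (θ : Param d) : Measure (Traj S A H) :=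
  X.start.bind fun s => trajFrom X.trans X.ref (X.policy θ) H s

/-- The discounted return `R(τ) = ∑ γ^h R(s_h, a_h)`. -/
def ret (γ : ℝ) (τ : Traj S A H) : ℝ :=
  ∑ h : Fin H, γ ^ (h : ℕ) * X.reward (τ h).1 (τ h).2

/-- The performance `J(θ) = E_{τ ∼ p(· | θ)} R(τ)`. -/
def J (γ : ℝ) (θ : Param d) : ℝ := ∫ τ, X.ret γ τ ∂(X.trajLaw θ)

/-- The score `∇_θ log π_θ(a | s)`. -/
def score (θ : Param d) (x : S × A) : Param d :=
  gradient (fun θ' => Real.log (X.policy θ' x.1 x.2)) θ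

/-- The gradient estimator `g(τ | θ)`: REINFORCE or GPOMDP. -/
def g (γ : ℝ) (τ : Traj S A H) (θ : Param d) : Param d :=
  match X.est with
  | .reinforce b => (X.ret γ τ - b) • ∑ h : Fin H, X.score θ (τ h)
  | .gpomdp b =>
      ∑ h : Fin H, (γ ^ (h : ℕ) * X.reward (τ h).1 (τ h).2 - b h) •
        ∑ t ∈ Finset.Iic h, X.score θ (τ t)

/-- The importance weight `ω(τ | θ₁, θ₂) = p(τ | θ₂) / p(τ | θ₁)`, in which the initial state and
transition probabilities cancel. -/
def weight (τ : Traj S A H) (θ₁ θ₂ : Param d) : ℝ :=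
  ∏ h : Fin H, X.policy θ₂ (τ h).1 (τ h).2 / X.policy θ₁ (τ h).1 (τ h).2

end Setting

/-- The standing assumptions, with the constants `c`. -/
structure Assumptions (c : Constants) (X : Setting S A d c.H) : Prop where
  start_prob : IsProbabilityMeasure X.start
  trans_markov : IsMarkovKernel X.trans
  ref_sigmaFinite : SigmaFinite X.ref
  reward_measurable : Measurable fun x : S × A => X.reward x.1 x.2
  reward_mem : ∀ s a, X.reward s a ∈ Set.Icc 0 c.R
  policy_measurable : ∀ θ, Measurable fun x : S × A => X.policy θ x.1 x.2
  policy_pos : ∀ θ s a, 0 < X.policy θ s a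
  policy_mass : ∀ θ s, ∫⁻ a, ENNReal.ofReal (X.policy θ s a) ∂X.ref = 1
  baseline : X.est.BaselineBound c.γ c.Cb
  /-- `log π_θ(a | s)` is twice differentiable in `θ`. -/
  diff : ∀ s a, Differentiable ℝ fun θ => Real.log (X.policy θ s a)
  diff_two : ∀ s a, Differentiable ℝ (fderiv ℝ fun θ => Real.log (X.policy θ s a))
  /-- `‖∇ log π_θ(a | s)‖ ≤ G`. -/
  score_bound : ∀ s a θ, ‖gradient (fun θ' => Real.log (X.policy θ' s a)) θ‖ ≤ c.G
  /-- `‖∇² log π_θ(a | s)‖ ≤ M` in the operator norm. -/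
  hess_bound : ∀ s a θ,
    ‖fderiv ℝ (fderiv ℝ fun θ' => Real.log (X.policy θ' s a)) θ‖ ≤ c.M
  /-- `‖g(τ | θ) - ∇J(θ)‖ ≤ σ` for `τ ∼ p(· | θ)`. -/
  estimator_bound : ∀ θ, ∀ᵐ τ ∂(X.trajLaw θ),
    ‖X.g c.γ τ θ - gradient (X.J c.γ) θ‖ ≤ c.σ
  /-- `Var(ω(τ | θ₁, θ₂)) ≤ W` for `τ ∼ p(· | θ₁)`. -/
  weight_variance : ∀ θ₁ θ₂,
    evariance (fun τ => X.weight τ θ₁ θ₂) (X.trajLaw θ₁) ≤ ENNReal.ofReal c.W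

end Trajectories

/-! ### The aggregation rule of the server -/

section Aggregate

variable {d K : ℕ}

open Classical in
/-- The vector medians: the agents whose message is within `r` of more than `K/2` messages. -/
def medians (r : ℝ) (m : Fin K → Param d) : Finset (Fin K) :=
  {k | (K : ℝ) / 2 < (Finset.card {k' : Fin K | ‖m k' - m k‖ ≤ r} : ℝ)}

/-- The mean of the vector medians. -/
def medianMean (r : ℝ) (m : Fin K → Param d) : Param d :=
  ((medians r m).card : ℝ)⁻¹ • ∑ k ∈ medians r m, m k

open Classical in
/-- The vector medians that are closest to the mean of the vector medians. -/
def momCandidates (r : ℝ) (m : Fin K → Param d) : Finset (Fin K) :=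
  {k ∈ medians r m | ∀ j ∈ medians r m, ‖m k - medianMean r m‖ ≤ ‖m j - medianMean r m‖}

open Classical in
/-- The filtering rule with threshold `r`: the agents within `r` of the mean of median, which is
picked among the candidates by the rule `pick`. No agent is accepted if there is no candidate. -/
def accepted (pick : Finset (Fin K) → Fin K) (r : ℝ) (m : Fin K → Param d) : Finset (Fin K) :=
  if (momCandidates r m).Nonempty then
    Finset.univ.filter fun k => ‖m k - m (pick (momCandidates r m))‖ ≤ r
  else ∅

open Classical in
/-- The accepted agents: rule R1 with threshold `thr`; if that accepts fewer than `(1-α)K` agents,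
rule R2 with threshold `2σ`. -/
def believedGood (pick : Finset (Fin K) → Fin K) (α σ thr : ℝ) (m : Fin K → Param d) :
    Finset (Fin K) :=
  if ((accepted pick thr m).card : ℝ) < (1 - α) * K then accepted pick (2 * σ) m
  else accepted pick thr m

/-- FedPG-Aggregate: the average of the accepted messages. -/
def aggregate (pick : Finset (Fin K) → Fin K) (α σ thr : ℝ) (m : Fin K → Param d) : Param d :=
  ((believedGood pick α σ thr m).card : ℝ)⁻¹ • ∑ k ∈ believedGood pick α σ thr m, m k

end Aggregate

/-! ### The algorithm -/

/-- `V = 2 log(2K/δ)`. -/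
def V (K : ℕ) (δ : ℝ) : ℝ := 2 * Real.log (2 * K / δ)

/-- The law of the number `N_t` of inner steps: geometric with parameter `Γ = B/(B+1)`, that is
`P(N = n) = Γ^n (1 - Γ)`, so that `E N = B`. Mathlib's parameter is the probability to stop,
`1 - Γ = 1/(B+1)`. -/
def stepsLaw (B : ℕ) : Measure ℕ :=
  geometricMeasure ⟨1 / ((B : ℝ) + 1), by positivity, by
    rw [div_le_one (by positivity)]; linarith [Nat.cast_nonneg (α := ℝ) B]⟩

/-- The Byzantine agents: an adversary with memory in `Z` and private randomness. In each round it
sees its memory, the broadcast parameter and the trajectories of all agents; it produces a message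
for every agent (used for the Byzantine agents only) and a new memory. -/
structure Adversary (S A Z : Type*) [MeasurableSpace S] [MeasurableSpace A] [MeasurableSpace Z]
    (d H K B : ℕ) where
  start : Measure Z
  start_prob : IsProbabilityMeasure start
  respond : ℕ → Kernel (Z × Param d × (Fin K → Fin B → Traj S A H)) ((Fin K → Param d) × Z)
  respond_markov : ∀ t, IsMarkovKernel (respond t)

section Algorithm

variable {S A Z : Type*} [MeasurableSpace S] [MeasurableSpace A] [MeasurableSpace Z] {d K : ℕ}

/-- The law of `θ_n` in the inner loop from `θ_0` with step size `η`, batch gradient `μ` and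
mini-batch size `1`: draw `τ ∼ p(· | θ_n)` and set
`θ_{n+1} = θ_n + η (g(τ | θ_n) - ω(τ | θ_n, θ_0) g(τ | θ_0) + μ)`. -/
def innerLaw {H : ℕ} (X : Setting S A d H) (γ η : ℝ) (θ₀ μ : Param d) : ℕ → Measure (Param d)
  | 0 => Measure.dirac θ₀
  | n + 1 => (innerLaw X γ η θ₀ μ n).bind fun θ =>
      (X.trajLaw θ).map fun τ =>
        θ + η • (X.g γ τ θ - X.weight τ θ θ₀ • X.g γ τ θ₀ + μ)

open Classical in
/-- The messages received by the server: the batch gradient from each good agent, an arbitrary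
vector from each Byzantine agent. -/
def messages {H B : ℕ} (X : Setting S A d H) (γ : ℝ) (good : Finset (Fin K)) (θ : Param d)
    (τ : Fin K → Fin B → Traj S A H) (m : Fin K → Param d) (k : Fin K) : Param d :=
  if k ∈ good then (B : ℝ)⁻¹ • ∑ i, X.g γ (τ k i) θ else m k

/-- Round `t` of FedPG-BR: the law of the new server parameter and of the memory of the adversary,
given the old ones. -/
def roundLaw (c : Constants) (X : Setting S A d c.H) {B : ℕ} (adv : Adversary S A Z d c.H K B)
    (good : Finset (Fin K)) (pick : Finset (Fin K) → Fin K) (α η δ : ℝ) (t : ℕ)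
    (x : Param d × Z) : Measure (Param d × Z) :=
  (Measure.pi fun _ : Fin K => Measure.pi fun _ : Fin B => X.trajLaw x.1).bind fun τ =>
    (adv.respond t (x.2, x.1, τ)).bind fun y =>
      (stepsLaw B).bind fun N =>
        (innerLaw X c.γ η x.1
          (aggregate pick α c.σ (2 * c.σ * √(V K δ / B)) (messages X c.γ good x.1 τ y.1))
          N).map fun θ' => (θ', y.2)

/-- The law of the server parameter `θ̃_t` and of the memory of the adversary after `t` rounds. -/
def runLaw (c : Constants) (X : Setting S A d c.H) {B : ℕ} (adv : Adversary S A Z d c.H K B)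
    (good : Finset (Fin K)) (pick : Finset (Fin K) → Fin K) (α η δ : ℝ) (θ₀ : Param d) :
    ℕ → Measure (Param d × Z)
  | 0 => adv.start.map fun z => (θ₀, z)
  | t + 1 => (runLaw c X adv good pick α η δ θ₀ t).bind
      (roundLaw c X adv good pick α η δ (t + 1))

/-- The law of the output `θ̃_a`, picked uniformly from `θ̃_1, …, θ̃_T`. -/
def outputLaw (c : Constants) (X : Setting S A d c.H) {B : ℕ} (adv : Adversary S A Z d c.H K B)
    (good : Finset (Fin K)) (pick : Finset (Fin K) → Fin K) (α η δ : ℝ) (θ₀ : Param d) (T : ℕ) :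
    Measure (Param d) :=
  (T : ℝ≥0∞)⁻¹ • ∑ t ∈ Finset.Icc 1 T, (runLaw c X adv good pick α η δ θ₀ t).map Prod.fst

end Algorithm

/-- The conditions on the batch size `B`, the step size `η` and the confidence parameter `δ`. -/
structure Admissible (c : Constants) (K B : ℕ) (η δ : ℝ) : Prop where
  one_le_B : 1 ≤ B
  B_large : 4 * c.Phi * (c.L ^ 2)⁻¹ ≤ B
  η_pos : 0 < η
  η_le : η ≤ 1 / (2 * c.Psi * (B : ℝ) ^ (2 / 3 : ℝ))
  δ_mem : δ ∈ Set.Ioo (0 : ℝ) 1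
  δ_lower : Real.exp (δ * B / (2 * (1 - 2 * δ))) ≤ 2 * K / δ
  δ_upper : 2 * K / δ ≤ Real.exp ((B : ℝ) / 2)
  δ_small : δ ≤ 1 / (5 * K * B)

/-- FedPG-BR with `K` agents, an `α`-fraction of them Byzantine, `T` rounds, batch size `B`, step
size `η` and confidence parameter `δ` reaches `E ‖∇J(θ̃_a)‖² ≤ ε`, on every problem that satisfies
the assumptions with the constants `c`, from every initial parameter, against every adversary and
for every way to break ties in the choice of the mean of median. -/
def Achieves (c : Constants) (K : ℕ) (α : ℝ) (T B : ℕ) (η δ ε : ℝ) : Prop :=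
  ∀ (S : Type u) (A : Type v) (Z : Type w)
    [MeasurableSpace S] [MeasurableSpace A] [MeasurableSpace Z]
    (d : ℕ) (X : Setting S A d c.H) (adv : Adversary S A Z d c.H K B)
    (good : Finset (Fin K)) (pick : Finset (Fin K) → Fin K) (θ₀ : Param d),
    Assumptions c X →
    (K : ℝ) - good.card ≤ α * K →
    (∀ s : Finset (Fin K), s.Nonempty → pick s ∈ s) →
    IsProbabilityMeasure (outputLaw c X adv good pick α η δ θ₀ T) ∧
    ∫⁻ θ, ENNReal.ofReal (‖gradient (X.J c.γ) θ‖ ^ 2) ∂(outputLaw c X adv good pick α η δ θ₀ T)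
      ≤ ENNReal.ofReal ε

/-- The expected number of trajectories in `T` rounds: `B` per round for the agent, and the `N_t`
trajectories of the inner loop of the server are counted as well. -/
def expectedTraj (T B : ℕ) : ℝ≥0∞ :=
  ∑ _t ∈ Finset.Icc 1 T, ((B : ℝ≥0∞) + ∫⁻ n, (n : ℝ≥0∞) ∂(stepsLaw B))

end FedPG

end

/-! The inner loop is a variance-reduced ascent. Write `θ₀` for the start of a round, `μ` for the
aggregate and `Λ` for `smooth`. The importance-corrected difference `gDiff` has mean `∇J(θ) -
∇J(θ₀)` and second moment at most `Λ² ‖θ - θ₀‖²`, so a step moves on average along `∇J(θ) + (μ -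
∇J(θ₀))`, with noise that is small near `θ₀`. The quadratic bound needs two regimes: far from `θ₀`
the variance bound `W` suffices, near `θ₀` the weight is close to `1` because the log-policy is
Lipschitz (`integral_weight_sub_one_sq_le`).

Subtracting a multiple of `‖θ - θ₀‖²` from `J` gives a Lyapunov function (`inner_step`). Its
distance term may grow by a factor `1 + 1/B` per step, which is exactly what the weights `Γ^n` of
the geometric stopping time cancel (`geometric_telescope`). The outcome, `inner_loop`, is
`E‖∇J(θ̃)‖² + (2/(ηB)) J(θ₀) ≤ (2/(ηB)) E J(θ̃) + ‖μ - ∇J(θ₀)‖²`. Summing over the rounds and using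
`0 ≤ J ≤ HR` bounds the output error by `2HR/(ηBT)` plus the mean squared error of the aggregate
(`lintegral_outputLaw_le`).

For the aggregate, put `ρ = σ √(V/B)`, let `β` bound the true Byzantine fraction, and take `a ≤ (1 -
2β)/2`. A dimension-free Hoeffding inequality (`measure_norm_sum_gt_le`) puts all good messages
within `aρ` of the gradient with high probability. Then all good agents are accepted, whatever the
others send, and the error is at most `2/K` times the norm of the sum of the good deviations plus
`8βρ` (`norm_aggregate_sub_le_of_concentrated`). On the exceptional event the almost sure bound `σ`
still gives `5σ`. The mean squared error is thus of order `σ²/(KB) + β²σ²V/B`, up to a negligible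
term.

It remains to choose parameters. `B` of order `1/(εK) + β²V/ε` makes the aggregation error at most
`3ε/4`; the Lyapunov argument allows `η` of order `B^(-2/3)`; so `T` of order `1/(ε B^(1/3))`
suffices, and `TB` is of order `B^(2/3)/ε`, which is the claim. The bound on `ε K log(2K)` ensures
`V ≤ B`. Keeping `β` apart from the server's `α` yields the case `K = 1`, where the only agent must
be good. -/

noncomputable section

namespace FedPG

/-! ### Measurability of families of probability measures. -/

section MeasurableFamilies

variable {α β γ : Type*} [MeasurableSpace α] [MeasurableSpace β] [MeasurableSpace γ]

theorem measurable_lintegral_param {μ : α → Measure β} (hμ : Measurable μ)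
    [∀ a, IsProbabilityMeasure (μ a)] {f : α → β → ℝ≥0∞}
    (hf : Measurable (Function.uncurry f)) : Measurable fun a => ∫⁻ b, f a b ∂(μ a) := by
  let κ : Kernel α β := ⟨μ, hμ⟩
  have : IsMarkovKernel κ := ⟨fun a => inferInstanceAs (IsProbabilityMeasure (μ a))⟩
  exact Measurable.lintegral_kernel_prod_right (κ := κ) hf

/-- A `bind` along a family that is not almost everywhere measurable is the zero measure. The laws
of the algorithm are nested binds, so each layer must be shown jointly measurable in its parameters
before it can be integrated. -/
theorem measurable_bind_param {μ : α → Measure β} (hμ : Measurable μ)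
    [∀ a, IsProbabilityMeasure (μ a)] {k : α → β → Measure γ}
    (hk : Measurable (Function.uncurry k)) : Measurable fun a => (μ a).bind (k a) := by
  refine Measure.measurable_of_measurable_coe _ fun s hs => ?_
  have h : ∀ a, Measurable (k a) := fun a => hk.comp measurable_prodMk_left
  simp_rw [fun a => Measure.bind_apply (m := μ a) hs (h a).aemeasurable]
  exact measurable_lintegral_param hμ ((Measure.measurable_coe hs).comp hk)

theorem measurable_map_param {μ : α → Measure β} (hμ : Measurable μ)
    [∀ a, IsProbabilityMeasure (μ a)] {k : α → β → γ}
    (hk : Measurable (Function.uncurry k)) : Measurable fun a => (μ a).map (k a) := by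
  have h : ∀ a, Measurable (k a) := fun a => hk.comp measurable_prodMk_left
  simp_rw [fun a => (Measure.bind_dirac_eq_map (μ a) (h a)).symm]
  exact measurable_bind_param hμ (Measure.measurable_dirac.comp hk)

theorem measurable_withDensity_param {ν : Measure β} [SFinite ν] {f : α → β → ℝ≥0∞}
    (hf : Measurable (Function.uncurry f)) : Measurable fun a => ν.withDensity (f a) := by
  refine Measure.measurable_of_measurable_coe _ fun s hs => ?_
  simp_rw [fun a => withDensity_apply (μ := ν) (f a) hs]
  exact Measurable.lintegral_prod_right' (f := Function.uncurry f) hf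

theorem measurable_pi_param {ι : Type*} [Fintype ι] {μ : α → Measure β} (hμ : Measurable μ)
    [∀ a, IsProbabilityMeasure (μ a)] : Measurable fun a => Measure.pi fun _ : ι => μ a := by
  refine Measurable.measure_of_isPiSystem_of_isProbabilityMeasure generateFrom_pi.symm
    isPiSystem_pi ?_
  rintro _ ⟨s, hs, rfl⟩
  simp_rw [Measure.pi_pi]
  exact Finset.measurable_prod _ fun i _ =>
    (Measure.measurable_coe (hs i (Set.mem_univ i))).comp hμ

theorem lintegral_bind_map {μ : Measure α} {k : α → Measure β} (hk : Measurable k)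
    {f : β → ℝ≥0∞} (hf : Measurable f) :
    ∫⁻ b, f b ∂(μ.bind k) = ∫⁻ a, ∫⁻ b, f b ∂(k a) ∂μ :=
  Measure.lintegral_bind hk.aemeasurable hf.aemeasurable

theorem isProbabilityMeasure_bind_of_measurable {μ : Measure α} [IsProbabilityMeasure μ]
    {k : α → Measure β} (hk : Measurable k) (h : ∀ a, IsProbabilityMeasure (k a)) :
    IsProbabilityMeasure (μ.bind k) :=
  isProbabilityMeasure_bind hk.aemeasurable (ae_of_all _ h)

end MeasurableFamilies

/-! ### The trajectory law and change of policy. -/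

section TrajectoryLaw

variable {S A Θ : Type*} [MeasurableSpace S] [MeasurableSpace A] [MeasurableSpace Θ]

theorem measurable_cons {n : ℕ} :
    Measurable fun q : (S × A) × Traj S A n => (Fin.cons q.1 q.2 : Traj S A (n + 1)) := by
  refine measurable_pi_iff.2 fun i => ?_
  refine Fin.cases ?_ (fun j => ?_) i
  · simpa using measurable_fst
  · simp only [Fin.cons_succ]
    exact (measurable_pi_apply j).comp measurable_snd

theorem measurable_cons_left {n : ℕ} (x : S × A) :
    Measurable fun τ : Traj S A n => (Fin.cons x τ : Traj S A (n + 1)) :=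
  measurable_cons.comp measurable_prodMk_left

/-- One step of the trajectory after the first action has been drawn. -/
def trajStep (P : Kernel (S × A) S) (ν : Measure A) (p : S → A → ℝ) (n : ℕ) (s : S) (a : A) :
    Measure (Traj S A (n + 1)) :=
  (P (s, a)).bind fun s' =>
    (trajFrom P ν p n s').map fun τ => (Fin.cons (s, a) τ : Traj S A (n + 1))

theorem trajFrom_succ (P : Kernel (S × A) S) (ν : Measure A) (p : S → A → ℝ) (n : ℕ) (s : S) :
    trajFrom P ν p (n + 1) s =
      (ν.withDensity fun a => ENNReal.ofReal (p s a)).bind (trajStep P ν p n s) := rfl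

theorem trajStep_prob_and_measurable (P : Kernel (S × A) S) [IsMarkovKernel P] (ν : Measure A)
    {p : Θ → S → A → ℝ} (n : ℕ) (ihp : ∀ θ s, IsProbabilityMeasure (trajFrom P ν (p θ) n s))
    (ihm : Measurable fun q : Θ × S => trajFrom P ν (p q.1) n q.2) :
    (∀ θ s a, IsProbabilityMeasure (trajStep P ν (p θ) n s a)) ∧
      Measurable fun q : Θ × S × A => trajStep P ν (p q.1) n q.2.1 q.2.2 := by
  have hmap : Measurable fun q : (Θ × S × A) × S =>
      (trajFrom P ν (p q.1.1) n q.2).map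
        fun τ => (Fin.cons (q.1.2.1, q.1.2.2) τ : Traj S A (n + 1)) := by
    have := ihp
    have h' : Measurable fun q : (Θ × S × A) × S => trajFrom P ν (p q.1.1) n q.2 :=
      ihm.comp (by fun_prop : Measurable fun q : (Θ × S × A) × S => (q.1.1, q.2))
    refine measurable_map_param h' (k := fun (q : (Θ × S × A) × S) τ =>
      (Fin.cons (q.1.2.1, q.1.2.2) τ : Traj S A (n + 1))) ?_
    exact measurable_cons.comp (by fun_prop :
      Measurable fun x : ((Θ × S × A) × S) × Traj S A n => ((x.1.1.2.1, x.1.1.2.2), x.2))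
  have hmapp : ∀ q : (Θ × S × A) × S, IsProbabilityMeasure
      ((trajFrom P ν (p q.1.1) n q.2).map
        fun τ => (Fin.cons (q.1.2.1, q.1.2.2) τ : Traj S A (n + 1))) := fun q => by
    have := ihp q.1.1 q.2
    exact Measure.isProbabilityMeasure_map
      (measurable_cons_left _).aemeasurable
  have hbind : Measurable fun q : Θ × S × A => trajStep P ν (p q.1) n q.2.1 q.2.2 :=
    measurable_bind_param (μ := fun q : Θ × S × A => P (q.2.1, q.2.2))
      (P.measurable.comp (by fun_prop)) hmap
  have hbindp : ∀ θ s a, IsProbabilityMeasure (trajStep P ν (p θ) n s a) :=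
    fun θ s a => isProbabilityMeasure_bind_of_measurable
      (hmap.comp (measurable_prodMk_left (x := (θ, s, a))))
      fun s' => hmapp ((θ, s, a), s')
  exact ⟨hbindp, hbind⟩

/-- Both properties go through one induction, because measurability of a bind is available only for
probability measures. The parameter space `Θ` is left free: it is `Param d` for the dependence on
the policy parameter and `Unit` for a fixed policy. -/
theorem trajFrom_prob_and_measurable (P : Kernel (S × A) S) [IsMarkovKernel P] (ν : Measure A)
    [SigmaFinite ν] {p : Θ → S → A → ℝ}
    (hp : Measurable fun q : Θ × S × A => p q.1 q.2.1 q.2.2)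
    (h1 : ∀ θ s, ∫⁻ a, ENNReal.ofReal (p θ s a) ∂ν = 1) (n : ℕ) :
    (∀ θ s, IsProbabilityMeasure (trajFrom P ν (p θ) n s)) ∧
      Measurable fun q : Θ × S => trajFrom P ν (p q.1) n q.2 := by
  induction n with
  | zero =>
    exact ⟨fun θ s => by unfold trajFrom; infer_instance, by
      unfold trajFrom; exact measurable_const⟩
  | succ n ih =>
    obtain ⟨ihp, ihm⟩ := ih
    have hdens : ∀ θ s, IsProbabilityMeasure
        (ν.withDensity fun a => ENNReal.ofReal (p θ s a)) := fun θ s =>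
      ⟨by rw [withDensity_apply _ .univ, Measure.restrict_univ, h1 θ s]⟩
    have hdensm : Measurable fun q : Θ × S =>
        ν.withDensity fun a => ENNReal.ofReal (p q.1 q.2 a) := by
      refine measurable_withDensity_param (f := fun (q : Θ × S) a =>
        ENNReal.ofReal (p q.1 q.2 a)) ?_
      exact ENNReal.measurable_ofReal.comp
        (hp.comp (by fun_prop : Measurable fun x : (Θ × S) × A => (x.1.1, x.1.2, x.2)))
    obtain ⟨hstepp, hstep⟩ := trajStep_prob_and_measurable P ν n ihp ihm
    simp_rw [trajFrom_succ]
    refine ⟨fun θ s => ?_, ?_⟩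
    · have := hdens θ s
      have hb := hstep.comp (by fun_prop : Measurable fun a : A => (θ, s, a))
      simp only [Function.comp_def] at hb
      exact isProbabilityMeasure_bind_of_measurable hb fun a => hstepp θ s a
    · have := fun q : Θ × S => hdens q.1 q.2
      have hb := hstep.comp
        (by fun_prop : Measurable fun q : (Θ × S) × A => (q.1.1, q.1.2, q.2))
      exact measurable_bind_param (k := fun (q : Θ × S) (a : A) =>
          trajStep P ν (p q.1) n q.2 a) hdensm hb

variable (P : Kernel (S × A) S) [IsMarkovKernel P] (ν : Measure A) [SigmaFinite ν]
  {p p' : S → A → ℝ} (hp : Measurable fun q : S × A => p q.1 q.2)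
  (h1 : ∀ s, ∫⁻ a, ENNReal.ofReal (p s a) ∂ν = 1)

include hp h1

theorem trajFrom_prob (n : ℕ) (s : S) : IsProbabilityMeasure (trajFrom P ν p n s) :=
  (trajFrom_prob_and_measurable (Θ := Unit) P ν (p := fun _ => p)
    (hp.comp measurable_snd) (fun _ => h1) n).1 () s

theorem measurable_trajFrom (n : ℕ) : Measurable (trajFrom P ν p n) :=
  (trajFrom_prob_and_measurable (Θ := Unit) P ν (p := fun _ => p)
    (hp.comp measurable_snd) (fun _ => h1) n).2.comp (measurable_prodMk_left (x := ()))

theorem measurable_map_cons_trajFrom (n : ℕ) (x : S × A) : Measurable fun s' =>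
    (trajFrom P ν p n s').map fun τ => (Fin.cons x τ : Traj S A (n + 1)) :=
  (Measure.measurable_map _ (measurable_cons_left x)).comp
    (measurable_trajFrom P ν hp h1 n)

theorem measurable_trajStep (n : ℕ) (s : S) : Measurable (trajStep P ν p n s) := by
  have := trajFrom_prob P ν hp h1 n
  have h := measurable_map_param (μ := fun q : A × S => trajFrom P ν p n q.2)
    ((measurable_trajFrom P ν hp h1 n).comp measurable_snd)
    (k := fun q τ => (Fin.cons (s, q.1) τ : Traj S A (n + 1)))
    (measurable_cons.comp (by fun_prop :
      Measurable fun x : (A × S) × Traj S A n => ((s, x.1.1), x.2)))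
  exact measurable_bind_param (μ := fun a => P (s, a)) (P.measurable.comp (by fun_prop)) h

theorem lintegral_trajStep (n : ℕ) (s : S) (a : A) {F : Traj S A (n + 1) → ℝ≥0∞}
    (hF : Measurable F) : ∫⁻ τ, F τ ∂(trajStep P ν p n s a) =
      ∫⁻ s', ∫⁻ τ, F (Fin.cons (s, a) τ) ∂(trajFrom P ν p n s') ∂(P (s, a)) := by
  rw [trajStep, lintegral_bind_map (measurable_map_cons_trajFrom P ν hp h1 n (s, a)) hF]
  refine lintegral_congr fun s' => ?_
  rw [lintegral_map hF (measurable_cons_left _)]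

theorem lintegral_trajFrom_succ (n : ℕ) (s : S) {F : Traj S A (n + 1) → ℝ≥0∞}
    (hF : Measurable F) : ∫⁻ τ, F τ ∂(trajFrom P ν p (n + 1) s) =
      ∫⁻ a, ENNReal.ofReal (p s a) * ∫⁻ τ, F τ ∂(trajStep P ν p n s a) ∂ν := by
  have hs := measurable_trajStep P ν hp h1 n s
  rw [trajFrom_succ, lintegral_bind_map hs hF]
  exact lintegral_withDensity_eq_lintegral_mul _
    (ENNReal.measurable_ofReal.comp (hp.comp measurable_prodMk_left))
    ((Measure.measurable_lintegral hF).comp hs)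

/-- Change of the policy on the first `m` steps, for functions of the first `m` steps. -/
theorem lintegral_trajFrom_change (hp' : Measurable fun q : S × A => p' q.1 q.2)
    (h1' : ∀ s, ∫⁻ a, ENNReal.ofReal (p' s a) ∂ν = 1) (hpos : ∀ s a, 0 < p s a) (n : ℕ) :
    ∀ (m : ℕ) (s : S) (F : Traj S A n → ℝ≥0∞), Measurable F →
      (∀ τ τ' : Traj S A n, (∀ i : Fin n, (i : ℕ) < m → τ i = τ' i) → F τ = F τ') →
      ∫⁻ τ, F τ ∂(trajFrom P ν p' n s) =
        ∫⁻ τ, (∏ i : Fin n, if (i : ℕ) < m then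
          ENNReal.ofReal (p' (τ i).1 (τ i).2 / p (τ i).1 (τ i).2) else 1) * F τ
          ∂(trajFrom P ν p n s) := by
  have hr : Measurable fun x : S × A => ENNReal.ofReal (p' x.1 x.2 / p x.1 x.2) :=
    ENNReal.measurable_ofReal.comp (hp'.div hp)
  induction n with
  | zero => intro m s F hF _; simp [trajFrom]
  | succ n ih =>
    intro m s F hF hdep
    have := trajFrom_prob P ν hp h1 (n + 1) s
    have := trajFrom_prob P ν hp' h1' (n + 1) s
    -- For `m = 0` the function is constant and both laws have mass one.
    obtain _ | m := m
    · obtain ⟨τ₀⟩ := nonempty_of_isProbabilityMeasure (trajFrom P ν p (n + 1) s)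
      have hc : ∀ τ, F τ = F τ₀ := fun τ => hdep _ _ fun i hi => absurd hi (by omega)
      simp only [Nat.not_lt_zero, if_false, Finset.prod_const_one, one_mul]
      rw [lintegral_congr hc, lintegral_congr hc]
      simp
    have hprod : ∀ k l, Measurable fun τ : Traj S A k => ∏ i : Fin k, if (i : ℕ) < l then
        ENNReal.ofReal (p' (τ i).1 (τ i).2 / p (τ i).1 (τ i).2) else 1 := fun k l =>
      Finset.measurable_prod _ fun i _ => by
        split_ifs
        · exact hr.comp (measurable_pi_apply i)
        · exact measurable_const
    have hF' : Measurable fun τ : Traj S A (n + 1) => (∏ i : Fin (n + 1), if (i : ℕ) < m + 1 then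
        ENNReal.ofReal (p' (τ i).1 (τ i).2 / p (τ i).1 (τ i).2) else 1) * F τ :=
      (hprod _ _).mul hF
    rw [lintegral_trajFrom_succ P ν hp' h1' n s hF, lintegral_trajFrom_succ P ν hp h1 n s hF']
    refine lintegral_congr fun a => ?_
    rw [lintegral_trajStep P ν hp' h1' n s a hF, lintegral_trajStep P ν hp h1 n s a hF']
    have hcons : Measurable fun τ : Traj S A n => (Fin.cons (s, a) τ : Traj S A (n + 1)) :=
      measurable_cons_left _
    -- The ratio of the first step comes out of the integral; the remaining product runs over the
    -- first `m` steps of the tail and is absorbed by the induction hypothesis.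
    have key : ∀ s', ∫⁻ τ, (∏ i : Fin (n + 1), if (i : ℕ) < m + 1 then
          ENNReal.ofReal (p' ((Fin.cons (s, a) τ : Traj S A (n + 1)) i).1
            ((Fin.cons (s, a) τ : Traj S A (n + 1)) i).2 /
            p ((Fin.cons (s, a) τ : Traj S A (n + 1)) i).1
              ((Fin.cons (s, a) τ : Traj S A (n + 1)) i).2) else 1) *
          F (Fin.cons (s, a) τ) ∂(trajFrom P ν p n s') =
        ENNReal.ofReal (p' s a / p s a) *
          ∫⁻ τ, F (Fin.cons (s, a) τ) ∂(trajFrom P ν p' n s') := by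
      intro s'
      have hG : Measurable fun τ : Traj S A n => (∏ i : Fin n, if (i : ℕ) < m then
          ENNReal.ofReal (p' (τ i).1 (τ i).2 / p (τ i).1 (τ i).2) else 1) *
          F (Fin.cons (s, a) τ) := (hprod n m).mul (hF.comp hcons)
      rw [ih m s' (fun τ => F (Fin.cons (s, a) τ)) (hF.comp hcons) ?_,
        ← lintegral_const_mul _ hG]
      · refine lintegral_congr fun τ => ?_
        simp [Fin.prod_univ_succ, mul_assoc]
      · intro τ τ' h
        refine hdep _ _ fun i => Fin.cases (fun _ => rfl) (fun j hj => ?_) i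
        simpa using h j (by simpa using hj)
    simp_rw [key]
    have hI : Measurable fun s' => ∫⁻ τ, F (Fin.cons (s, a) τ) ∂(trajFrom P ν p' n s') :=
      (Measure.measurable_lintegral (hF.comp hcons)).comp (measurable_trajFrom P ν hp' h1' n)
    rw [lintegral_const_mul _ hI, ← mul_assoc, ← ENNReal.ofReal_mul (hpos s a).le,
      mul_div_cancel₀ _ (hpos s a).ne']

end TrajectoryLaw

end FedPG

namespace FedPG

/-! ### Regularity of the log-policy and of the score. -/

section PolicyRegularity

variable {S A : Type*} [MeasurableSpace S] [MeasurableSpace A] {d : ℕ} {c : Constants}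
  {X : Setting S A d c.H}

/-- The log-likelihood `log π_θ(a | s)`. -/
def Setting.logp {S A : Type*} [MeasurableSpace S] [MeasurableSpace A] {d H : ℕ}
    (X : Setting S A d H) (θ : Param d) (x : S × A) : ℝ := Real.log (X.policy θ x.1 x.2)

variable (hX : Assumptions c X)
include hX

theorem policy_eq_exp (θ : Param d) (s : S) (a : A) :
    X.policy θ s a = Real.exp (X.logp θ (s, a)) :=
  (Real.exp_log (hX.policy_pos θ s a)).symm

/-- A Carathéodory function: measurable in `(s, a)` and continuous in `θ`, hence jointly measurable.
-/
theorem measurable_policy : Measurable fun q : Param d × S × A => X.policy q.1 q.2.1 q.2.2 := by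
  refine measurable_uncurry_of_continuous_of_measurable
    (u := fun θ (x : S × A) => X.policy θ x.1 x.2) (fun x => ?_) hX.policy_measurable
  simp_rw [policy_eq_exp hX]
  exact Real.continuous_exp.comp (hX.diff x.1 x.2).continuous

theorem hasFDerivAt_logp (θ : Param d) (x : S × A) :
    HasFDerivAt (fun θ' => X.logp θ' x) (InnerProductSpace.toDual ℝ _ (X.score θ x)) θ := by
  have h := (hX.diff x.1 x.2 θ).hasFDerivAt
  rwa [← toDual_gradient] at h

theorem norm_score_le (θ : Param d) (x : S × A) : ‖X.score θ x‖ ≤ c.G := hX.score_bound _ _ _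

theorem norm_score_sub_le (θ θ' : Param d) (x : S × A) :
    ‖X.score θ' x - X.score θ x‖ ≤ c.M * ‖θ' - θ‖ := by
  have h := Convex.norm_image_sub_le_of_norm_fderiv_le (𝕜 := ℝ) (s := Set.univ)
    (fun y _ => hX.diff_two x.1 x.2 y) (fun y _ => hX.hess_bound x.1 x.2 y) convex_univ
    (Set.mem_univ θ) (Set.mem_univ θ')
  have e : X.score θ' x - X.score θ x = (InnerProductSpace.toDual ℝ (Param d)).symm
      (fderiv ℝ (fun θ => Real.log (X.policy θ x.1 x.2)) θ' -
        fderiv ℝ (fun θ => Real.log (X.policy θ x.1 x.2)) θ) := by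
    rw [map_sub]; rfl
  rwa [e, LinearIsometryEquiv.norm_map]

theorem abs_logp_sub_le (θ θ' : Param d) (x : S × A) :
    |X.logp θ' x - X.logp θ x| ≤ c.G * ‖θ' - θ‖ := by
  refine Convex.norm_image_sub_le_of_norm_fderiv_le (𝕜 := ℝ) (f := fun θ => X.logp θ x)
    (s := Set.univ) (fun y _ => hX.diff x.1 x.2 y) (fun y _ => ?_) convex_univ
    (Set.mem_univ θ) (Set.mem_univ θ')
  rw [(hasFDerivAt_logp hX y x).fderiv, LinearIsometryEquiv.norm_map]
  exact norm_score_le hX y x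

/-- Again a Carathéodory function. It is Lipschitz in `θ` by the Hessian bound; for fixed `θ` its
inner product with any vector is a pointwise limit of difference quotients of measurable
log-policies. -/
theorem measurable_score : Measurable fun q : Param d × S × A => X.score q.1 q.2 := by
  refine measurable_uncurry_of_continuous_of_measurable
    (u := fun θ (x : S × A) => X.score θ x) (fun x => ?_) fun θ => ?_
  · refine (LipschitzWith.of_dist_le_mul (K := ⟨c.M, c.M_pos.le⟩) fun θ θ' => ?_).continuous
    rw [dist_eq_norm, dist_eq_norm]
    exact norm_score_sub_le hX θ' θ x
  · have hlog : ∀ θ, Measurable (X.logp θ) := fun θ =>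
      Real.measurable_log.comp (hX.policy_measurable θ)
    have hin : ∀ v : Param d, Measurable fun x => inner ℝ (X.score θ x) v := by
      intro v
      refine measurable_of_tendsto_metrizable (f := fun (n : ℕ) x =>
        (n : ℝ) * (X.logp (θ + (n : ℝ)⁻¹ • v) x - X.logp θ x))
        (fun n => ((hlog _).sub (hlog _)).const_mul _) ?_
      rw [tendsto_pi_nhds]
      intro x
      exact ((hasFDerivAt_logp hX θ x).lim_real v).comp tendsto_natCast_atTop_atTop
    have hb : X.score θ = fun x => ∑ i, inner ℝ (X.score θ x) (EuclideanSpace.basisFun (Fin d) ℝ i)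
        • EuclideanSpace.basisFun (Fin d) ℝ i := by
      funext x
      rw [← (EuclideanSpace.basisFun (Fin d) ℝ).sum_repr' (X.score θ x)]
      refine Finset.sum_congr rfl fun i _ => ?_
      rw [OrthonormalBasis.sum_repr', real_inner_comm]
    rw [hb]
    exact Finset.measurable_sum _ fun i _ => (hin _).smul_const _

end PolicyRegularity

/-! ### Importance weights of trajectories. -/

section TrajLaw

variable {S A : Type*} [MeasurableSpace S] [MeasurableSpace A] {d : ℕ} {c : Constants}
  {X : Setting S A d c.H} (hX : Assumptions c X)
include hX

theorem trajLaw_prob_and_measurable :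
    (∀ θ, IsProbabilityMeasure (X.trajLaw θ)) ∧ Measurable X.trajLaw := by
  have := hX.trans_markov
  have := hX.ref_sigmaFinite
  have := hX.start_prob
  obtain ⟨hp, hm⟩ := trajFrom_prob_and_measurable X.trans X.ref (p := X.policy)
    (measurable_policy hX) hX.policy_mass c.H
  refine ⟨fun θ => ?_, ?_⟩
  · exact isProbabilityMeasure_bind_of_measurable (hm.comp measurable_prodMk_left) (hp θ)
  · exact measurable_bind_param measurable_const hm

theorem trajLaw_prob (θ : Param d) : IsProbabilityMeasure (X.trajLaw θ) :=
  (trajLaw_prob_and_measurable hX).1 θ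

theorem measurable_trajLaw : Measurable X.trajLaw := (trajLaw_prob_and_measurable hX).2

omit hX in
/-- The importance weight of the first `m` steps. -/
def Setting.weightUpTo (X : Setting S A d c.H) (m : ℕ) (τ : Traj S A c.H) (θ₁ θ₂ : Param d) : ℝ :=
  Real.exp (∑ h : Fin c.H with h.val < m, (X.logp θ₂ (τ h) - X.logp θ₁ (τ h)))

theorem weight_eq_weightUpTo (τ : Traj S A c.H) (θ₁ θ₂ : Param d) :
    X.weight τ θ₁ θ₂ = X.weightUpTo c.H τ θ₁ θ₂ := by
  rw [Setting.weightUpTo, Setting.weight, Real.exp_sum]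
  rw [Finset.filter_true_of_mem fun h _ => h.2]
  refine Finset.prod_congr rfl fun h _ => ?_
  rw [Real.exp_sub, policy_eq_exp hX, policy_eq_exp hX]

theorem abs_sum_logp_sub_le (m : ℕ) (τ : Traj S A c.H) (θ θ' : Param d) :
    |∑ h : Fin c.H with h.val < m, (X.logp θ' (τ h) - X.logp θ (τ h))| ≤
      c.H * c.G * ‖θ' - θ‖ := by
  refine (Finset.abs_sum_le_sum_abs _ _).trans ?_
  refine (Finset.sum_le_card_nsmul _ _ (c.G * ‖θ' - θ‖)
    fun h _ => abs_logp_sub_le hX θ θ' (τ h)).trans ?_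
  rw [nsmul_eq_mul, mul_assoc]
  have hc : (Finset.card {h : Fin c.H | h.val < m} : ℝ) ≤ c.H := by
    exact_mod_cast (Finset.card_le_univ _).trans (by simp)
  exact mul_le_mul_of_nonneg_right hc (mul_nonneg c.G_pos.le (norm_nonneg _))

theorem weightUpTo_le (m : ℕ) (τ : Traj S A c.H) (θ θ' : Param d) :
    X.weightUpTo m τ θ θ' ≤ Real.exp (c.H * c.G * ‖θ' - θ‖) :=
  Real.exp_le_exp.2 ((le_abs_self _).trans (abs_sum_logp_sub_le hX m τ θ θ'))

/-- The log-weight `y` satisfies `|y| ≤ b` with `b = H G ‖θ' - θ‖`, and then `|e^y - 1| ≤ b e^b`.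
The factor `b` is what `W` alone cannot give: the weight tends to `1` as `θ'` tends to `θ`. -/
theorem abs_weight_sub_one_le (τ : Traj S A c.H) (θ θ' : Param d) :
    |X.weight τ θ θ' - 1| ≤
      c.H * c.G * ‖θ' - θ‖ * Real.exp (c.H * c.G * ‖θ' - θ‖) := by
  rw [weight_eq_weightUpTo hX, Setting.weightUpTo]
  have h := abs_sum_logp_sub_le hX c.H τ θ θ'
  set y := ∑ h : Fin c.H with h.val < c.H, (X.logp θ' (τ h) - X.logp θ (τ h))
  set b := c.H * c.G * ‖θ' - θ‖
  have hb : 0 ≤ b := (abs_nonneg _).trans h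
  obtain ⟨h1, h2⟩ := abs_le.1 h
  have e1 : 1 - y ≤ Real.exp (-y) := by linarith [Real.add_one_le_exp (-y)]
  have e2 := Real.add_one_le_exp y
  have e3 : Real.exp y ≤ Real.exp b := Real.exp_le_exp.2 h2
  have e4 : 1 ≤ Real.exp b := Real.one_le_exp hb
  have e5 : Real.exp y * Real.exp (-y) = 1 := by rw [← Real.exp_add]; simp
  have e6 := Real.exp_pos y
  rw [abs_le]
  constructor
  · nlinarith
  · have : Real.exp y - 1 ≤ y * Real.exp y := by nlinarith
    nlinarith

theorem measurable_logp : Measurable fun q : Param d × S × A => X.logp q.1 q.2 :=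
  Real.measurable_log.comp (measurable_policy hX)

theorem measurable_weightUpTo (m : ℕ) :
    Measurable fun q : Traj S A c.H × Param d × Param d =>
      X.weightUpTo m q.1 q.2.1 q.2.2 := by
  refine Real.measurable_exp.comp (Finset.measurable_sum _ fun h _ => ?_)
  have hl := measurable_logp hX
  exact (hl.comp (by fun_prop : Measurable fun q : Traj S A c.H × Param d × Param d =>
      (q.2.2, q.1 h))).sub
    (hl.comp (by fun_prop : Measurable fun q : Traj S A c.H × Param d × Param d =>
      (q.2.1, q.1 h)))

theorem measurable_weight :
    Measurable fun q : Traj S A c.H × Param d × Param d => X.weight q.1 q.2.1 q.2.2 := by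
  simp_rw [weight_eq_weightUpTo hX]
  exact measurable_weightUpTo hX c.H

theorem lintegral_trajLaw_change (m : ℕ) (θ θ' : Param d) {F : Traj S A c.H → ℝ≥0∞}
    (hF : Measurable F)
    (hdep : ∀ τ τ' : Traj S A c.H, (∀ i : Fin c.H, (i : ℕ) < m → τ i = τ' i) → F τ = F τ') :
    ∫⁻ τ, F τ ∂(X.trajLaw θ') =
      ∫⁻ τ, ENNReal.ofReal (X.weightUpTo m τ θ θ') * F τ ∂(X.trajLaw θ) := by
  have := hX.trans_markov
  have := hX.ref_sigmaFinite
  have := hX.start_prob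
  have hw : Measurable fun τ => ENNReal.ofReal (X.weightUpTo m τ θ θ') * F τ :=
    (ENNReal.measurable_ofReal.comp ((measurable_weightUpTo hX m).comp
      (by fun_prop : Measurable fun τ : Traj S A c.H => (τ, θ, θ')))).mul hF
  have hk : ∀ θ, Measurable fun s => trajFrom X.trans X.ref (X.policy θ) c.H s := fun θ =>
    measurable_trajFrom X.trans X.ref (hX.policy_measurable θ) (hX.policy_mass θ) c.H
  rw [Setting.trajLaw, Setting.trajLaw, lintegral_bind_map (hk θ') hF,
    lintegral_bind_map (hk θ) hw]
  refine lintegral_congr fun s => ?_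
  rw [lintegral_trajFrom_change X.trans X.ref (hX.policy_measurable θ) (hX.policy_mass θ)
    (hX.policy_measurable θ') (hX.policy_mass θ') (hX.policy_pos θ) c.H m s F hF hdep]
  refine lintegral_congr fun τ => ?_
  rw [Setting.weightUpTo, Real.exp_sum,
    ENNReal.ofReal_prod_of_nonneg fun _ _ => (Real.exp_pos _).le, Finset.prod_filter]
  congr 1
  refine Finset.prod_congr rfl fun h _ => ?_
  rw [Real.exp_sub, policy_eq_exp hX, policy_eq_exp hX]

theorem trajLaw_eq_withDensity (θ θ' : Param d) :
    X.trajLaw θ' = (X.trajLaw θ).withDensity fun τ => ENNReal.ofReal (X.weight τ θ θ') := by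
  refine Measure.ext fun s hs => ?_
  rw [withDensity_apply _ hs, ← lintegral_indicator_one hs,
    lintegral_trajLaw_change hX c.H θ θ' (measurable_one.indicator hs)
      (fun τ τ' h => by rw [funext fun i => h i i.2]),
    ← lintegral_indicator hs]
  refine lintegral_congr fun τ => ?_
  by_cases h : τ ∈ s <;> simp [h, weight_eq_weightUpTo hX]

theorem integral_trajLaw_change {E : Type*} [NormedAddCommGroup E] [NormedSpace ℝ E]
    (θ θ' : Param d) (f : Traj S A c.H → E) :
    ∫ τ, f τ ∂(X.trajLaw θ') = ∫ τ, X.weight τ θ θ' • f τ ∂(X.trajLaw θ) := by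
  have hm : Measurable fun τ => ENNReal.ofReal (X.weight τ θ θ') :=
    ENNReal.measurable_ofReal.comp ((measurable_weight hX).comp
      (by fun_prop : Measurable fun τ : Traj S A c.H => (τ, θ, θ')))
  rw [trajLaw_eq_withDensity hX θ θ', integral_withDensity_eq_integral_toReal_smul hm
    (ae_of_all _ fun _ => ENNReal.ofReal_lt_top)]
  refine integral_congr_ae (ae_of_all _ fun τ => ?_)
  simp only
  rw [ENNReal.toReal_ofReal]
  rw [weight_eq_weightUpTo hX]
  exact (Real.exp_pos _).le

/-- A function of the first `m` steps is reweighted by these steps only. Differentiating the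
truncated weight therefore produces only the scores of those steps, as GPOMDP requires. -/
theorem integral_trajLaw_change_upTo (m : ℕ) (θ θ' : Param d) {f : Traj S A c.H → ℝ}
    (hf : Measurable f) {C : ℝ} (hC : ∀ τ, |f τ| ≤ C)
    (hdep : ∀ τ τ' : Traj S A c.H, (∀ i : Fin c.H, (i : ℕ) < m → τ i = τ' i) → f τ = f τ') :
    ∫ τ, f τ ∂(X.trajLaw θ') = ∫ τ, X.weightUpTo m τ θ θ' * f τ ∂(X.trajLaw θ) := by
  have := trajLaw_prob hX
  have hwm : Measurable fun τ => X.weightUpTo m τ θ θ' := (measurable_weightUpTo hX m).comp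
      (by fun_prop : Measurable fun τ : Traj S A c.H => (τ, θ, θ'))
  have hw0 : ∀ τ, 0 ≤ X.weightUpTo m τ θ θ' := fun τ => (Real.exp_pos _).le
  have key : ∀ g : Traj S A c.H → ℝ, Measurable g → (∀ τ, 0 ≤ g τ) →
      (∀ τ τ' : Traj S A c.H, (∀ i : Fin c.H, (i : ℕ) < m → τ i = τ' i) → g τ = g τ') →
      ∫ τ, g τ ∂(X.trajLaw θ') = ∫ τ, X.weightUpTo m τ θ θ' * g τ ∂(X.trajLaw θ) := by
    intro g hg h0 hd
    rw [integral_eq_lintegral_of_nonneg_ae (ae_of_all _ h0) hg.aestronglyMeasurable,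
      integral_eq_lintegral_of_nonneg_ae (ae_of_all _ fun τ => mul_nonneg (hw0 τ) (h0 τ))
        (hwm.mul hg).aestronglyMeasurable,
      lintegral_trajLaw_change hX m θ θ' (F := fun τ => ENNReal.ofReal (g τ))
        (ENNReal.measurable_ofReal.comp hg)
        fun τ τ' h => by rw [hd τ τ' h]]
    simp_rw [ENNReal.ofReal_mul (hw0 _)]
  have hfi : ∀ θ, Integrable f (X.trajLaw θ) := fun θ =>
    Integrable.of_bound hf.aestronglyMeasurable C (ae_of_all _ hC)
  have hwi : Integrable (fun τ => X.weightUpTo m τ θ θ') (X.trajLaw θ) :=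
    Integrable.of_bound hwm.aestronglyMeasurable _
      (ae_of_all _ fun τ => by
        rw [Real.norm_of_nonneg (hw0 τ)]; exact weightUpTo_le hX m τ θ θ')
  have hwfi : Integrable (fun τ => X.weightUpTo m τ θ θ' * f τ) (X.trajLaw θ) :=
    hwi.mul_bdd hf.aestronglyMeasurable (ae_of_all _ hC)
  -- Adding `C` makes `f` nonnegative; the contribution of the constant is then removed by the same
  -- identity.
  have h1 := key (fun τ => f τ + C) (hf.add_const C)
    (fun τ => by linarith [(abs_le.1 (hC τ)).1]) (fun τ τ' h => by rw [hdep τ τ' h])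
  have h2 := key (fun _ => C) measurable_const
    (fun τ => (abs_nonneg _).trans (hC τ)) (fun _ _ _ => rfl)
  simp_rw [mul_add] at h1
  rw [integral_add (hfi θ') (integrable_const C), integral_add hwfi (hwi.mul_const C)] at h1
  linarith

end TrajLaw

end FedPG

/-! ### The policy gradient theorem and the two estimators. -/

namespace FedPG

variable {S A : Type*} [MeasurableSpace S] [MeasurableSpace A] {d : ℕ} {c : Constants}

/-- The sum of the scores of the first `m` steps. -/
def Setting.scoreSum (X : Setting S A d c.H) (m : ℕ) (θ : Param d) (τ : Traj S A c.H) : Param d :=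
  ∑ h : Fin c.H with h.val < m, X.score θ (τ h)

/-- The coefficients of the scores in the gradient estimator have total size at most
`H (R + C_b)`. -/
def Constants.coef (c : Constants) : ℝ := c.H * (c.R + c.Cb)

theorem Constants.one_le_H' (c : Constants) : (1 : ℝ) ≤ c.H := by exact_mod_cast c.one_le_H

theorem Constants.coef_pos (c : Constants) : 0 < c.coef :=
  mul_pos (by linarith [c.one_le_H']) (by linarith [c.R_pos, c.Cb_nonneg])

variable {X : Setting S A d c.H} (hX : Assumptions c X)
include hX

omit [MeasurableSpace S] [MeasurableSpace A] hX in
theorem card_filter_lt_le (m : ℕ) : (Finset.card {h : Fin c.H | h.val < m} : ℝ) ≤ c.H := by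
  exact_mod_cast (Finset.card_le_univ _).trans (by simp)

theorem norm_scoreSum_le (m : ℕ) (θ : Param d) (τ : Traj S A c.H) :
    ‖X.scoreSum m θ τ‖ ≤ c.H * c.G := by
  refine (norm_sum_le_of_le _ fun h _ => norm_score_le hX θ (τ h)).trans ?_
  rw [Finset.sum_const, nsmul_eq_mul]
  exact mul_le_mul_of_nonneg_right (card_filter_lt_le m) c.G_pos.le

theorem norm_scoreSum_sub_le (m : ℕ) (θ θ' : Param d) (τ : Traj S A c.H) :
    ‖X.scoreSum m θ' τ - X.scoreSum m θ τ‖ ≤ c.H * (c.M * ‖θ' - θ‖) := by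
  rw [Setting.scoreSum, Setting.scoreSum, ← Finset.sum_sub_distrib]
  refine (norm_sum_le_of_le _ fun h _ => norm_score_sub_le hX θ θ' (τ h)).trans ?_
  rw [Finset.sum_const, nsmul_eq_mul]
  exact mul_le_mul_of_nonneg_right (card_filter_lt_le m)
    (mul_nonneg c.M_pos.le (norm_nonneg _))

theorem measurable_scoreSum (m : ℕ) :
    Measurable fun q : Param d × Traj S A c.H => X.scoreSum m q.1 q.2 :=
  Finset.measurable_sum _ fun h _ => (measurable_score hX).comp
    (by fun_prop : Measurable fun q : Param d × Traj S A c.H => (q.1, q.2 h))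

theorem hasFDerivAt_weightUpTo (m : ℕ) (θ θ' : Param d) (τ : Traj S A c.H) :
    HasFDerivAt (fun y => X.weightUpTo m τ θ y)
      (X.weightUpTo m τ θ θ' • InnerProductSpace.toDual ℝ _ (X.scoreSum m θ' τ)) θ' := by
  have h : HasFDerivAt (fun y => ∑ h : Fin c.H with h.val < m,
      (X.logp y (τ h) - X.logp θ (τ h)))
      (∑ h : Fin c.H with h.val < m, InnerProductSpace.toDual ℝ _ (X.score θ' (τ h))) θ' :=
    HasFDerivAt.fun_sum fun h _ => (hasFDerivAt_logp hX θ' (τ h)).sub_const _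
  rw [Setting.scoreSum, map_sum]
  exact h.exp

/-- The policy gradient theorem for a function of the first `m` steps. -/
theorem hasGradientAt_integral (m : ℕ) (θ : Param d) {f : Traj S A c.H → ℝ}
    (hf : Measurable f) {C : ℝ} (hC : ∀ τ, |f τ| ≤ C)
    (hdep : ∀ τ τ' : Traj S A c.H, (∀ i : Fin c.H, (i : ℕ) < m → τ i = τ' i) → f τ = f τ') :
    HasGradientAt (fun θ' => ∫ τ, f τ ∂(X.trajLaw θ'))
      (∫ τ, f τ • X.scoreSum m θ τ ∂(X.trajLaw θ)) θ := by
  have := trajLaw_prob hX θ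
  have hwm : ∀ θ', Measurable fun τ => X.weightUpTo m τ θ θ' := fun θ' =>
    (measurable_weightUpTo hX m).comp
      (by fun_prop : Measurable fun τ : Traj S A c.H => (τ, θ, θ'))
  have hw0 : ∀ θ' τ, 0 ≤ X.weightUpTo m τ θ θ' := fun θ' τ => (Real.exp_pos _).le
  have hone : ∀ τ, X.weightUpTo m τ θ θ = 1 := fun τ => by simp [Setting.weightUpTo]
  have hsm : Measurable fun τ => X.scoreSum m θ τ := by
    have h := (measurable_scoreSum hX m).comp (measurable_prodMk_left (x := θ))
    exact h
  have hd : Measurable fun τ => InnerProductSpace.toDual ℝ _ (X.scoreSum m θ τ) := by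
    have h := (InnerProductSpace.toDual ℝ (Param d)).continuous.measurable.comp hsm
    exact h
  have hHG : 0 ≤ c.H * c.G := mul_nonneg (by positivity) c.G_pos.le
  have hC0 : 0 ≤ C := (abs_nonneg _).trans
    (hC (nonempty_of_isProbabilityMeasure (X.trajLaw θ)).some)
  -- The law is frozen at `θ` and only the weight depends on `θ'`. On the unit ball around `θ` the
  -- weight is at most `exp (H G)`, which gives an integrable bound for the derivative.
  have key := hasFDerivAt_integral_of_dominated_of_fderiv_le (𝕜 := ℝ) (μ := X.trajLaw θ)
    (F := fun θ' τ => X.weightUpTo m τ θ θ' * f τ) (x₀ := θ) (s := Metric.ball θ 1)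
    (F' := fun θ' τ => f τ • (X.weightUpTo m τ θ θ' •
      InnerProductSpace.toDual ℝ _ (X.scoreSum m θ' τ)))
    (bound := fun _ => C * (Real.exp (c.H * c.G) * (c.H * c.G)))
    (Metric.ball_mem_nhds θ one_pos)
    (Filter.Eventually.of_forall fun θ' => ((hwm θ').mul hf).aestronglyMeasurable)
    (by
      refine Integrable.of_bound ((hwm θ).mul hf).aestronglyMeasurable C (ae_of_all _ fun τ => ?_)
      rw [hone, one_mul]; exact hC τ)
    (by
      exact (hf.smul ((hwm θ).smul hd)).aestronglyMeasurable)
    (by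
      refine ae_of_all _ fun τ θ' hθ' => ?_
      rw [norm_smul, norm_smul, LinearIsometryEquiv.norm_map, Real.norm_of_nonneg (hw0 _ _)]
      have h1 : X.weightUpTo m τ θ θ' ≤ Real.exp (c.H * c.G) := by
        refine (weightUpTo_le hX m τ θ θ').trans (Real.exp_le_exp.2 ?_)
        rw [Metric.mem_ball, dist_eq_norm] at hθ'
        exact mul_le_of_le_one_right hHG hθ'.le
      exact mul_le_mul (hC τ) (mul_le_mul h1 (norm_scoreSum_le hX m θ' τ) (norm_nonneg _)
        (Real.exp_pos _).le) (mul_nonneg (hw0 _ _) (norm_nonneg _)) hC0)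
    (integrable_const _)
    (ae_of_all _ fun τ θ' _ => (hasFDerivAt_weightUpTo hX m θ θ' τ).mul_const (f τ))
  have e : (fun θ' => ∫ τ, f τ ∂(X.trajLaw θ')) =
      fun θ' => ∫ τ, X.weightUpTo m τ θ θ' * f τ ∂(X.trajLaw θ) :=
    funext fun θ' => integral_trajLaw_change_upTo hX m θ θ' hf hC hdep
  rw [hasGradientAt_iff_hasFDerivAt, e]
  refine key.congr_fderiv (Eq.symm ?_)
  have hint : Integrable (fun τ => f τ • X.scoreSum m θ τ) (X.trajLaw θ) :=
    Integrable.of_bound (hf.smul hsm).aestronglyMeasurable (C * (c.H * c.G))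
      (ae_of_all _ fun τ => by
        rw [norm_smul]
        exact mul_le_mul (hC τ) (norm_scoreSum_le hX m θ τ) (norm_nonneg _) hC0)
  simp_rw [hone, one_smul]
  ext v
  have hint' : Integrable (fun τ => f τ • InnerProductSpace.toDual ℝ _ (X.scoreSum m θ τ))
      (X.trajLaw θ) :=
    Integrable.of_bound (hf.smul hd).aestronglyMeasurable (C * (c.H * c.G))
      (ae_of_all _ fun τ => by
        rw [norm_smul, LinearIsometryEquiv.norm_map]
        exact mul_le_mul (hC τ) (norm_scoreSum_le hX m θ τ) (norm_nonneg _) hC0)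
  rw [ContinuousLinearMap.integral_apply hint', InnerProductSpace.toDual_apply_apply,
    real_inner_comm, ← integral_inner hint]
  refine integral_congr_ae (ae_of_all _ fun τ => ?_)
  simp [InnerProductSpace.toDual_apply_apply, inner_smul_right, real_inner_comm]

omit hX in
theorem measurable_ret_term (hr : Measurable fun x : S × A => X.reward x.1 x.2) (h : Fin c.H) :
    Measurable fun τ : Traj S A c.H => c.γ ^ (h : ℕ) * X.reward (τ h).1 (τ h).2 :=
  (hr.comp (measurable_pi_apply h)).const_mul _

theorem ret_term_mem (h : Fin c.H) (τ : Traj S A c.H) :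
    0 ≤ c.γ ^ (h : ℕ) * X.reward (τ h).1 (τ h).2 ∧
      c.γ ^ (h : ℕ) * X.reward (τ h).1 (τ h).2 ≤ c.R := by
  obtain ⟨h0, h1⟩ := hX.reward_mem (τ h).1 (τ h).2
  have hg : 0 ≤ c.γ ^ (h : ℕ) := pow_nonneg c.γ_pos.le _
  have hg1 : c.γ ^ (h : ℕ) ≤ 1 := pow_le_one₀ c.γ_pos.le c.γ_lt_one.le
  exact ⟨mul_nonneg hg h0, (mul_le_of_le_one_left h0 hg1).trans h1⟩

theorem ret_mem (τ : Traj S A c.H) : 0 ≤ X.ret c.γ τ ∧ X.ret c.γ τ ≤ c.H * c.R := by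
  refine ⟨Finset.sum_nonneg fun h _ => (ret_term_mem hX h τ).1, ?_⟩
  refine (Finset.sum_le_sum fun h _ => (ret_term_mem hX h τ).2).trans ?_
  simp

/-- Both estimators are sums of score sums, with coefficients that only depend on the steps
scored; the coefficients add up to the return, up to a constant. -/
theorem exists_g_eq : ∃ (k : ℕ) (a : Fin k → Traj S A c.H → ℝ) (m : Fin k → ℕ) (b : ℝ),
    (∀ j, Measurable (a j)) ∧
    (∀ τ θ, X.g c.γ τ θ = ∑ j, a j τ • X.scoreSum (m j) θ τ) ∧
    (∀ τ, ∑ j, |a j τ| ≤ c.coef) ∧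
    (∀ j, ∀ τ τ' : Traj S A c.H,
      (∀ i : Fin c.H, (i : ℕ) < m j → τ i = τ' i) → a j τ = a j τ') ∧
    ∀ τ, X.ret c.γ τ = ∑ j, a j τ + b := by
  have hrm := fun h => measurable_ret_term (X := X) hX.reward_measurable h
  have hb := hX.baseline
  have hH := c.one_le_H'
  have hCb := c.Cb_nonneg
  cases he : X.est with
  | reinforce b =>
    rw [he] at hb
    have hb' : |b| ≤ c.Cb := hb
    -- REINFORCE is a single term that scores all `H` steps.
    refine ⟨1, fun _ τ => X.ret c.γ τ - b, fun _ => c.H, b, fun _ => ?_, fun τ θ => ?_,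
      fun τ => ?_, fun _ τ τ' h => ?_, fun τ => by simp⟩
    · exact (Finset.measurable_sum _ fun h _ => hrm h).sub_const b
    · simp [Setting.g, he, Setting.scoreSum]
    · obtain ⟨h0, h1⟩ := ret_mem hX τ
      obtain ⟨h2, h3⟩ := abs_le.1 hb'
      simp only [Finset.univ_unique, Finset.sum_const, Finset.card_singleton, one_smul,
        Constants.coef]
      rw [abs_le]
      constructor <;> nlinarith
    · rw [funext fun i => h i i.2]
  | gpomdp b =>
    rw [he] at hb
    have hb' : ∀ h, |b h| ≤ c.γ ^ (h : ℕ) * c.Cb := hb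
    -- GPOMDP has one term per step `h`; the scores over `Finset.Iic h` are those of the first `h +
    -- 1` steps.
    refine ⟨c.H, fun h τ => c.γ ^ (h : ℕ) * X.reward (τ h).1 (τ h).2 - b h,
      fun h => h + 1, ∑ h, b h, fun h => (hrm h).sub_const _, fun τ θ => ?_, fun τ => ?_,
      fun j τ τ' h => ?_, fun τ => ?_⟩
    · simp only [Setting.g, he, Setting.scoreSum]
      refine Finset.sum_congr rfl fun h _ => ?_
      congr 2
      ext t
      simp
    · refine (Finset.sum_le_card_nsmul _ _ (c.R + c.Cb) fun h _ => ?_).trans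
        (by simp [Constants.coef, mul_add])
      obtain ⟨h0, h1⟩ := ret_term_mem hX h τ
      have hg1 : c.γ ^ (h : ℕ) ≤ 1 := pow_le_one₀ c.γ_pos.le c.γ_lt_one.le
      obtain ⟨h2, h3⟩ := abs_le.1 ((hb' h).trans (mul_le_of_le_one_left hCb hg1))
      rw [abs_le]
      constructor <;> linarith [c.R_pos]
    · simp only
      rw [h j (Nat.lt_succ_self _)]
    · simp [Setting.ret]

theorem norm_g_le (τ : Traj S A c.H) (θ : Param d) :
    ‖X.g c.γ τ θ‖ ≤ c.coef * (c.H * c.G) := by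
  obtain ⟨k, a, m, b, -, hg, ha, -, -⟩ := exists_g_eq hX
  rw [hg]
  refine (norm_sum_le_of_le (f := fun j => a j τ • X.scoreSum (m j) θ τ)
    (n := fun j => |a j τ| * (c.H * c.G)) _ fun j _ => ?_).trans ?_
  · rw [norm_smul]
    exact mul_le_mul_of_nonneg_left (norm_scoreSum_le hX _ _ _) (abs_nonneg _)
  · rw [← Finset.sum_mul]
    exact mul_le_mul_of_nonneg_right (ha τ) (mul_nonneg (by positivity) c.G_pos.le)

theorem norm_g_sub_le (τ : Traj S A c.H) (θ θ' : Param d) :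
    ‖X.g c.γ τ θ' - X.g c.γ τ θ‖ ≤ c.coef * (c.H * c.M) * ‖θ' - θ‖ := by
  obtain ⟨k, a, m, b, -, hg, ha, -, -⟩ := exists_g_eq hX
  rw [hg, hg, ← Finset.sum_sub_distrib]
  have h0 : 0 ≤ c.H * (c.M * ‖θ' - θ‖) :=
    mul_nonneg (by positivity) (mul_nonneg c.M_pos.le (norm_nonneg _))
  refine (norm_sum_le_of_le _ (n := fun j => |a j τ| * (c.H * (c.M * ‖θ' - θ‖)))
    fun j _ => ?_).trans ?_
  · rw [← smul_sub, norm_smul]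
    exact mul_le_mul_of_nonneg_left (norm_scoreSum_sub_le hX _ _ _ _) (abs_nonneg _)
  · rw [← Finset.sum_mul]
    refine (mul_le_mul_of_nonneg_right (ha τ) h0).trans (le_of_eq (by ring))

theorem measurable_g : Measurable fun q : Traj S A c.H × Param d => X.g c.γ q.1 q.2 := by
  obtain ⟨k, a, m, b, hm, hg, -, -, -⟩ := exists_g_eq hX
  have e : (fun q : Traj S A c.H × Param d => X.g c.γ q.1 q.2) = fun q =>
      ∑ j, a j q.1 • X.scoreSum (m j) q.2 q.1 := funext fun q => hg _ _
  rw [e]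
  refine Finset.measurable_sum _ fun j _ => ?_
  have h1 : Measurable fun q : Traj S A c.H × Param d => a j q.1 := (hm j).comp measurable_fst
  have h2 : Measurable fun q : Traj S A c.H × Param d => X.scoreSum (m j) q.2 q.1 := by
    have h := (measurable_scoreSum hX (m j)).comp
      (measurable_swap (α := Traj S A c.H) (β := Param d))
    exact h
  exact h1.smul h2

/-- Unbiasedness of both estimators at once. Up to the constant `b` the return is the sum of the
coefficients `a j`, and the expectation of each has as gradient the mean of `a j` times its own
score sum. -/
theorem hasGradientAt_J (θ : Param d) :
    HasGradientAt (X.J c.γ) (∫ τ, X.g c.γ τ θ ∂(X.trajLaw θ)) θ := by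
  obtain ⟨k, a, m, b, hm, hg, ha, hdep, hret⟩ := exists_g_eq hX
  have hprob := trajLaw_prob hX
  have hC : ∀ j τ, |a j τ| ≤ c.coef := fun j τ =>
    (Finset.single_le_sum (f := fun j => |a j τ|) (fun _ _ => abs_nonneg _)
      (Finset.mem_univ j)).trans (ha τ)
  have hJ : X.J c.γ = fun θ' => ∑ j, ∫ τ, a j τ ∂(X.trajLaw θ') + b := by
    funext θ'
    have hi : ∀ j ∈ (Finset.univ : Finset (Fin k)), Integrable (a j) (X.trajLaw θ') :=
      fun j _ => Integrable.of_bound (hm j).aestronglyMeasurable _ (ae_of_all _ (hC j))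
    rw [Setting.J]
    simp_rw [hret]
    rw [integral_add (integrable_finsetSum _ hi) (integrable_const b), integral_finsetSum _ hi]
    simp
  have hs : ∀ j ∈ (Finset.univ : Finset (Fin k)),
      Integrable (fun τ => a j τ • X.scoreSum (m j) θ τ) (X.trajLaw θ) := fun j _ =>
    Integrable.of_bound ((hm j).smul ((measurable_scoreSum hX (m j)).comp
      measurable_prodMk_left)).aestronglyMeasurable (c.coef * (c.H * c.G)) (ae_of_all _ fun τ => by
        rw [norm_smul]
        exact mul_le_mul (hC j τ) (norm_scoreSum_le hX _ θ τ) (norm_nonneg _) c.coef_pos.le)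
  simp_rw [hg]
  rw [hJ, hasGradientAt_iff_hasFDerivAt, integral_finsetSum _ hs, map_sum]
  exact (HasFDerivAt.fun_sum fun j _ =>
    (hasGradientAt_integral hX (m j) θ (hm j) (hC j) (hdep j)).hasFDerivAt).add_const b

theorem integral_g (θ : Param d) :
    ∫ τ, X.g c.γ τ θ ∂(X.trajLaw θ) = gradient (X.J c.γ) θ := (hasGradientAt_J hX θ).gradient.symm

theorem integral_weight_smul_g (θ θ₀ : Param d) :
    ∫ τ, X.weight τ θ θ₀ • X.g c.γ τ θ₀ ∂(X.trajLaw θ) = gradient (X.J c.γ) θ₀ := by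
  rw [← integral_g hX θ₀, integral_trajLaw_change hX θ θ₀]

theorem J_mem (θ : Param d) : 0 ≤ X.J c.γ θ ∧ X.J c.γ θ ≤ c.H * c.R := by
  have := trajLaw_prob hX θ
  refine ⟨integral_nonneg fun τ => (ret_mem hX τ).1, ?_⟩
  have hm : Measurable (X.ret c.γ) :=
    Finset.measurable_sum _ fun h _ => measurable_ret_term hX.reward_measurable h
  have := integral_mono (μ := X.trajLaw θ) (f := X.ret c.γ) (g := fun _ => c.H * c.R)
    (Integrable.of_bound hm.aestronglyMeasurable (c.H * c.R) (ae_of_all _ fun τ => by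
      rw [Real.norm_of_nonneg (ret_mem hX τ).1]; exact (ret_mem hX τ).2))
    (integrable_const _) fun τ => (ret_mem hX τ).2
  rw [integral_const, probReal_univ, one_smul] at this
  exact this

end FedPG

/-! ### Second moments of the corrected difference and smoothness of the performance. -/

namespace FedPG

section Moments

variable {Ω E : Type*} [MeasurableSpace Ω] {P : Measure Ω} [IsProbabilityMeasure P]
  [NormedAddCommGroup E] [InnerProductSpace ℝ E] [CompleteSpace E]

theorem integral_norm_add_sq {Y : Ω → E} (hY : AEStronglyMeasurable Y P) {C : ℝ}
    (hC : ∀ ω, ‖Y ω‖ ≤ C) (a : E) :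
    ∫ ω, ‖a + Y ω‖ ^ 2 ∂P = ‖a‖ ^ 2 + 2 * inner ℝ a (∫ ω, Y ω ∂P) + ∫ ω, ‖Y ω‖ ^ 2 ∂P := by
  have hi : Integrable Y P := Integrable.of_bound hY C (ae_of_all _ hC)
  have h2 : Integrable (fun ω => ‖Y ω‖ ^ 2) P :=
    Integrable.of_bound (hY.norm.pow 2) (C ^ 2) (ae_of_all _ fun ω => by
      rw [norm_pow, norm_norm]; exact pow_le_pow_left₀ (norm_nonneg _) (hC ω) 2)
  have h3 : Integrable (fun ω => 2 * inner ℝ a (Y ω)) P := (hi.const_inner a).const_mul 2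
  simp_rw [norm_add_sq_real]
  have h4 : Integrable (fun ω => ‖a‖ ^ 2 + 2 * inner ℝ a (Y ω)) P := (integrable_const _).add h3
  rw [integral_add h4 h2, integral_add (integrable_const _) h3, integral_const, probReal_univ,
    one_smul, integral_const_mul, integral_inner hi]

theorem integral_norm_sub_mean_sq {Y : Ω → E} (hY : AEStronglyMeasurable Y P) {C : ℝ}
    (hC : ∀ ω, ‖Y ω‖ ≤ C) :
    ∫ ω, ‖Y ω‖ ^ 2 ∂P = ‖∫ ω, Y ω ∂P‖ ^ 2 + ∫ ω, ‖Y ω - ∫ ω', Y ω' ∂P‖ ^ 2 ∂P := by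
  have h := integral_norm_add_sq hY hC (-∫ ω, Y ω ∂P)
  simp only [neg_add_eq_sub, norm_neg, inner_neg_left, real_inner_self_eq_norm_sq] at h
  linarith

theorem norm_integral_sq_le {Y : Ω → E} (hY : AEStronglyMeasurable Y P) {C : ℝ}
    (hC : ∀ ω, ‖Y ω‖ ≤ C) : ‖∫ ω, Y ω ∂P‖ ^ 2 ≤ ∫ ω, ‖Y ω‖ ^ 2 ∂P := by
  rw [integral_norm_sub_mean_sq hY hC]
  have : 0 ≤ ∫ ω, ‖Y ω - ∫ ω', Y ω' ∂P‖ ^ 2 ∂P := integral_nonneg fun _ => by positivity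
  linarith

end Moments

namespace Constants

/-- A bound on the gradient estimator. -/
def gBound (c : Constants) : ℝ := c.coef * (c.H * c.G)

/-- A Lipschitz constant of the gradient estimator. -/
def gLip (c : Constants) : ℝ := c.coef * (c.H * c.M)

/-- The variance of the importance weight is at most `wVar * ‖θ₁ - θ₂‖ ^ 2`. -/
def wVar (c : Constants) : ℝ := c.W + (c.H * c.G) ^ 2 * Real.exp (c.H * c.G) ^ 2

/-- A Lipschitz constant of the gradient of the performance. -/
def smooth (c : Constants) : ℝ := √(2 * c.gLip ^ 2 + 2 * c.gBound ^ 2 * c.wVar + 1)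

variable (c : Constants)

theorem wVar_nonneg : 0 ≤ c.wVar := add_nonneg c.W_nonneg (by positivity)

theorem smooth_sq : c.smooth ^ 2 = 2 * c.gLip ^ 2 + 2 * c.gBound ^ 2 * c.wVar + 1 :=
  Real.sq_sqrt (by have := c.wVar_nonneg; positivity)

theorem smooth_pos : 0 < c.smooth := Real.sqrt_pos.2 (by have := c.wVar_nonneg; positivity)

theorem gBound_nonneg : 0 ≤ c.gBound :=
  mul_nonneg c.coef_pos.le (mul_nonneg (by positivity) c.G_pos.le)

end Constants

variable {S A : Type*} [MeasurableSpace S] [MeasurableSpace A] {d : ℕ} {c : Constants}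
  {X : Setting S A d c.H} (hX : Assumptions c X)
include hX

theorem weight_nonneg (τ : Traj S A c.H) (θ θ' : Param d) : 0 ≤ X.weight τ θ θ' := by
  rw [weight_eq_weightUpTo hX]; exact (Real.exp_pos _).le

theorem weight_le (τ : Traj S A c.H) (θ θ' : Param d) :
    X.weight τ θ θ' ≤ Real.exp (c.H * c.G * ‖θ' - θ‖) := by
  rw [weight_eq_weightUpTo hX]; exact weightUpTo_le hX _ _ _ _

theorem measurable_weight_left (θ θ' : Param d) : Measurable fun τ => X.weight τ θ θ' := by
  have h := (measurable_weight hX).comp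
    (by fun_prop : Measurable fun τ : Traj S A c.H => (τ, θ, θ'))
  exact h

theorem measurable_g_left (θ : Param d) : Measurable fun τ => X.g c.γ τ θ := by
  have h := (measurable_g hX).comp (measurable_prodMk_right (y := θ))
  exact h

theorem integral_weight (θ θ' : Param d) : ∫ τ, X.weight τ θ θ' ∂(X.trajLaw θ) = 1 := by
  have := trajLaw_prob hX θ'
  have h := integral_trajLaw_change hX θ θ' fun _ => (1 : ℝ)
  simp only [smul_eq_mul, mul_one, integral_const, probReal_univ] at h
  exact h.symm

theorem integral_weight_sub_one_sq_le_W (θ θ' : Param d) :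
    ∫ τ, (X.weight τ θ θ' - 1) ^ 2 ∂(X.trajLaw θ) ≤ c.W := by
  have h := hX.weight_variance θ θ'
  rw [evariance, integral_weight hX] at h
  rw [integral_eq_lintegral_of_nonneg_ae (ae_of_all _ fun _ => sq_nonneg _)
    (((measurable_weight_left hX θ θ').sub_const 1).pow_const 2).aestronglyMeasurable]
  refine ENNReal.toReal_le_of_le_ofReal c.W_nonneg (le_of_eq_of_le ?_ h)
  refine lintegral_congr fun τ => ?_
  rw [← enorm_pow, Real.enorm_eq_ofReal (sq_nonneg _)]

theorem integrable_weight_sub_one_sq (θ θ' : Param d) :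
    Integrable (fun τ => (X.weight τ θ θ' - 1) ^ 2) (X.trajLaw θ) := by
  have := trajLaw_prob hX θ
  refine Integrable.of_bound
    (((measurable_weight_left hX θ θ').sub_const 1).pow_const 2).aestronglyMeasurable
    ((c.H * c.G * ‖θ' - θ‖ * Real.exp (c.H * c.G * ‖θ' - θ‖)) ^ 2) (ae_of_all _ fun τ => ?_)
  rw [norm_pow]
  exact pow_le_pow_left₀ (norm_nonneg _) (abs_weight_sub_one_le hX τ θ θ') 2

/-- At distance at most one the pointwise bound `b e^b` with `b ≤ H G` is already quadratic in the
distance; beyond it `‖θ' - θ‖² ≥ 1`, so the constant `W` is enough. -/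
theorem integral_weight_sub_one_sq_le (θ θ' : Param d) :
    ∫ τ, (X.weight τ θ θ' - 1) ^ 2 ∂(X.trajLaw θ) ≤ c.wVar * ‖θ' - θ‖ ^ 2 := by
  have := trajLaw_prob hX θ
  have hHG : 0 ≤ c.H * c.G := mul_nonneg (by positivity) c.G_pos.le
  have hW := c.W_nonneg
  have hn := norm_nonneg (θ' - θ)
  rw [Constants.wVar]
  rcases le_total ‖θ' - θ‖ 1 with h | h
  · have hb : ∀ τ, (X.weight τ θ θ' - 1) ^ 2 ≤
        (c.H * c.G) ^ 2 * Real.exp (c.H * c.G) ^ 2 * ‖θ' - θ‖ ^ 2 := by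
      intro τ
      rw [← sq_abs, ← mul_pow, ← mul_pow]
      refine pow_le_pow_left₀ (abs_nonneg _) ((abs_weight_sub_one_le hX τ θ θ').trans ?_) 2
      have : Real.exp (c.H * c.G * ‖θ' - θ‖) ≤ Real.exp (c.H * c.G) :=
        Real.exp_le_exp.2 (mul_le_of_le_one_right hHG h)
      calc c.H * c.G * ‖θ' - θ‖ * Real.exp (c.H * c.G * ‖θ' - θ‖)
          ≤ c.H * c.G * ‖θ' - θ‖ * Real.exp (c.H * c.G) :=
            mul_le_mul_of_nonneg_left this (mul_nonneg hHG hn)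
        _ = _ := by ring
    have hi := integral_mono (integrable_weight_sub_one_sq hX θ θ') (integrable_const _) hb
    rw [integral_const, probReal_univ, one_smul] at hi
    have : 0 ≤ c.W * ‖θ' - θ‖ ^ 2 := by positivity
    linarith
  · have h1 : c.W ≤ c.W * ‖θ' - θ‖ ^ 2 := le_mul_of_one_le_right hW (one_le_pow₀ h)
    have : 0 ≤ (c.H * c.G) ^ 2 * Real.exp (c.H * c.G) ^ 2 * ‖θ' - θ‖ ^ 2 := by positivity
    linarith [integral_weight_sub_one_sq_le_W hX θ θ']

/-- The importance-corrected difference of the estimators at `θ` and `θ₀`. -/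
def Setting.gDiff (X : Setting S A d c.H) (θ θ₀ : Param d) (τ : Traj S A c.H) : Param d :=
  X.g c.γ τ θ - X.weight τ θ θ₀ • X.g c.γ τ θ₀

theorem measurable_gDiff :
    Measurable fun q : (Param d × Param d) × Traj S A c.H => X.gDiff q.1.1 q.1.2 q.2 := by
  have h1 := (measurable_g hX).comp (by fun_prop :
    Measurable fun q : (Param d × Param d) × Traj S A c.H => (q.2, q.1.1))
  have h2 := (measurable_g hX).comp (by fun_prop :
    Measurable fun q : (Param d × Param d) × Traj S A c.H => (q.2, q.1.2))
  have h3 := (measurable_weight hX).comp (by fun_prop :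
    Measurable fun q : (Param d × Param d) × Traj S A c.H => (q.2, q.1.1, q.1.2))
  exact h1.sub (h3.smul h2)

theorem measurable_gDiff_left (θ θ₀ : Param d) : Measurable (X.gDiff θ θ₀) := by
  have h := (measurable_gDiff hX).comp (measurable_prodMk_left (x := (θ, θ₀)))
  exact h

theorem norm_gDiff_le (θ θ₀ : Param d) (τ : Traj S A c.H) :
    ‖X.gDiff θ θ₀ τ‖ ≤ c.gBound + Real.exp (c.H * c.G * ‖θ₀ - θ‖) * c.gBound := by
  refine (norm_sub_le _ _).trans (add_le_add (norm_g_le hX τ θ) ?_)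
  rw [norm_smul, Real.norm_of_nonneg (weight_nonneg hX _ _ _)]
  exact mul_le_mul (weight_le hX τ θ θ₀) (norm_g_le hX τ θ₀) (norm_nonneg _) (Real.exp_pos _).le

theorem integral_gDiff (θ θ₀ : Param d) :
    ∫ τ, X.gDiff θ θ₀ τ ∂(X.trajLaw θ) = gradient (X.J c.γ) θ - gradient (X.J c.γ) θ₀ := by
  have := trajLaw_prob hX θ
  have h1 : Integrable (fun τ => X.g c.γ τ θ) (X.trajLaw θ) :=
    Integrable.of_bound (measurable_g_left hX θ).aestronglyMeasurable _
      (ae_of_all _ fun τ => norm_g_le hX τ θ)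
  have h2 : Integrable (fun τ => X.weight τ θ θ₀ • X.g c.γ τ θ₀) (X.trajLaw θ) :=
    Integrable.of_bound ((measurable_weight_left hX θ θ₀).smul
      (measurable_g_left hX θ₀)).aestronglyMeasurable
      (Real.exp (c.H * c.G * ‖θ₀ - θ‖) * c.gBound) (ae_of_all _ fun τ => by
        rw [norm_smul, Real.norm_of_nonneg (weight_nonneg hX _ _ _)]
        exact mul_le_mul (weight_le hX τ θ θ₀) (norm_g_le hX τ θ₀) (norm_nonneg _)
          (Real.exp_pos _).le)
  simp only [Setting.gDiff]
  rw [integral_sub h1 h2, integral_g hX, integral_weight_smul_g hX]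

/-- This is the variance reduction. Write `gDiff` as `(g θ - g θ₀) - (ω - 1) g θ₀`: the first part
is Lipschitz in the parameter, the second is a bounded vector times the centered weight. -/
theorem integral_norm_gDiff_sq_le (θ θ₀ : Param d) :
    ∫ τ, ‖X.gDiff θ θ₀ τ‖ ^ 2 ∂(X.trajLaw θ) ≤ c.smooth ^ 2 * ‖θ - θ₀‖ ^ 2 := by
  have := trajLaw_prob hX θ
  have hb : ∀ τ, ‖X.gDiff θ θ₀ τ‖ ^ 2 ≤ 2 * c.gLip ^ 2 * ‖θ - θ₀‖ ^ 2 +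
      2 * c.gBound ^ 2 * (X.weight τ θ θ₀ - 1) ^ 2 := by
    intro τ
    have e : X.gDiff θ θ₀ τ = (X.g c.γ τ θ - X.g c.γ τ θ₀) -
        (X.weight τ θ θ₀ - 1) • X.g c.γ τ θ₀ := by
      rw [Setting.gDiff, sub_smul, one_smul]; abel
    have h1 : ‖X.g c.γ τ θ - X.g c.γ τ θ₀‖ ≤ c.gLip * ‖θ - θ₀‖ := norm_g_sub_le hX τ θ₀ θ
    have h2 : ‖(X.weight τ θ θ₀ - 1) • X.g c.γ τ θ₀‖ ≤ |X.weight τ θ θ₀ - 1| * c.gBound := by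
      rw [norm_smul]
      exact mul_le_mul_of_nonneg_left (norm_g_le hX τ θ₀) (abs_nonneg _)
    have h3 : ‖X.gDiff θ θ₀ τ‖ ≤ c.gLip * ‖θ - θ₀‖ + |X.weight τ θ θ₀ - 1| * c.gBound := by
      rw [e]; exact (norm_sub_le _ _).trans (add_le_add h1 h2)
    rw [← sq_abs (X.weight τ θ θ₀ - 1)]
    refine (pow_le_pow_left₀ (norm_nonneg _) h3 2).trans ?_
    nlinarith [sq_nonneg (c.gLip * ‖θ - θ₀‖ - |X.weight τ θ θ₀ - 1| * c.gBound)]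
  have hi : Integrable (fun τ => 2 * c.gLip ^ 2 * ‖θ - θ₀‖ ^ 2 +
      2 * c.gBound ^ 2 * (X.weight τ θ θ₀ - 1) ^ 2) (X.trajLaw θ) :=
    (integrable_const _).add ((integrable_weight_sub_one_sq hX θ θ₀).const_mul _)
  have hi' : Integrable (fun τ => ‖X.gDiff θ θ₀ τ‖ ^ 2) (X.trajLaw θ) :=
    hi.mono' ((measurable_gDiff_left hX θ θ₀).norm.pow_const 2).aestronglyMeasurable
      (ae_of_all _ fun τ => by rw [Real.norm_of_nonneg (by positivity)]; exact hb τ)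
  refine (integral_mono hi' hi hb).trans ?_
  rw [integral_add (integrable_const _) ((integrable_weight_sub_one_sq hX θ θ₀).const_mul _),
    integral_const, probReal_univ, one_smul, integral_const_mul, c.smooth_sq]
  have h := integral_weight_sub_one_sq_le hX θ θ₀
  rw [norm_sub_rev] at h
  have := mul_le_mul_of_nonneg_left h (by positivity : 0 ≤ 2 * c.gBound ^ 2)
  nlinarith [sq_nonneg ‖θ - θ₀‖]

/-- Jensen's inequality applied to `gDiff`, whose mean is the difference of gradients. One constant
`smooth` thus serves both for the noise of a step and for the smoothness of `J`. -/
theorem norm_gradient_sub_le (θ θ₀ : Param d) :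
    ‖gradient (X.J c.γ) θ - gradient (X.J c.γ) θ₀‖ ≤ c.smooth * ‖θ - θ₀‖ := by
  have := trajLaw_prob hX θ
  refine le_of_sq_le_sq ?_ (mul_nonneg c.smooth_pos.le (norm_nonneg _))
  rw [← integral_gDiff hX, mul_pow]
  exact (norm_integral_sq_le (measurable_gDiff_left hX θ θ₀).aestronglyMeasurable
    (norm_gDiff_le hX θ θ₀)).trans (integral_norm_gDiff_sq_le hX θ θ₀)

theorem continuous_gradient_J : Continuous (gradient (X.J c.γ)) :=
  (LipschitzWith.of_dist_le_mul (K := ⟨c.smooth, c.smooth_pos.le⟩) fun θ θ' => by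
    rw [dist_eq_norm, dist_eq_norm]; exact norm_gradient_sub_le hX θ θ').continuous

theorem norm_gradient_J_le (θ : Param d) : ‖gradient (X.J c.γ) θ‖ ≤ c.gBound := by
  have := trajLaw_prob hX θ
  rw [← integral_g hX]
  refine (norm_integral_le_of_norm_le_const (ae_of_all _ fun τ => norm_g_le hX τ θ)).trans ?_
  rw [probReal_univ, mul_one, Constants.gBound]

theorem hasFDerivAt_J (θ : Param d) : HasFDerivAt (X.J c.γ)
    (InnerProductSpace.toDual ℝ _ (gradient (X.J c.γ) θ)) θ := by
  have h := (hasGradientAt_J hX θ).hasFDerivAt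
  rwa [integral_g hX] at h

theorem continuous_J : Continuous (X.J c.γ) :=
  continuous_iff_continuousAt.2 fun θ => (hasFDerivAt_J hX θ).continuousAt

/-- The mean value inequality along the segment. It gives the coefficient `smooth` where Taylor's
formula in integral form would give half of it; the step-size conditions absorb the loss. -/
theorem J_ge (x y : Param d) : X.J c.γ x + inner ℝ (gradient (X.J c.γ) x) (y - x) -
    c.smooth * ‖y - x‖ ^ 2 ≤ X.J c.γ y := by
  have h := Convex.norm_image_sub_le_of_norm_hasFDerivWithin_le' (𝕜 := ℝ) (f := X.J c.γ)
    (f' := fun z => InnerProductSpace.toDual ℝ _ (gradient (X.J c.γ) z))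
    (φ := InnerProductSpace.toDual ℝ _ (gradient (X.J c.γ) x))
    (C := c.smooth * ‖y - x‖) (s := segment ℝ x y)
    (fun z _ => (hasFDerivAt_J hX z).hasFDerivWithinAt)
    (fun z hz => by
      rw [← map_sub, LinearIsometryEquiv.norm_map]
      refine (norm_gradient_sub_le hX z x).trans
        (mul_le_mul_of_nonneg_left ?_ c.smooth_pos.le)
      exact norm_sub_le_of_mem_segment hz)
    (convex_segment x y) (left_mem_segment ℝ x y) (right_mem_segment ℝ x y)
  rw [InnerProductSpace.toDual_apply_apply, Real.norm_eq_abs] at h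
  have := (abs_le.1 h).1
  nlinarith

end FedPG

/-! ### One step of the inner loop. -/

namespace FedPG

/-- The arithmetic of one inner step. `P`, `U`, `E`, `D`, `Q` are the squared norms of the gradient,
the drift, the error of the batch gradient, the distance to the start, and the second moment of
the step. -/
theorem inner_step_arith {Λ η b P U E D Q J J' pu du : ℝ} (hΛ : 0 < Λ) (hη : 0 < η) (hb : 1 ≤ b)
    (hx1 : Λ * η ≤ 1 / 4) (hx2 : (Λ * η) ^ 2 * b ≤ 1 / 16) (hx3 : (Λ * η) ^ 3 * b ^ 2 ≤ 1 / 64)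
    (hU : 0 ≤ U) (hD : 0 ≤ D)
    (hpu : 2 * pu = P + U - E) (hQ : Q ≤ U + Λ ^ 2 * D)
    (hdu : 2 * η * du ≤ D / (4 * b) + 4 * b * η ^ 2 * U)
    (hJ : J + η * pu - Λ * η ^ 2 * Q ≤ J') :
    2 * Λ ^ 3 * η ^ 2 * b * (D + 2 * η * du + η ^ 2 * Q) + J + η / 2 * P ≤
      J' + 2 * Λ ^ 3 * η ^ 2 * b * (1 + 1 / b) * D + η / 2 * E := by
  have hb0 : 0 < b := by linarith
  set x := Λ * η with hx
  have hx0 : 0 < x := mul_pos hΛ hη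
  set l := 2 * Λ ^ 3 * η ^ 2 * b with hl
  have hl0 : 0 < l := by positivity
  have hlD : 0 ≤ l * D := by positivity
  have h1 : l * (2 * η * du) ≤ l * (D / (4 * b) + 4 * b * η ^ 2 * U) :=
    mul_le_mul_of_nonneg_left hdu hl0.le
  have h2 : (l * η ^ 2 + Λ * η ^ 2) * Q ≤ (l * η ^ 2 + Λ * η ^ 2) * (U + Λ ^ 2 * D) :=
    mul_le_mul_of_nonneg_left hQ (by positivity)
  have cU : l * (4 * b * η ^ 2) + l * η ^ 2 + Λ * η ^ 2 ≤ η / 2 := by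
    have e1 : l * η ^ 2 ≤ l * (b * η ^ 2) :=
      mul_le_mul_of_nonneg_left (le_mul_of_one_le_left (by positivity) hb) hl0.le
    have e2 : l * (b * η ^ 2) = 2 * η * (x ^ 3 * b ^ 2) := by rw [hl, hx]; ring
    have e3 : Λ * η ^ 2 = η * x := by rw [hx]; ring
    nlinarith
  -- The growth factor `1 + 1 / b` leaves room `l / b` for the multiples of the squared distance.
  -- The weight `l` is chosen so that the noise term `Λ ^ 3 * η ^ 2` takes exactly half of it; the
  -- other two take at most `1/4` and `1/16`.
  have cD : l / (4 * b) + l * η ^ 2 * Λ ^ 2 + Λ ^ 3 * η ^ 2 ≤ l / b := by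
    have e1 : Λ ^ 3 * η ^ 2 = l / b / 2 := by rw [hl]; field_simp
    have e2 : l * η ^ 2 * Λ ^ 2 = l / b * (x ^ 2 * b) := by rw [hx]; field_simp
    have e3 : l / (4 * b) = l / b / 4 := by field_simp
    have e4 : 0 < l / b := by positivity
    rw [e1, e2, e3]
    nlinarith
  have h3 := mul_le_mul_of_nonneg_right cU hU
  have h4 := mul_le_mul_of_nonneg_right cD hD
  have e5 : l * (1 + 1 / b) * D = l * D + l / b * D := by field_simp
  have e6 : l * (D / (4 * b)) = l / (4 * b) * D := by field_simp
  rw [e5]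
  nlinarith

section InnerStep

variable {S A : Type*} [MeasurableSpace S] [MeasurableSpace A] {d : ℕ} {c : Constants}
  {X : Setting S A d c.H} (hX : Assumptions c X)
include hX

/-- The Lyapunov function is `J` minus `2 Λ³ η² b ‖θ - θ₀‖²`. The mean direction is `u = ∇J(θ) + (μ
- ∇J(θ₀))`, so `2⟨∇J(θ), u⟩` is `‖∇J(θ)‖² + ‖u‖²` minus the squared error of `μ`. Young's inequality
with weight of order `b` keeps the growth of the distance within `1 + 1 / b`. -/
theorem inner_step (θ θ₀ μ : Param d) {η b : ℝ} (hη : 0 < η) (hb : 1 ≤ b)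
    (hx1 : c.smooth * η ≤ 1 / 4) (hx2 : (c.smooth * η) ^ 2 * b ≤ 1 / 16)
    (hx3 : (c.smooth * η) ^ 3 * b ^ 2 ≤ 1 / 64) :
    2 * c.smooth ^ 3 * η ^ 2 * b *
        ∫ τ, ‖θ + η • (X.gDiff θ θ₀ τ + μ) - θ₀‖ ^ 2 ∂(X.trajLaw θ) + X.J c.γ θ +
        η / 2 * ‖gradient (X.J c.γ) θ‖ ^ 2 ≤
      ∫ τ, X.J c.γ (θ + η • (X.gDiff θ θ₀ τ + μ)) ∂(X.trajLaw θ) +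
        2 * c.smooth ^ 3 * η ^ 2 * b * (1 + 1 / b) * ‖θ - θ₀‖ ^ 2 +
        η / 2 * ‖μ - gradient (X.J c.γ) θ₀‖ ^ 2 := by
  have := trajLaw_prob hX θ
  set p := gradient (X.J c.γ) θ
  set p₀ := gradient (X.J c.γ) θ₀
  set u := p + (μ - p₀) with hu
  set K := c.gBound + Real.exp (c.H * c.G * ‖θ₀ - θ‖) * c.gBound
  have hYm := measurable_gDiff_left hX θ θ₀
  have hYb : ∀ τ, ‖X.gDiff θ θ₀ τ‖ ≤ K := norm_gDiff_le hX θ θ₀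
  have hv_m : Measurable fun τ => X.gDiff θ θ₀ τ + μ := hYm.add_const μ
  have hv_b : ∀ τ, ‖X.gDiff θ θ₀ τ + μ‖ ≤ K + ‖μ‖ := fun τ =>
    (norm_add_le _ _).trans (add_le_add (hYb τ) le_rfl)
  have hY_int : Integrable (X.gDiff θ θ₀) (X.trajLaw θ) :=
    Integrable.of_bound hYm.aestronglyMeasurable K (ae_of_all _ hYb)
  have hv_int : Integrable (fun τ => X.gDiff θ θ₀ τ + μ) (X.trajLaw θ) :=
    hY_int.add (integrable_const μ)
  have hmean : ∫ τ, (X.gDiff θ θ₀ τ + μ) ∂(X.trajLaw θ) = u := by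
    rw [integral_add hY_int (integrable_const μ), integral_gDiff hX, integral_const,
      probReal_univ, one_smul, hu]
    abel
  set Q := ∫ τ, ‖X.gDiff θ θ₀ τ + μ‖ ^ 2 ∂(X.trajLaw θ) with hQdef
  -- Adding the fixed vector `μ` does not change the variance, which is at most the second moment of
  -- `gDiff`.
  have hQ : Q ≤ ‖u‖ ^ 2 + c.smooth ^ 2 * ‖θ - θ₀‖ ^ 2 := by
    have e1 := integral_norm_sub_mean_sq (P := X.trajLaw θ) hv_m.aestronglyMeasurable hv_b
    rw [hmean] at e1
    have e2 := integral_norm_sub_mean_sq (P := X.trajLaw θ) hYm.aestronglyMeasurable hYb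
    rw [integral_gDiff hX] at e2
    have e3 : ∀ τ, X.gDiff θ θ₀ τ + μ - u = X.gDiff θ θ₀ τ - (p - p₀) := fun τ => by
      rw [hu]; abel
    simp_rw [e3] at e1
    have e4 := integral_norm_gDiff_sq_le hX θ θ₀
    have e5 : 0 ≤ ‖p - p₀‖ ^ 2 := by positivity
    linarith
  have hdist : ∫ τ, ‖θ + η • (X.gDiff θ θ₀ τ + μ) - θ₀‖ ^ 2 ∂(X.trajLaw θ) =
      ‖θ - θ₀‖ ^ 2 + 2 * η * inner ℝ (θ - θ₀) u + η ^ 2 * Q := by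
    have e1 := integral_norm_add_sq (P := X.trajLaw θ) (Y := fun τ => η • (X.gDiff θ θ₀ τ + μ))
      (hv_m.const_smul η).aestronglyMeasurable (C := |η| * (K + ‖μ‖)) (fun τ => by
        rw [norm_smul]; exact mul_le_mul_of_nonneg_left (hv_b τ) (abs_nonneg _)) (θ - θ₀)
    rw [integral_smul, hmean, inner_smul_right] at e1
    simp_rw [norm_smul, mul_pow, Real.norm_eq_abs, sq_abs] at e1
    rw [integral_const_mul] at e1
    rw [← mul_assoc] at e1
    rw [← e1]
    refine integral_congr_ae (ae_of_all _ fun τ => ?_)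
    simp only
    congr 2
    abel
  have hJstep : X.J c.γ θ + η * inner ℝ p u - c.smooth * η ^ 2 * Q ≤
      ∫ τ, X.J c.γ (θ + η • (X.gDiff θ θ₀ τ + μ)) ∂(X.trajLaw θ) := by
    have hJm : Measurable fun τ => X.J c.γ (θ + η • (X.gDiff θ θ₀ τ + μ)) :=
      (continuous_J hX).measurable.comp ((hv_m.const_smul η).const_add θ)
    have hJi : Integrable (fun τ => X.J c.γ (θ + η • (X.gDiff θ θ₀ τ + μ))) (X.trajLaw θ) :=
      Integrable.of_bound hJm.aestronglyMeasurable (c.H * c.R) (ae_of_all _ fun τ => by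
        rw [Real.norm_of_nonneg (J_mem hX _).1]; exact (J_mem hX _).2)
    have hvi2 : Integrable (fun τ => ‖X.gDiff θ θ₀ τ + μ‖ ^ 2) (X.trajLaw θ) :=
      Integrable.of_bound (hv_m.norm.pow_const 2).aestronglyMeasurable ((K + ‖μ‖) ^ 2)
        (ae_of_all _ fun τ => by
          rw [norm_pow, norm_norm]; exact pow_le_pow_left₀ (norm_nonneg _) (hv_b τ) 2)
    have hin : Integrable (fun τ => η * inner ℝ p (X.gDiff θ θ₀ τ + μ)) (X.trajLaw θ) :=
      (hv_int.const_inner p).const_mul η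
    have hlow : Integrable (fun τ => X.J c.γ θ + η * inner ℝ p (X.gDiff θ θ₀ τ + μ))
        (X.trajLaw θ) := (integrable_const _).add hin
    have h := integral_mono (hlow.sub (hvi2.const_mul (c.smooth * η ^ 2))) hJi fun τ => by
      have h := J_ge hX θ (θ + η • (X.gDiff θ θ₀ τ + μ))
      rw [add_sub_cancel_left, inner_smul_right, norm_smul, mul_pow, Real.norm_eq_abs, sq_abs,
        ← mul_assoc] at h
      exact h
    simp only [Pi.sub_apply] at h
    rw [integral_sub hlow (hvi2.const_mul _), integral_add (integrable_const _) hin,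
      integral_const, probReal_univ, one_smul, integral_const_mul, integral_const_mul,
      integral_inner hv_int, hmean] at h
    exact h
  rw [hdist]
  refine inner_step_arith c.smooth_pos hη hb hx1 hx2 hx3 (sq_nonneg ‖u‖) (sq_nonneg ‖θ - θ₀‖)
    ?_ hQ ?_ hJstep
  · have e : μ - p₀ = u - p := by rw [hu]; abel
    rw [e, norm_sub_sq_real, real_inner_comm]
    ring
  · have h1 : inner ℝ (θ - θ₀) u ≤ ‖θ - θ₀‖ * ‖u‖ := real_inner_le_norm _ _
    have h2 := mul_le_mul_of_nonneg_left h1 (by positivity : 0 ≤ 2 * η)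
    refine h2.trans ?_
    have hb0 : 0 < b := by linarith
    have h3 : ‖θ - θ₀‖ ^ 2 / (4 * b) + 4 * b * η ^ 2 * ‖u‖ ^ 2 - 2 * η * (‖θ - θ₀‖ * ‖u‖) =
        (‖θ - θ₀‖ - 4 * b * η * ‖u‖) ^ 2 / (4 * b) := by field_simp; ring
    have h4 : 0 ≤ (‖θ - θ₀‖ - 4 * b * η * ‖u‖) ^ 2 / (4 * b) := by positivity
    linarith

end InnerStep

end FedPG

/-! ### The inner loop with a geometric number of steps. -/

namespace FedPG

section Geometric

theorem lintegral_stepsLaw (B : ℕ) (f : ℕ → ℝ≥0∞) :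
    ∫⁻ n, f n ∂(stepsLaw B) =
      ∑' n, ENNReal.ofReal (((B : ℝ) / (B + 1)) ^ n * (1 / ((B : ℝ) + 1))) * f n := by
  have hB : (0 : ℝ) < (B : ℝ) + 1 := by positivity
  rw [stepsLaw, geometricMeasure_eq (by
    intro h
    have := congrArg Subtype.val h
    simp only [Set.Icc.coe_zero] at this
    exact (one_div_pos.2 hB).ne' this), lintegral_sum_measure]
  refine tsum_congr fun n => ?_
  rw [lintegral_smul_measure, lintegral_dirac, smul_eq_mul]
  congr 4
  field_simp
  ring

theorem lintegral_ofReal_stepsLaw {B : ℕ} {a : ℕ → ℝ} {C : ℝ} (h0 : ∀ n, 0 ≤ a n)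
    (hC : ∀ n, a n ≤ C) : Summable (fun n => ((B : ℝ) / (B + 1)) ^ n * a n) ∧
    ∫⁻ n, ENNReal.ofReal (a n) ∂(stepsLaw B) =
      ENNReal.ofReal (1 / ((B : ℝ) + 1) * ∑' n, ((B : ℝ) / (B + 1)) ^ n * a n) := by
  have hB : (0 : ℝ) < (B : ℝ) + 1 := by positivity
  have hΓ0 : 0 ≤ (B : ℝ) / (B + 1) := by positivity
  have hΓ1 : (B : ℝ) / (B + 1) < 1 := by rw [div_lt_one hB]; linarith
  have hs : Summable (fun n => ((B : ℝ) / (B + 1)) ^ n * a n) :=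
    Summable.of_nonneg_of_le (fun n => mul_nonneg (pow_nonneg hΓ0 n) (h0 n))
      (fun n => mul_le_mul_of_nonneg_left (hC n) (pow_nonneg hΓ0 n))
      ((summable_geometric_of_lt_one hΓ0 hΓ1).mul_right C)
  refine ⟨hs, ?_⟩
  rw [lintegral_stepsLaw, ← tsum_mul_left, ENNReal.ofReal_tsum_of_nonneg
    (fun n => mul_nonneg (by positivity) (mul_nonneg (pow_nonneg hΓ0 n) (h0 n))) (hs.mul_left _)]
  refine tsum_congr fun n => ?_
  rw [← ENNReal.ofReal_mul (mul_nonneg (pow_nonneg hΓ0 n) (by positivity))]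
  congr 1
  ring

/-- Telescoping under a geometric number of steps. -/
theorem geometric_telescope {b l e : ℝ} {x y D : ℕ → ℝ} (hb : 0 < b) (hl : 0 ≤ l)
    (hx : Summable fun n => (b / (b + 1)) ^ n * x n)
    (hy : Summable fun n => (b / (b + 1)) ^ n * y n) (hD : ∀ n, 0 ≤ D n) (hD0 : D 0 = 0)
    (h : ∀ n, l * D (n + 1) + x n + y n ≤ x (n + 1) + l * (1 + 1 / b) * D n + e) :
    1 / (b + 1) * ∑' n, (b / (b + 1)) ^ n * y n + x 0 / b ≤
      1 / (b + 1) * (∑' n, (b / (b + 1)) ^ n * x n) / b + e := by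
  set Γ := b / (b + 1) with hΓ
  have hb1 : 0 < b + 1 := by linarith
  have hΓ0 : 0 < Γ := by positivity
  have hΓ1 : Γ < 1 := by rw [hΓ, div_lt_one hb1]; linarith
  -- Weighting the inequality of step `n` by `Γ ^ n` makes the distance terms telescope, thanks to
  -- this identity.
  have hΓl : Γ * (l * (1 + 1 / b)) = l := by rw [hΓ]; field_simp
  have hpart : ∀ N, ∑ n ∈ Finset.range N, Γ ^ n * (x n + y n - x (n + 1) - e) +
      Γ ^ N * (l * (1 + 1 / b) * D N) ≤ 0 := by
    intro N
    induction N with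
    | zero => simp [hD0]
    | succ N ih =>
      rw [Finset.sum_range_succ, pow_succ]
      have h1 := mul_le_mul_of_nonneg_left (h N) (pow_nonneg hΓ0.le N)
      have h2 : Γ ^ N * Γ * (l * (1 + 1 / b) * D (N + 1)) = Γ ^ N * (l * D (N + 1)) := by
        rw [← hΓl]; simp only [hΓl]; rw [mul_assoc, ← mul_assoc Γ, hΓl]
      rw [h2]
      nlinarith
  have hx1 : Summable fun n => Γ ^ n * x (n + 1) := by
    have := ((summable_nat_add_iff 1).2 hx).mul_left Γ⁻¹
    refine this.congr fun n => ?_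
    field_simp
    ring
  have hg := summable_geometric_of_lt_one hΓ0.le hΓ1
  have hsum : Summable fun n => Γ ^ n * (x n + y n - x (n + 1) - e) := by
    refine (((hx.add hy).sub hx1).sub (hg.mul_right e)).congr fun n => ?_
    ring
  -- The leftover distance term is nonnegative and is dropped before the limit, so the growth of `D`
  -- need not be controlled.
  have hle : ∑' n, Γ ^ n * (x n + y n - x (n + 1) - e) ≤ 0 := by
    refine le_of_tendsto' hsum.hasSum.tendsto_sum_nat fun N => ?_
    have h3 : 0 ≤ Γ ^ N * (l * (1 + 1 / b) * D N) := by have := hD N; positivity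
    linarith [hpart N]
  have hsplit : ∑' n, Γ ^ n * (x n + y n - x (n + 1) - e) =
      ∑' n, Γ ^ n * x n + ∑' n, Γ ^ n * y n - ∑' n, Γ ^ n * x (n + 1) - (1 - Γ)⁻¹ * e := by
    rw [← tsum_geometric_of_lt_one hΓ0.le hΓ1, ← tsum_mul_right, ← hx.tsum_add hy,
      ← (hx.add hy).tsum_sub hx1, ← ((hx.add hy).sub hx1).tsum_sub (hg.mul_right e)]
    exact tsum_congr fun n => by ring
  have hshift : ∑' n, Γ ^ n * x n = x 0 + Γ * ∑' n, Γ ^ n * x (n + 1) := by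
    rw [hx.tsum_eq_zero_add, ← tsum_mul_left]
    simp only [pow_zero, one_mul]
    congr 1
    exact tsum_congr fun n => by ring
  rw [hsplit] at hle
  set Sx := ∑' n, Γ ^ n * x n
  set Sx' := ∑' n, Γ ^ n * x (n + 1)
  set Sy := ∑' n, Γ ^ n * y n
  have e1 : (1 - Γ)⁻¹ = b + 1 := by
    have : 1 - Γ = (b + 1)⁻¹ := by rw [hΓ]; field_simp; ring
    rw [this, inv_inv]
  rw [e1] at hle
  have e2 : Sx' = (Sx - x 0) * ((b + 1) / b) := by
    rw [hshift, hΓ]; field_simp; ring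
  rw [e2] at hle
  have e3 : 1 / (b + 1) * Sy + x 0 / b - (1 / (b + 1) * Sx / b + e) =
      1 / (b + 1) * (Sx + Sy - (Sx - x 0) * ((b + 1) / b) - (b + 1) * e) := by
    field_simp; ring
  have e4 : 1 / (b + 1) * (Sx + Sy - (Sx - x 0) * ((b + 1) / b) - (b + 1) * e) ≤ 0 :=
    mul_nonpos_of_nonneg_of_nonpos (by positivity) hle
  linarith

end Geometric

section OfReal

theorem ofReal_mul_add_le {a x y a' x' y' : ℝ} (ha : 0 ≤ a) (hx : 0 ≤ x) (hy : 0 ≤ y)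
    (ha' : 0 ≤ a') (hx' : 0 ≤ x') (hy' : 0 ≤ y') (h : a * x + y ≤ a' * x' + y') :
    ENNReal.ofReal a * ENNReal.ofReal x + ENNReal.ofReal y ≤
      ENNReal.ofReal a' * ENNReal.ofReal x' + ENNReal.ofReal y' := by
  rw [← ENNReal.ofReal_mul ha, ← ENNReal.ofReal_mul ha',
    ← ENNReal.ofReal_add (mul_nonneg ha hx) hy, ← ENNReal.ofReal_add (mul_nonneg ha' hx') hy']
  exact ENNReal.ofReal_le_ofReal h

theorem ofReal_mul_add_add_le_iff {a x y z x' a' y' z' : ℝ} (ha : 0 ≤ a) (hx : 0 ≤ x) (hy : 0 ≤ y)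
    (hz : 0 ≤ z) (ha' : 0 ≤ a') (hx' : 0 ≤ x') (hy' : 0 ≤ y') (hz' : 0 ≤ z') :
    ENNReal.ofReal a * ENNReal.ofReal x + ENNReal.ofReal y + ENNReal.ofReal z ≤
      ENNReal.ofReal x' + ENNReal.ofReal a' * ENNReal.ofReal y' + ENNReal.ofReal z' ↔
    a * x + y + z ≤ x' + a' * y' + z' := by
  have h1 := mul_nonneg ha hx
  have h2 := mul_nonneg ha' hy'
  rw [← ENNReal.ofReal_mul ha, ← ENNReal.ofReal_mul ha', ← ENNReal.ofReal_add h1 hy,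
    ← ENNReal.ofReal_add (add_nonneg h1 hy) hz, ← ENNReal.ofReal_add hx' h2,
    ← ENNReal.ofReal_add (add_nonneg hx' h2) hz',
    ENNReal.ofReal_le_ofReal_iff (add_nonneg (add_nonneg hx' h2) hz')]

end OfReal

section InnerLoop

variable {S A : Type*} [MeasurableSpace S] [MeasurableSpace A] {d : ℕ} {c : Constants}
  {X : Setting S A d c.H} (hX : Assumptions c X)

/-- The transition law of the inner loop. -/
def innerKernel (X : Setting S A d c.H) (η : ℝ) (θ₀ μ θ : Param d) : Measure (Param d) :=
  (X.trajLaw θ).map fun τ => θ + η • (X.gDiff θ θ₀ τ + μ)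

theorem innerLaw_succ (X : Setting S A d c.H) (η : ℝ) (θ₀ μ : Param d) (n : ℕ) :
    innerLaw X c.γ η θ₀ μ (n + 1) = (innerLaw X c.γ η θ₀ μ n).bind (innerKernel X η θ₀ μ) := rfl

include hX

theorem measurable_inner_update (η : ℝ) : Measurable fun q : (Param d × Param d × Param d) ×
    Traj S A c.H => q.1.2.2 + η • (X.gDiff q.1.2.2 q.1.1 q.2 + q.1.2.1) := by
  have h := (measurable_gDiff hX).comp (by fun_prop :
    Measurable fun q : (Param d × Param d × Param d) × Traj S A c.H =>
      ((q.1.2.2, q.1.1), q.2))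
  have h1 : Measurable fun q : (Param d × Param d × Param d) × Traj S A c.H => q.1.2.2 := by
    fun_prop
  have h2 : Measurable fun q : (Param d × Param d × Param d) × Traj S A c.H => q.1.2.1 := by
    fun_prop
  exact h1.add ((h.add h2).const_smul η)

theorem measurable_inner_update_left (η : ℝ) (θ₀ μ θ : Param d) :
    Measurable fun τ => θ + η • (X.gDiff θ θ₀ τ + μ) :=
  (((measurable_gDiff_left hX θ θ₀).add_const μ).const_smul η).const_add θ

theorem innerKernel_prob (η : ℝ) (θ₀ μ θ : Param d) :
    IsProbabilityMeasure (innerKernel X η θ₀ μ θ) := by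
  have := trajLaw_prob hX θ
  exact Measure.isProbabilityMeasure_map (measurable_inner_update_left hX η θ₀ μ θ).aemeasurable

theorem measurable_innerKernel (η : ℝ) :
    Measurable fun q : Param d × Param d × Param d => innerKernel X η q.1 q.2.1 q.2.2 := by
  have := trajLaw_prob hX
  have h := (measurable_trajLaw hX).comp
    (by fun_prop : Measurable fun q : Param d × Param d × Param d => q.2.2)
  simp only [Function.comp_def] at h
  exact measurable_map_param h (k := fun q τ => q.2.2 + η • (X.gDiff q.2.2 q.1 τ + q.2.1))
    (measurable_inner_update hX η)

theorem measurable_innerKernel_left (η : ℝ) (θ₀ μ : Param d) :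
    Measurable (innerKernel X η θ₀ μ) := by
  have h := (measurable_innerKernel hX η).comp
    (by fun_prop : Measurable fun θ : Param d => (θ₀, μ, θ))
  exact h

theorem innerLaw_prob_and_measurable (η : ℝ) (n : ℕ) :
    (∀ θ₀ μ, IsProbabilityMeasure (innerLaw X c.γ η θ₀ μ n)) ∧
      Measurable fun q : Param d × Param d => innerLaw X c.γ η q.1 q.2 n := by
  induction n with
  | zero =>
    refine ⟨fun θ₀ μ => ?_, ?_⟩
    · unfold innerLaw; infer_instance
    · unfold innerLaw
      exact Measure.measurable_dirac.comp measurable_fst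
  | succ n ih =>
    obtain ⟨ihp, ihm⟩ := ih
    simp_rw [innerLaw_succ]
    refine ⟨fun θ₀ μ => ?_, ?_⟩
    · have := ihp θ₀ μ
      exact isProbabilityMeasure_bind_of_measurable (measurable_innerKernel_left hX η θ₀ μ)
        (innerKernel_prob hX η θ₀ μ)
    · have := fun q : Param d × Param d => ihp q.1 q.2
      have h := (measurable_innerKernel hX η).comp
        (by fun_prop : Measurable fun q : (Param d × Param d) × Param d => (q.1.1, q.1.2, q.2))
      exact measurable_bind_param ihm (k := fun q => innerKernel X η q.1 q.2) h

theorem innerLaw_prob (η : ℝ) (n : ℕ) (θ₀ μ : Param d) :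
    IsProbabilityMeasure (innerLaw X c.γ η θ₀ μ n) := (innerLaw_prob_and_measurable hX η n).1 θ₀ μ

theorem lintegral_innerKernel (η : ℝ) (θ₀ μ θ : Param d) {f : Param d → ℝ≥0∞}
    (hf : Measurable f) : ∫⁻ θ', f θ' ∂(innerKernel X η θ₀ μ θ) =
      ∫⁻ τ, f (θ + η • (X.gDiff θ θ₀ τ + μ)) ∂(X.trajLaw θ) :=
  lintegral_map hf (measurable_inner_update_left hX η θ₀ μ θ)

theorem inner_step_lintegral (θ θ₀ μ : Param d) {η b : ℝ} (hη : 0 < η) (hb : 1 ≤ b)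
    (hx1 : c.smooth * η ≤ 1 / 4) (hx2 : (c.smooth * η) ^ 2 * b ≤ 1 / 16)
    (hx3 : (c.smooth * η) ^ 3 * b ^ 2 ≤ 1 / 64) :
    ENNReal.ofReal (2 * c.smooth ^ 3 * η ^ 2 * b) *
        ∫⁻ θ', ENNReal.ofReal (‖θ' - θ₀‖ ^ 2) ∂(innerKernel X η θ₀ μ θ) +
        ENNReal.ofReal (X.J c.γ θ) +
        ENNReal.ofReal (η / 2 * ‖gradient (X.J c.γ) θ‖ ^ 2) ≤
      ∫⁻ θ', ENNReal.ofReal (X.J c.γ θ') ∂(innerKernel X η θ₀ μ θ) +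
        ENNReal.ofReal (2 * c.smooth ^ 3 * η ^ 2 * b * (1 + 1 / b)) *
          ENNReal.ofReal (‖θ - θ₀‖ ^ 2) +
        ENNReal.ofReal (η / 2 * ‖μ - gradient (X.J c.γ) θ₀‖ ^ 2) := by
  have := trajLaw_prob hX θ
  have hu := measurable_inner_update_left hX η θ₀ μ θ
  have hs := c.smooth_pos
  have hJm := (continuous_J hX).measurable
  rw [lintegral_innerKernel hX _ _ _ _ (by fun_prop),
    lintegral_innerKernel hX _ _ _ _ (f := fun θ => ENNReal.ofReal (X.J c.γ θ))
      (ENNReal.measurable_ofReal.comp hJm)]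
  have hK : ∀ τ, ‖X.gDiff θ θ₀ τ‖ ≤ _ := norm_gDiff_le hX θ θ₀
  have i1 : Integrable (fun τ => ‖θ + η • (X.gDiff θ θ₀ τ + μ) - θ₀‖ ^ 2) (X.trajLaw θ) := by
    refine Integrable.of_bound ((hu.sub_const θ₀).norm.pow_const 2).aestronglyMeasurable
      ((‖θ‖ + |η| * (c.gBound + Real.exp (c.H * c.G * ‖θ₀ - θ‖) * c.gBound + ‖μ‖) + ‖θ₀‖) ^ 2)
      (ae_of_all _ fun τ => ?_)
    rw [norm_pow, norm_norm]
    refine pow_le_pow_left₀ (norm_nonneg _) ((norm_sub_le _ _).trans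
      (add_le_add ((norm_add_le _ _).trans (add_le_add le_rfl ?_)) le_rfl)) 2
    rw [norm_smul]
    exact mul_le_mul_of_nonneg_left ((norm_add_le _ _).trans (add_le_add (hK τ) le_rfl))
      (abs_nonneg _)
  have i2 : Integrable (fun τ => X.J c.γ (θ + η • (X.gDiff θ θ₀ τ + μ))) (X.trajLaw θ) :=
    Integrable.of_bound (hJm.comp hu).aestronglyMeasurable (c.H * c.R) (ae_of_all _ fun τ => by
      rw [Real.norm_of_nonneg (J_mem hX _).1]; exact (J_mem hX _).2)
  rw [← ofReal_integral_eq_lintegral_ofReal i1 (ae_of_all _ fun τ => by positivity),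
    ← ofReal_integral_eq_lintegral_ofReal i2 (ae_of_all _ fun τ => (J_mem hX _).1)]
  have n1 : 0 ≤ ∫ τ, ‖θ + η • (X.gDiff θ θ₀ τ + μ) - θ₀‖ ^ 2 ∂(X.trajLaw θ) :=
    integral_nonneg fun τ => by positivity
  have n2 : 0 ≤ ∫ τ, X.J c.γ (θ + η • (X.gDiff θ θ₀ τ + μ)) ∂(X.trajLaw θ) :=
    integral_nonneg fun τ => (J_mem hX _).1
  have n3 := (J_mem hX θ).1
  exact (ofReal_mul_add_add_le_iff (by positivity) n1 n3 (by positivity) (by positivity) n2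
    (sq_nonneg _) (by positivity)).2 (inner_step hX θ θ₀ μ hη hb hx1 hx2 hx3)

set_option maxHeartbeats 400000 in
/-- The inner loop makes progress when the gradient is large. -/
theorem inner_loop (θ₀ μ : Param d) {η : ℝ} {B : ℕ} (hη : 0 < η) (hB : 1 ≤ B)
    (hx1 : c.smooth * η ≤ 1 / 4) (hx2 : (c.smooth * η) ^ 2 * B ≤ 1 / 16)
    (hx3 : (c.smooth * η) ^ 3 * (B : ℝ) ^ 2 ≤ 1 / 64) :
    ∫⁻ n, ∫⁻ θ, ENNReal.ofReal (‖gradient (X.J c.γ) θ‖ ^ 2) ∂(innerLaw X c.γ η θ₀ μ n)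
        ∂(stepsLaw B) + ENNReal.ofReal (2 / (η * B) * X.J c.γ θ₀) ≤
      ∫⁻ n, ∫⁻ θ, ENNReal.ofReal (2 / (η * B) * X.J c.γ θ) ∂(innerLaw X c.γ η θ₀ μ n)
        ∂(stepsLaw B) + ENNReal.ofReal (‖μ - gradient (X.J c.γ) θ₀‖ ^ 2) := by
  have hBr : (1 : ℝ) ≤ B := by exact_mod_cast hB
  have hprob := innerLaw_prob hX η (θ₀ := θ₀) (μ := μ)
  have hJm := (continuous_J hX).measurable
  have hGm := (continuous_gradient_J hX).measurable
  have hs := c.smooth_pos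
  set ν := innerLaw X c.γ η θ₀ μ with hν
  set l := 2 * c.smooth ^ 3 * η ^ 2 * B with hl
  set e := η / 2 * ‖μ - gradient (X.J c.γ) θ₀‖ ^ 2 with he
  set x : ℕ → ℝ := fun n => ∫ θ, X.J c.γ θ ∂(ν n) with hx
  set y : ℕ → ℝ := fun n => ∫ θ, η / 2 * ‖gradient (X.J c.γ) θ‖ ^ 2 ∂(ν n) with hy
  set D : ℕ → ℝ≥0∞ := fun n => ∫⁻ θ, ENNReal.ofReal (‖θ - θ₀‖ ^ 2) ∂(ν n) with hD
  have hl0 : 0 < l := by positivity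
  have he0 : 0 ≤ e := by positivity
  have hx0 : ∀ n, 0 ≤ x n := fun n => integral_nonneg fun θ => (J_mem hX θ).1
  have hy0 : ∀ n, 0 ≤ y n := fun n => integral_nonneg fun θ => by positivity
  have ix : ∀ n, Integrable (X.J c.γ) (ν n) := fun n =>
    Integrable.of_bound hJm.aestronglyMeasurable (c.H * c.R) (ae_of_all _ fun τ => by
      rw [Real.norm_of_nonneg (J_mem hX _).1]; exact (J_mem hX _).2)
  have hyb : ∀ θ, η / 2 * ‖gradient (X.J c.γ) θ‖ ^ 2 ≤ η / 2 * c.gBound ^ 2 := fun θ =>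
    mul_le_mul_of_nonneg_left (pow_le_pow_left₀ (norm_nonneg _) (norm_gradient_J_le hX θ) 2)
      (by positivity)
  have iy : ∀ n, Integrable (fun θ => η / 2 * ‖gradient (X.J c.γ) θ‖ ^ 2) (ν n) := fun n =>
    Integrable.of_bound ((hGm.norm.pow_const 2).const_mul _).aestronglyMeasurable
      (η / 2 * c.gBound ^ 2) (ae_of_all _ fun τ => by
      rw [Real.norm_of_nonneg (by positivity)]; exact hyb τ)
  have hxC : ∀ n, x n ≤ c.H * c.R := fun n => by
    have h := integral_mono (ix n) (integrable_const _) fun θ => (J_mem hX θ).2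
    rwa [integral_const, probReal_univ, one_smul] at h
  have hyC : ∀ n, y n ≤ η / 2 * c.gBound ^ 2 := fun n => by
    have h := integral_mono (iy n) (integrable_const _) hyb
    rwa [integral_const, probReal_univ, one_smul] at h
  have exl : ∀ n, ∫⁻ θ, ENNReal.ofReal (X.J c.γ θ) ∂(ν n) = ENNReal.ofReal (x n) := fun n =>
    (ofReal_integral_eq_lintegral_ofReal (ix n) (ae_of_all _ fun θ => (J_mem hX θ).1)).symm
  have eyl : ∀ n, ∫⁻ θ, ENNReal.ofReal (η / 2 * ‖gradient (X.J c.γ) θ‖ ^ 2) ∂(ν n) =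
      ENNReal.ofReal (y n) := fun n =>
    (ofReal_integral_eq_lintegral_ofReal (iy n) (ae_of_all _ fun θ => by positivity)).symm
  have hstep : ∀ n, ENNReal.ofReal l * D (n + 1) + ENNReal.ofReal (x n) + ENNReal.ofReal (y n) ≤
      ENNReal.ofReal (x (n + 1)) + ENNReal.ofReal (l * (1 + 1 / B)) * D n + ENNReal.ofReal e := by
    intro n
    have hk := measurable_innerKernel_left hX η θ₀ μ
    have mD : Measurable fun θ : Param d => ENNReal.ofReal (‖θ - θ₀‖ ^ 2) := by fun_prop
    have mJ : Measurable fun θ : Param d => ENNReal.ofReal (X.J c.γ θ) :=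
      ENNReal.measurable_ofReal.comp hJm
    have mG : Measurable fun θ : Param d =>
        ENNReal.ofReal (η / 2 * ‖gradient (X.J c.γ) θ‖ ^ 2) :=
      ENNReal.measurable_ofReal.comp ((hGm.norm.pow_const 2).const_mul _)
    have mDk := (Measure.measurable_lintegral mD).comp hk
    have mJk := (Measure.measurable_lintegral mJ).comp hk
    simp only [Function.comp_def] at mDk mJk
    have h := lintegral_mono (μ := ν n) fun θ =>
      inner_step_lintegral hX θ θ₀ μ hη hBr hx1 hx2 hx3
    rw [lintegral_add_right _ mG, lintegral_add_right _ mJ, lintegral_const_mul _ mDk,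
      lintegral_add_right _ measurable_const, lintegral_add_left mJk, lintegral_const_mul _ mD,
      lintegral_const, measure_univ, mul_one, ← lintegral_bind_map hk mD,
      ← lintegral_bind_map hk mJ, exl, eyl] at h
    rw [← exl (n + 1)]
    exact h
  have hD0 : D 0 = 0 := by
    have : ν 0 = Measure.dirac θ₀ := rfl
    rw [hD]
    simp only [this]
    rw [lintegral_dirac' _ (by fun_prop)]
    simp
  -- Finiteness of the second moments comes from the step inequality itself: as `l > 0`, it bounds
  -- `D (n + 1)` by finite quantities and `D n`.
  have hDfin : ∀ n, D n ≠ ∞ := by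
    intro n
    induction n with
    | zero => rw [hD0]; exact ENNReal.zero_ne_top
    | succ n ih =>
      intro htop
      have h := hstep n
      rw [htop, ENNReal.mul_top (by simpa using hl0), top_add, top_add, top_le_iff] at h
      exact ENNReal.add_ne_top.2 ⟨ENNReal.add_ne_top.2 ⟨ENNReal.ofReal_ne_top,
        ENNReal.mul_ne_top ENNReal.ofReal_ne_top ih⟩, ENNReal.ofReal_ne_top⟩ h
  have hreal : ∀ n, l * (D (n + 1)).toReal + x n + y n ≤
      x (n + 1) + l * (1 + 1 / B) * (D n).toReal + e := by
    intro n
    have h := hstep n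
    have hl1 : 0 ≤ l * (1 + 1 / (B : ℝ)) := by positivity
    rw [← ENNReal.ofReal_toReal (hDfin n), ← ENNReal.ofReal_toReal (hDfin (n + 1))] at h
    exact (ofReal_mul_add_add_le_iff hl0.le ENNReal.toReal_nonneg (hx0 n) (hy0 n) hl1 (hx0 _)
      ENNReal.toReal_nonneg he0).1 h
  obtain ⟨sx, lx⟩ := lintegral_ofReal_stepsLaw (B := B) hx0 hxC
  obtain ⟨sy, ly⟩ := lintegral_ofReal_stepsLaw (B := B) hy0 hyC
  have htel := geometric_telescope (D := fun n => (D n).toReal) (by linarith : (0 : ℝ) < B)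
    hl0.le sx sy
    (fun n => ENNReal.toReal_nonneg) (by rw [hD0]; rfl) hreal
  set Sx := 1 / ((B : ℝ) + 1) * ∑' n, ((B : ℝ) / (B + 1)) ^ n * x n
  set Sy := 1 / ((B : ℝ) + 1) * ∑' n, ((B : ℝ) / (B + 1)) ^ n * y n
  have hx00 : x 0 = X.J c.γ θ₀ := by
    have : ν 0 = Measure.dirac θ₀ := rfl
    rw [hx]
    simp only [this]
    rw [integral_dirac' _ _ hJm.stronglyMeasurable]
  have hSx0 : 0 ≤ Sx := mul_nonneg (by positivity)
    (tsum_nonneg fun n => mul_nonneg (by positivity) (hx0 n))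
  have hSy0 : 0 ≤ Sy := mul_nonneg (by positivity)
    (tsum_nonneg fun n => mul_nonneg (by positivity) (hy0 n))
  have hJ0 := (J_mem hX θ₀).1
  have eG : ∀ n, ∫⁻ θ, ENNReal.ofReal (‖gradient (X.J c.γ) θ‖ ^ 2) ∂(ν n) =
      ENNReal.ofReal (2 / η) * ENNReal.ofReal (y n) := by
    intro n
    rw [← eyl, ← lintegral_const_mul' _ _ ENNReal.ofReal_ne_top]
    refine lintegral_congr fun θ => ?_
    rw [← ENNReal.ofReal_mul (by positivity)]
    congr 1
    field_simp
  have eJ : ∀ n, ∫⁻ θ, ENNReal.ofReal (2 / (η * B) * X.J c.γ θ) ∂(ν n) =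
      ENNReal.ofReal (2 / (η * B)) * ENNReal.ofReal (x n) := by
    intro n
    rw [← exl, ← lintegral_const_mul' _ _ ENNReal.ofReal_ne_top]
    exact lintegral_congr fun θ => ENNReal.ofReal_mul (by positivity)
  simp_rw [eG, eJ]
  rw [lintegral_const_mul' _ _ ENNReal.ofReal_ne_top,
    lintegral_const_mul' _ _ ENNReal.ofReal_ne_top, lx, ly]
  refine ofReal_mul_add_le (by positivity) hSy0 (mul_nonneg (by positivity) hJ0) (by positivity)
    hSx0 (sq_nonneg _) ?_
  rw [hx00] at htel
  have h2 := mul_le_mul_of_nonneg_left htel (by positivity : 0 ≤ 2 / η)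
  have e1 : 2 / η * (Sy + X.J c.γ θ₀ / B) = 2 / η * Sy + 2 / (η * B) * X.J c.γ θ₀ := by
    field_simp
  have e2 : 2 / η * (Sx / B + e) =
      2 / (η * B) * Sx + ‖μ - gradient (X.J c.γ) θ₀‖ ^ 2 := by
    rw [he]; field_simp
  rwa [e1, e2] at h2

end InnerLoop

end FedPG

/-! ### Concentration of sums of independent vectors. -/

namespace FedPG

section Cosh

/-- The power series of `cosh √u` in `u`, with terms `u ^ n / (2n)!`, has nonnegative coefficients,
so the function is a sum of convex functions on the half-line. -/
theorem convexOn_cosh_sqrt : ConvexOn ℝ (Set.Ici (0 : ℝ)) fun u => Real.cosh √u := by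
  have hs : ∀ u : ℝ, 0 ≤ u → HasSum (fun n : ℕ => u ^ n / ((2 * n).factorial : ℝ))
      (Real.cosh √u) := by
    intro u hu
    have h := Real.hasSum_cosh √u
    simpa only [pow_mul, Real.sq_sqrt hu] using h
  refine ⟨convex_Ici 0, fun x hx y hy a b ha hb hab => ?_⟩
  have hx' : (0 : ℝ) ≤ x := hx
  have hy' : (0 : ℝ) ≤ y := hy
  refine hasSum_le (fun n => ?_) (hs _ (by simp only [smul_eq_mul]; positivity))
    (((hs x hx').mul_left a).add ((hs y hy').mul_left b))
  have h := (convexOn_pow (𝕜 := ℝ) n).2 hx hy ha hb hab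
  simp only [smul_eq_mul] at h ⊢
  have hf : (0 : ℝ) < ((2 * n).factorial : ℝ) := by exact_mod_cast Nat.factorial_pos _
  rw [mul_div_assoc', mul_div_assoc', ← add_div]
  exact div_le_div_of_nonneg_right h hf.le

variable {E : Type*} [NormedAddCommGroup E] [InnerProductSpace ℝ E]

/-- With `a = ‖x‖`, the upper bound `a² + 2⟨x, Y⟩ + s²` for `‖x + Y‖²` is affine in `⟨x, Y⟩` and
runs from `(a - s)²` to `(a + s)²`. Convexity of `cosh √u` bounds the value by the chord, whose
midpoint is `cosh a * cosh s`. Since `k` does not depend on `Y`, the linear term vanishes in the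
mean for centered `Y`. -/
theorem exists_cosh_norm_add_le (x : E) {s : ℝ} (hs : 0 ≤ s) : ∃ k : ℝ, ∀ Y : E, ‖Y‖ ≤ s →
    Real.cosh ‖x + Y‖ ≤ Real.cosh ‖x‖ * Real.cosh s + k * inner ℝ x Y := by
  rcases eq_or_lt_of_le hs with rfl | hs
  · refine ⟨0, fun Y hY => ?_⟩
    rw [norm_le_zero_iff.1 hY]
    simp
  rcases eq_or_ne x 0 with rfl | hx
  · refine ⟨0, fun Y hY => ?_⟩
    simp only [zero_add, norm_zero, Real.cosh_zero, one_mul, zero_mul, add_zero]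
    exact Real.cosh_le_cosh.2 (by rwa [abs_of_nonneg (norm_nonneg _), abs_of_pos hs])
  have ha : 0 < ‖x‖ := norm_pos_iff.2 hx
  set a := ‖x‖ with haD
  refine ⟨Real.sinh a * Real.sinh s / (a * s), fun Y hY => ?_⟩
  set y := inner ℝ x Y with hy
  have hyle : |y| ≤ a * s :=
    (abs_real_inner_le_norm x Y).trans (mul_le_mul_of_nonneg_left hY ha.le)
  obtain ⟨hy1, hy2⟩ := abs_le.1 hyle
  have has : 0 < a * s := by positivity
  -- The position of `a² + 2⟨x, Y⟩ + s²` on the chord from `(a - s)²` to `(a + s)²`.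
  set t := (1 + y / (a * s)) / 2 with ht
  have hq1 : -1 ≤ y / (a * s) := by rw [le_div_iff₀ has]; linarith
  have hq2 : y / (a * s) ≤ 1 := by rw [div_le_one has]; exact hy2
  have hc := convexOn_cosh_sqrt.2 (show (a + s) ^ 2 ∈ Set.Ici (0 : ℝ) from sq_nonneg (a + s))
    (show (a - s) ^ 2 ∈ Set.Ici (0 : ℝ) from sq_nonneg (a - s))
    (show 0 ≤ t by rw [ht]; linarith) (show 0 ≤ 1 - t by rw [ht]; linarith) (by ring)
  simp only [smul_eq_mul, Real.sqrt_sq_eq_abs, Real.cosh_abs, Real.cosh_add, Real.cosh_sub] at hc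
  have e : t * (a + s) ^ 2 + (1 - t) * (a - s) ^ 2 = a ^ 2 + 2 * y + s ^ 2 := by
    rw [ht]; field_simp; ring
  rw [e] at hc
  have hle : ‖x + Y‖ ≤ √(a ^ 2 + 2 * y + s ^ 2) := by
    refine Real.le_sqrt_of_sq_le ?_
    rw [norm_add_sq_real]
    have := pow_le_pow_left₀ (norm_nonneg Y) hY 2
    linarith
  have h1 : Real.cosh ‖x + Y‖ ≤ Real.cosh √(a ^ 2 + 2 * y + s ^ 2) :=
    Real.cosh_le_cosh.2 (by
      rwa [abs_of_nonneg (norm_nonneg _), abs_of_nonneg (Real.sqrt_nonneg _)])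
  refine h1.trans (hc.trans (le_of_eq ?_))
  rw [ht]; field_simp; ring

end Cosh

section Concentration

variable {Ω E : Type*} [MeasurableSpace Ω] {P : Measure Ω} [IsProbabilityMeasure P]
  [NormedAddCommGroup E] [InnerProductSpace ℝ E] [CompleteSpace E] [MeasurableSpace E]
  [BorelSpace E] [SecondCountableTopology E]

theorem lintegral_pi_succ (n : ℕ) {f : (Fin (n + 1) → Ω) → ℝ≥0∞} (hf : Measurable f) :
    ∫⁻ τ, f τ ∂(Measure.pi fun _ => P) =
      ∫⁻ ω, ∫⁻ τ, f (Fin.cons ω τ) ∂(Measure.pi fun _ : Fin n => P) ∂P := by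
  have h := (measurePreserving_piFinSuccAbove (fun _ : Fin (n + 1) => P) 0).symm
  have hm := hf.comp h.measurable
  simp only [Function.comp_def] at hm
  rw [← h.lintegral_comp hf, lintegral_prod _ hm.aemeasurable]
  refine lintegral_congr fun ω => lintegral_congr fun τ => ?_
  simp [MeasurableEquiv.piFinSuccAbove, Fin.insertNthEquiv]

/-- The bound `C` holds everywhere and serves integrability only; the bound `s`, which enters the
estimate, is only needed almost surely. -/
theorem lintegral_cosh_step {F : Ω → E} (hF : Measurable F) {C s : ℝ} (hC : ∀ ω, ‖F ω‖ ≤ C)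
    (hs : 0 ≤ s) (hFs : ∀ᵐ ω ∂P, ‖F ω‖ ≤ s) (h0 : ∫ ω, F ω ∂P = 0) (x : E) :
    ∫⁻ ω, ENNReal.ofReal (Real.cosh ‖x + F ω‖) ∂P ≤
      ENNReal.ofReal (Real.cosh ‖x‖ * Real.cosh s) := by
  obtain ⟨k, hk⟩ := exists_cosh_norm_add_le x hs
  have hi : Integrable F P := Integrable.of_bound hF.aestronglyMeasurable C (ae_of_all _ hC)
  have hi2 : Integrable (fun ω => k * inner ℝ x (F ω)) P := (hi.const_inner x).const_mul k
  have hm : Measurable fun ω => Real.cosh ‖x + F ω‖ :=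
    Real.continuous_cosh.measurable.comp (hF.const_add x).norm
  have hup : Integrable (fun ω => Real.cosh ‖x‖ * Real.cosh s + k * inner ℝ x (F ω)) P :=
    (integrable_const _).add hi2
  have hci : Integrable (fun ω => Real.cosh ‖x + F ω‖) P := by
    refine hup.mono' hm.aestronglyMeasurable ?_
    filter_upwards [hFs] with ω hω
    rw [Real.norm_of_nonneg (Real.cosh_pos _).le]
    exact hk _ hω
  rw [← ofReal_integral_eq_lintegral_ofReal hci (ae_of_all _ fun ω => (Real.cosh_pos _).le)]
  refine ENNReal.ofReal_le_ofReal ?_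
  refine (integral_mono_ae hci hup (hFs.mono fun ω hω => hk _ hω)).trans (le_of_eq ?_)
  rw [integral_add (integrable_const _) hi2, integral_const, probReal_univ, one_smul,
    integral_const_mul, integral_inner hi, h0, inner_zero_right, mul_zero, add_zero]

omit [InnerProductSpace ℝ E] [CompleteSpace E] in
theorem measurable_sum_coord {n : ℕ} {F : Fin n → Ω → E} (hF : ∀ i, Measurable (F i)) :
    Measurable fun τ : Fin n → Ω => ∑ i, F i (τ i) :=
  Finset.measurable_sum _ fun i _ => (hF i).comp (measurable_pi_apply i)

theorem lintegral_cosh_sum_le {F : Ω → E} (hF : Measurable F) {C s : ℝ} (hC : ∀ ω, ‖F ω‖ ≤ C)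
    (hs : 0 ≤ s) (hFs : ∀ᵐ ω ∂P, ‖F ω‖ ≤ s) (h0 : ∫ ω, F ω ∂P = 0) (n : ℕ) :
    ∀ x : E, ∫⁻ τ, ENNReal.ofReal (Real.cosh ‖x + ∑ i, F (τ i)‖)
        ∂(Measure.pi fun _ : Fin n => P) ≤
      ENNReal.ofReal (Real.cosh ‖x‖ * Real.cosh s ^ n) := by
  induction n with
  | zero => intro x; simp
  | succ n ih =>
    intro x
    have hm : Measurable fun τ : Fin (n + 1) → Ω =>
        ENNReal.ofReal (Real.cosh ‖x + ∑ i, F (τ i)‖) :=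
      ENNReal.measurable_ofReal.comp (Real.continuous_cosh.measurable.comp
        ((measurable_sum_coord fun _ => hF).const_add x).norm)
    rw [lintegral_pi_succ n hm]
    have hstep : ∀ ω, ∫⁻ τ, ENNReal.ofReal (Real.cosh
        ‖x + ∑ i, F ((Fin.cons ω τ : Fin (n + 1) → Ω) i)‖) ∂(Measure.pi fun _ : Fin n => P) ≤
        ENNReal.ofReal (Real.cosh s ^ n) * ENNReal.ofReal (Real.cosh ‖x + F ω‖) := by
      intro ω
      rw [← ENNReal.ofReal_mul (pow_nonneg (Real.cosh_pos _).le _), mul_comm]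
      simp_rw [Fin.sum_univ_succ, Fin.cons_zero, Fin.cons_succ, ← add_assoc]
      exact ih (x + F ω)
    refine (lintegral_mono hstep).trans ?_
    rw [lintegral_const_mul' _ _ ENNReal.ofReal_ne_top]
    refine (mul_le_mul_right (lintegral_cosh_step hF hC hs hFs h0 x) _).trans (le_of_eq ?_)
    rw [← ENNReal.ofReal_mul (pow_nonneg (Real.cosh_pos _).le _)]
    congr 1
    ring

theorem ae_pi_of_ae {ι : Type*} [Fintype ι] {p : Ω → Prop} (h : ∀ᵐ ω ∂P, p ω) :
    ∀ᵐ τ ∂(Measure.pi fun _ : ι => P), ∀ i, p (τ i) :=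
  ae_all_iff.2 fun i => (Measure.quasiMeasurePreserving_eval (fun _ : ι => P) i).ae h

/-- Hoeffding's inequality for bounded vectors, without dependence on the dimension. -/
theorem measure_norm_sum_gt_le {F : Ω → E} (hF : Measurable F) {C s : ℝ} (hC : ∀ ω, ‖F ω‖ ≤ C)
    (hs : 0 ≤ s) (hFs : ∀ᵐ ω ∂P, ‖F ω‖ ≤ s) (h0 : ∫ ω, F ω ∂P = 0) (n : ℕ) {t : ℝ}
    (ht : 0 ≤ t) :
    (Measure.pi fun _ : Fin n => P) {τ | s * √n * t < ‖∑ i, F (τ i)‖} ≤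
      ENNReal.ofReal (2 * Real.exp (-(t ^ 2 / 2))) := by
  rcases eq_or_lt_of_le (mul_nonneg hs (Real.sqrt_nonneg n)) with hz | hpos
  · have hae : ∀ᵐ τ ∂(Measure.pi fun _ : Fin n => P), ‖∑ i, F (τ i)‖ ≤ 0 := by
      rcases mul_eq_zero.1 hz.symm with hs0 | hn
      · filter_upwards [ae_pi_of_ae (ι := Fin n) hFs] with τ hτ
        rw [Finset.sum_eq_zero fun i _ => norm_le_zero_iff.1 ((hτ i).trans hs0.le), norm_zero]
      · have : n = 0 := by simpa using hn
        subst this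
        simp
    have : (Measure.pi fun _ : Fin n => P) {τ | s * √n * t < ‖∑ i, F (τ i)‖} = 0 := by
      rw [← hz, zero_mul]
      exact measure_eq_zero_iff_ae_notMem.2 (hae.mono fun τ h => not_lt.2 h)
    rw [this]
    exact zero_le
  -- The Chernoff parameter. It gives `cosh (l s) ^ n ≤ exp (t² / 2)`, while on the event the norm
  -- scaled by `l` is at least `t²` and its `cosh` at least `exp (t²) / 2`.
  set l := t / (s * √n) with hl
  have hl0 : 0 ≤ l := div_nonneg ht hpos.le
  have hcosh := lintegral_cosh_sum_le (P := P) (F := fun ω => l • F ω) (hF.const_smul l)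
    (C := l * C) (s := l * s)
    (fun ω => by
      rw [norm_smul, Real.norm_of_nonneg hl0]; exact mul_le_mul_of_nonneg_left (hC ω) hl0)
    (by positivity)
    (hFs.mono fun ω hω => by
      rw [norm_smul, Real.norm_of_nonneg hl0]; exact mul_le_mul_of_nonneg_left hω hl0)
    (by rw [integral_smul, h0, smul_zero]) n 0
  simp only [zero_add, norm_zero, Real.cosh_zero, one_mul, ← Finset.smul_sum] at hcosh
  have hbound : Real.cosh (l * s) ^ n ≤ Real.exp (t ^ 2 / 2) := by
    refine (pow_le_pow_left₀ (Real.cosh_pos _).le (Real.cosh_le_exp_half_sq _) n).trans ?_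
    rw [← Real.exp_nat_mul]
    refine Real.exp_le_exp.2 (le_of_eq ?_)
    have hs' : s ≠ 0 := fun h => by rw [h, zero_mul] at hpos; exact lt_irrefl _ hpos
    have hn' : √(n : ℝ) ≠ 0 := fun h => by rw [h, mul_zero] at hpos; exact lt_irrefl _ hpos
    have hn2 : √(n : ℝ) ^ 2 = n := Real.sq_sqrt (Nat.cast_nonneg n)
    rw [hl]
    nth_rewrite 1 [← hn2]
    field_simp
  have hm : Measurable fun τ : Fin n → Ω => ENNReal.ofReal (Real.cosh ‖l • ∑ i, F (τ i)‖) :=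
    ENNReal.measurable_ofReal.comp (Real.continuous_cosh.measurable.comp
      ((measurable_sum_coord fun _ => hF).const_smul l).norm)
  have hsub : {τ : Fin n → Ω | s * √n * t < ‖∑ i, F (τ i)‖} ⊆
      {τ | ENNReal.ofReal (Real.exp (t ^ 2) / 2) ≤
        ENNReal.ofReal (Real.cosh ‖l • ∑ i, F (τ i)‖)} := by
    intro τ hτ
    refine ENNReal.ofReal_le_ofReal ?_
    have h1 : t ^ 2 ≤ ‖l • ∑ i, F (τ i)‖ := by
      rw [norm_smul, Real.norm_of_nonneg hl0]
      have h2 := mul_le_mul_of_nonneg_left (le_of_lt hτ) hl0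
      refine le_trans (le_of_eq ?_) h2
      rw [hl, div_mul_eq_mul_div, eq_div_iff hpos.ne']
      ring
    have h3 := Real.exp_le_exp.2 h1
    rw [Real.cosh_eq]
    have := Real.exp_pos (-‖l • ∑ i, F (τ i)‖)
    linarith
  have hmark := mul_meas_ge_le_lintegral (μ := Measure.pi fun _ : Fin n => P) hm
    (ENNReal.ofReal (Real.exp (t ^ 2) / 2))
  have hep := Real.exp_pos (t ^ 2)
  have hchain : ENNReal.ofReal (Real.exp (t ^ 2) / 2) *
      (Measure.pi fun _ : Fin n => P) {τ | s * √n * t < ‖∑ i, F (τ i)‖} ≤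
      ENNReal.ofReal (Real.exp (t ^ 2) / 2) * ENNReal.ofReal (2 * Real.exp (-(t ^ 2 / 2))) := by
    refine (mul_le_mul_right (measure_mono hsub) _).trans (hmark.trans (hcosh.trans ?_))
    rw [← ENNReal.ofReal_mul (by positivity)]
    refine ENNReal.ofReal_le_ofReal (hbound.trans (le_of_eq ?_))
    rw [show Real.exp (t ^ 2) / 2 * (2 * Real.exp (-(t ^ 2 / 2))) =
      Real.exp (t ^ 2) * Real.exp (-(t ^ 2 / 2)) by ring, ← Real.exp_add]
    congr 1
    ring
  exact (ENNReal.mul_le_mul_iff_right (by simpa using by positivity) ENNReal.ofReal_ne_top).1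
    hchain

/-- Second moments of a sum of independent centered vectors. -/
theorem lintegral_norm_sum_sq_le (n : ℕ) : ∀ (F : Fin n → Ω → E) (C v : Fin n → ℝ) (x : E),
    (∀ i, Measurable (F i)) → (∀ i ω, ‖F i ω‖ ≤ C i) → (∀ i, ∫ ω, F i ω ∂P = 0) →
    (∀ i, ∫ ω, ‖F i ω‖ ^ 2 ∂P ≤ v i) →
    ∫⁻ τ, ENNReal.ofReal (‖x + ∑ i, F i (τ i)‖ ^ 2) ∂(Measure.pi fun _ : Fin n => P) ≤
      ENNReal.ofReal (‖x‖ ^ 2 + ∑ i, v i) := by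
  induction n with
  | zero => intro F C v x _ _ _ _; simp
  | succ n ih =>
    intro F C v x hF hC h0 hv
    have hm : Measurable fun τ : Fin (n + 1) → Ω =>
        ENNReal.ofReal (‖x + ∑ i, F i (τ i)‖ ^ 2) :=
      ENNReal.measurable_ofReal.comp (((measurable_sum_coord hF).const_add x).norm.pow_const 2)
    rw [lintegral_pi_succ n hm]
    have hv0 : ∀ i, 0 ≤ v i := fun i => (integral_nonneg fun _ => by positivity).trans (hv i)
    have hstep : ∀ ω, ∫⁻ τ, ENNReal.ofReal
        (‖x + ∑ i, F i ((Fin.cons ω τ : Fin (n + 1) → Ω) i)‖ ^ 2)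
          ∂(Measure.pi fun _ : Fin n => P) ≤
        ENNReal.ofReal (‖x + F 0 ω‖ ^ 2) + ENNReal.ofReal (∑ i : Fin n, v i.succ) := by
      intro ω
      rw [← ENNReal.ofReal_add (by positivity) (Finset.sum_nonneg fun i _ => hv0 _)]
      simp_rw [Fin.sum_univ_succ, Fin.cons_zero, Fin.cons_succ, ← add_assoc]
      exact ih (fun i => F i.succ) (fun i => C i.succ) (fun i => v i.succ) (x + F 0 ω)
        (fun i => hF _) (fun i => hC _) (fun i => h0 _) (fun i => hv _)
    refine (lintegral_mono hstep).trans ?_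
    have hsq : Integrable (fun ω => ‖x + F 0 ω‖ ^ 2) P :=
      Integrable.of_bound (((hF 0).const_add x).norm.pow_const 2).aestronglyMeasurable
        ((‖x‖ + C 0) ^ 2) (ae_of_all _ fun ω => by
          rw [norm_pow, norm_norm]
          exact pow_le_pow_left₀ (norm_nonneg _)
            ((norm_add_le _ _).trans (add_le_add le_rfl (hC 0 ω))) 2)
    rw [lintegral_add_right _ measurable_const, lintegral_const, measure_univ, mul_one,
      ← ofReal_integral_eq_lintegral_ofReal hsq (ae_of_all _ fun _ => by positivity),
      integral_norm_add_sq (hF 0).aestronglyMeasurable (hC 0), h0, inner_zero_right, mul_zero,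
      add_zero, ← ENNReal.ofReal_add (by positivity) (Finset.sum_nonneg fun i _ => hv0 _),
      Fin.sum_univ_succ]
    exact ENNReal.ofReal_le_ofReal (by linarith [hv 0])

omit [CompleteSpace E] in
theorem integral_pi_coord {ι : Type*} [Fintype ι] (i : ι) {F : Ω → E} (hF : Measurable F) :
    ∫ τ, F (τ i) ∂(Measure.pi fun _ : ι => P) = ∫ ω, F ω ∂P := by
  have h := measurePreserving_eval (fun _ : ι => P) i
  conv_rhs => rw [← h.map_eq]
  rw [integral_map h.measurable.aemeasurable hF.aestronglyMeasurable]

end Concentration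

end FedPG

/-! ### Deterministic error bounds for the aggregation rule. -/

namespace FedPG

section AggregateBounds

variable {d K : ℕ} {m : Fin K → Param d} {good : Finset (Fin K)} {r : ℝ}

theorem norm_avg_sub_eq {s : Finset (Fin K)} (hs : s.Nonempty) (m : Fin K → Param d)
    (x : Param d) : (s.card : ℝ)⁻¹ • ∑ k ∈ s, m k - x = (s.card : ℝ)⁻¹ • ∑ k ∈ s, (m k - x) := by
  have h : (s.card : ℝ) ≠ 0 := by exact_mod_cast hs.card_pos.ne'
  rw [Finset.sum_sub_distrib, smul_sub, Finset.sum_const, ← Nat.cast_smul_eq_nsmul ℝ, smul_smul,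
    inv_mul_cancel₀ h, one_smul]

theorem norm_avg_sub_le {s : Finset (Fin K)} (hs : s.Nonempty) {x : Param d} {C : ℝ}
    (h : ∀ k ∈ s, ‖m k - x‖ ≤ C) : ‖(s.card : ℝ)⁻¹ • ∑ k ∈ s, m k - x‖ ≤ C := by
  have h0 : (0 : ℝ) < s.card := by exact_mod_cast hs.card_pos
  rw [norm_avg_sub_eq hs, norm_smul, Real.norm_of_nonneg (by positivity)]
  have := norm_sum_le_of_le s h
  rw [Finset.sum_const, nsmul_eq_mul] at this
  rw [inv_mul_le_iff₀ h0]
  exact this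

theorem subset_medians (hcard : (K : ℝ) / 2 < good.card)
    (h : ∀ k ∈ good, ∀ j ∈ good, ‖m j - m k‖ ≤ r) : good ⊆ medians r m := by
  classical
  intro k hk
  rw [medians, Finset.mem_filter]
  refine ⟨Finset.mem_univ k, hcard.trans_le ?_⟩
  exact_mod_cast Finset.card_le_card fun j hj =>
    Finset.mem_filter.2 ⟨Finset.mem_univ j, h k hk j hj⟩

/-- Two sets of more than `K/2` agents intersect. Even a Byzantine median is therefore within `r` of
some good message. -/
theorem exists_good_near_median (hcard : (K : ℝ) / 2 < good.card) {k : Fin K}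
    (hk : k ∈ medians r m) : ∃ j ∈ good, ‖m j - m k‖ ≤ r := by
  classical
  rw [medians, Finset.mem_filter] at hk
  obtain ⟨j, hj⟩ := Finset.inter_nonempty_of_card_lt_card_add_card
    (Finset.subset_univ good) (Finset.subset_univ ({k' : Fin K | ‖m k' - m k‖ ≤ r} : Finset _))
    (by
      rw [Finset.card_univ, Fintype.card_fin]
      have h2 := hk.2
      have : (K : ℝ) < good.card + (Finset.card {k' : Fin K | ‖m k' - m k‖ ≤ r} : ℝ) := by
        linarith
      exact_mod_cast this)
  rw [Finset.mem_inter, Finset.mem_filter] at hj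
  exact ⟨j, hj.1, hj.2.2⟩

variable {pick : Finset (Fin K) → Fin K}

theorem momCandidates_nonempty (h : (medians r m).Nonempty) : (momCandidates r m).Nonempty := by
  obtain ⟨k, hk, hmin⟩ := Finset.exists_min_image (medians r m) (fun j => ‖m j - medianMean r m‖) h
  exact ⟨k, by rw [momCandidates, Finset.mem_filter]; exact ⟨hk, hmin⟩⟩

theorem mem_accepted {k : Fin K} : k ∈ accepted pick r m ↔ (momCandidates r m).Nonempty ∧
    ‖m k - m (pick (momCandidates r m))‖ ≤ r := by
  classical
  rw [accepted]
  split_ifs with h <;> simp [h]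

theorem mem_momCandidates {k : Fin K} : k ∈ momCandidates r m ↔ k ∈ medians r m ∧
    ∀ j ∈ medians r m, ‖m k - medianMean r m‖ ≤ ‖m j - medianMean r m‖ := by
  rw [momCandidates, Finset.mem_filter]

variable (hpick : ∀ s : Finset (Fin K), s.Nonempty → pick s ∈ s)
include hpick

theorem norm_accepted_sub_le (hcard : (K : ℝ) / 2 < good.card) {x : Param d} {s : ℝ}
    (hgood : ∀ k ∈ good, ‖m k - x‖ ≤ s) {k : Fin K} (hk : k ∈ accepted pick r m) :
    ‖m k - x‖ ≤ 2 * r + s := by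
  obtain ⟨hne, hkr⟩ := mem_accepted.1 hk
  obtain ⟨j, hj, hjr⟩ := exists_good_near_median hcard
    (mem_momCandidates.1 (hpick _ hne)).1
  have e : m k - x = (m k - m (pick (momCandidates r m))) -
      (m j - m (pick (momCandidates r m))) + (m j - x) := by abel
  rw [e]
  linarith [norm_add_le ((m k - m (pick (momCandidates r m))) -
    (m j - m (pick (momCandidates r m)))) (m j - x), norm_sub_le
    (m k - m (pick (momCandidates r m))) (m j - m (pick (momCandidates r m))), hgood j hj]

/-- The aggregate is never farther than `5 σ` from the center. -/
theorem norm_aggregate_sub_le (hK : 1 ≤ K) {α s thr : ℝ} (hα : α < 1 / 2)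
    (hcard : (K : ℝ) - good.card ≤ α * K) {x : Param d} (hs : 0 ≤ s) (hthr : thr ≤ 2 * s)
    (hgood : ∀ k ∈ good, ‖m k - x‖ ≤ s) :
    ‖aggregate pick α s thr m - x‖ ≤ 5 * s := by
  classical
  have hK' : (1 : ℝ) ≤ K := by exact_mod_cast hK
  have hhalf : (K : ℝ) / 2 < good.card := by nlinarith
  rw [aggregate]
  have hne : (believedGood pick α s thr m).Nonempty := by
    rw [believedGood]
    -- Rule R2 accepts at least the agent it picks, because good messages are pairwise within `2 *
    -- s` and so medians exist. Rule R1 is kept only if it accepts at least `(1 - α) * K > 0`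
    -- agents.
    split_ifs with h
    · have hg : good.Nonempty := by
        rw [← Finset.card_pos]
        have : (0 : ℝ) < good.card := by linarith
        exact_mod_cast this
      have hsub : good ⊆ medians (2 * s) m := subset_medians hhalf fun k hk j hj => by
        have e : m j - m k = (m j - x) - (m k - x) := by abel
        rw [e]
        linarith [norm_sub_le (m j - x) (m k - x), hgood j hj, hgood k hk]
      have hc := momCandidates_nonempty (hg.mono hsub)
      exact ⟨pick (momCandidates (2 * s) m), mem_accepted.2 ⟨hc, by
        rw [sub_self, norm_zero]; linarith⟩⟩
    · rw [← Finset.card_pos]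
      have : (0 : ℝ) < (accepted pick thr m).card := by nlinarith
      exact_mod_cast this
  refine norm_avg_sub_le hne fun k hk => ?_
  rw [believedGood] at hk
  split_ifs at hk with h
  · linarith [norm_accepted_sub_le hpick hhalf hgood hk]
  · linarith [norm_accepted_sub_le hpick hhalf hgood hk]

/-- If the good messages are concentrated well below the threshold, all of them are accepted. -/
theorem norm_aggregate_sub_le_of_concentrated (hK : 1 ≤ K) {α β s ρ a : ℝ} (hα : α < 1 / 2)
    (hβ0 : 0 ≤ β) (hβ : β ≤ α) (hcard : (K : ℝ) - good.card ≤ β * K) {x : Param d}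
    (hρ : 0 ≤ ρ) (ha0 : 0 ≤ a) (ha : a ≤ (1 - 2 * β) / 2)
    (hgood : ∀ k ∈ good, ‖m k - x‖ ≤ a * ρ) :
    ‖aggregate pick α s (2 * ρ) m - x‖ ≤ 2 / K * ‖∑ k ∈ good, (m k - x)‖ + 8 * β * ρ := by
  classical
  have hK' : (1 : ℝ) ≤ K := by exact_mod_cast hK
  have hcardβ : (1 - β) * K ≤ good.card := by linarith
  have hcardα : (1 - α) * K ≤ good.card := by nlinarith
  have hhalf : (K : ℝ) / 2 < good.card := by nlinarith
  have hg : good.Nonempty := by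
    rw [← Finset.card_pos]
    have : (0 : ℝ) < good.card := by linarith
    exact_mod_cast this
  have haρ : a * ρ ≤ (1 - 2 * β) / 2 * ρ := mul_le_mul_of_nonneg_right ha hρ
  have hβρ : 0 ≤ β * ρ := mul_nonneg hβ0 hρ
  have haρ0 : 0 ≤ a * ρ := mul_nonneg ha0 hρ
  have hsub : good ⊆ medians (2 * ρ) m := subset_medians hhalf fun k hk j hj => by
    have e : m j - m k = (m j - x) - (m k - x) := by abel
    rw [e]
    linarith [norm_sub_le (m j - x) (m k - x), hgood j hj, hgood k hk]
  set S := medians (2 * ρ) m with hS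
  have hSne : S.Nonempty := hg.mono hsub
  have hSfar : ∀ k ∈ S, ‖m k - x‖ ≤ 2 * ρ + a * ρ := by
    intro k hk
    obtain ⟨j, hj, hjr⟩ := exists_good_near_median hhalf hk
    have e : m k - x = (m j - x) - (m j - m k) := by abel
    rw [e]
    linarith [norm_sub_le (m j - x) (m j - m k), hgood j hj]
  set M := medianMean (2 * ρ) m with hM
  have hSpos : (0 : ℝ) < S.card := by exact_mod_cast hSne.card_pos
  -- The good agents form at least a fraction `1 - β` of `S`. Each of them contributes at most `a *
  -- ρ`, each other median at most `2 * ρ` more.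
  have hMx : ‖M - x‖ ≤ a * ρ + 2 * β * ρ := by
    have e : M = (S.card : ℝ)⁻¹ • ∑ k ∈ S, m k := rfl
    rw [e, norm_avg_sub_eq hSne, norm_smul, Real.norm_of_nonneg (by positivity),
      inv_mul_le_iff₀ hSpos, ← Finset.sum_sdiff hsub]
    have h1 := norm_sum_le_of_le good hgood
    have h2 := norm_sum_le_of_le (S \ good) fun k hk => hSfar k (Finset.mem_sdiff.1 hk).1
    rw [Finset.sum_const, nsmul_eq_mul] at h1 h2
    have h3 : ((S \ good).card : ℝ) = S.card - good.card := by
      rw [Finset.card_sdiff_of_subset hsub, Nat.cast_sub (Finset.card_le_card hsub)]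
    rw [h3] at h2
    have h4 : (S.card : ℝ) ≤ K := by
      exact_mod_cast (Finset.card_le_univ S).trans (by simp)
    have h5 : (S.card : ℝ) - good.card ≤ β * S.card := by nlinarith
    have h6 := mul_le_mul_of_nonneg_right h5 (by linarith : 0 ≤ 2 * ρ)
    have h7 := norm_add_le (∑ k ∈ S \ good, (m k - x)) (∑ k ∈ good, (m k - x))
    nlinarith
  have hc := momCandidates_nonempty hSne
  set p := pick (momCandidates (2 * ρ) m) with hp
  -- The picked median is no farther from the mean `M` than a good one; two triangle inequalities
  -- through `M` follow.
  have hpx : ‖m p - x‖ ≤ 3 * (a * ρ) + 4 * β * ρ := by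
    obtain ⟨j, hj⟩ := hg
    have h1 := (mem_momCandidates.1 (hpick _ hc)).2 j (hsub hj)
    have e1 : m j - M = (m j - x) - (M - x) := by abel
    have h2 : ‖m j - M‖ ≤ a * ρ + (a * ρ + 2 * β * ρ) := by
      rw [e1]; exact (norm_sub_le _ _).trans (add_le_add (hgood j hj) hMx)
    have e2 : m p - x = (m p - M) + (M - x) := by abel
    rw [e2]
    linarith [norm_add_le (m p - M) (M - x)]
  -- A good agent is within `(4 a + 4 β) ρ` of the picked one, and `a ≤ (1 - 2 β) / 2` is exactly
  -- the condition that this is at most the threshold `2 * ρ`.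
  have hacc : good ⊆ accepted pick (2 * ρ) m := by
    intro k hk
    refine mem_accepted.2 ⟨hc, ?_⟩
    have e : m k - m p = (m k - x) - (m p - x) := by abel
    rw [← hp, e]
    linarith [norm_sub_le (m k - x) (m p - x), hgood k hk]
  have hbel : believedGood pick α s (2 * ρ) m = accepted pick (2 * ρ) m := by
    rw [believedGood, if_neg]
    rw [not_lt]
    exact hcardα.trans (by exact_mod_cast Finset.card_le_card hacc)
  set Acc := accepted pick (2 * ρ) m with hAcc
  have hfar : ∀ k ∈ Acc, ‖m k - x‖ ≤ 4 * ρ := by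
    intro k hk
    have h1 := (mem_accepted.1 hk).2
    have e : m k - x = (m k - m p) + (m p - x) := by abel
    rw [e]
    linarith [norm_add_le (m k - m p) (m p - x)]
  have hAne : Acc.Nonempty := hg.mono hacc
  have hApos : (0 : ℝ) < Acc.card := by exact_mod_cast hAne.card_pos
  rw [aggregate, hbel, norm_avg_sub_eq hAne, norm_smul, Real.norm_of_nonneg (by positivity),
    ← Finset.sum_sdiff hacc]
  have h2 := norm_sum_le_of_le (Acc \ good) fun k hk => hfar k (Finset.mem_sdiff.1 hk).1
  rw [Finset.sum_const, nsmul_eq_mul] at h2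
  have h3 : ((Acc \ good).card : ℝ) = Acc.card - good.card := by
    rw [Finset.card_sdiff_of_subset hacc, Nat.cast_sub (Finset.card_le_card hacc)]
  rw [h3] at h2
  have h4 : (Acc.card : ℝ) ≤ K := by exact_mod_cast (Finset.card_le_univ Acc).trans (by simp)
  have h5 : (good.card : ℝ) ≤ Acc.card := by exact_mod_cast Finset.card_le_card hacc
  have h6 : ‖∑ k ∈ Acc \ good, (m k - x)‖ ≤ β * K * (4 * ρ) :=
    h2.trans (mul_le_mul_of_nonneg_right (by linarith) (by linarith))
  have h7 := norm_add_le (∑ k ∈ Acc \ good, (m k - x)) (∑ k ∈ good, (m k - x))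
  -- At least `K/2` agents are accepted, as all good ones are.
  have h8 : (Acc.card : ℝ)⁻¹ ≤ 2 / K := by
    rw [inv_le_comm₀ hApos (by positivity), inv_div]
    linarith
  have h9 : 2 / (K : ℝ) * (‖∑ k ∈ good, (m k - x)‖ + β * K * (4 * ρ)) =
      2 / K * ‖∑ k ∈ good, (m k - x)‖ + 8 * β * ρ := by
    field_simp; ring
  rw [← h9]
  exact mul_le_mul h8 (h7.trans (by linarith)) (norm_nonneg _) (by positivity)

end AggregateBounds

/-! ### Measurability of the aggregation rule. -/

section AggregateMeasurable

variable {M β : Type*} [MeasurableSpace M] [MeasurableSpace β] {K d : ℕ}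

/-- A random finite set of agents is measurable if its membership events are. -/
def FinsetMeasurable (f : M → Finset (Fin K)) : Prop := ∀ k, MeasurableSet {m | k ∈ f m}

theorem FinsetMeasurable.eq {f : M → Finset (Fin K)} (hf : FinsetMeasurable f)
    (s : Finset (Fin K)) : MeasurableSet {m | f m = s} := by
  have : {m | f m = s} = ⋂ k, {m | k ∈ f m ↔ k ∈ s} := by
    ext m
    simp [Finset.ext_iff]
  rw [this]
  refine MeasurableSet.iInter fun k => ?_
  by_cases hk : k ∈ s
  · simpa [hk] using hf k
  · have h := (hf k).compl
    simp only [hk, iff_false]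
    exact h

/-- The random set takes finitely many values, so the event splits into pieces on which it is
constant. -/
theorem FinsetMeasurable.setOf {f : M → Finset (Fin K)} (hf : FinsetMeasurable f)
    {P : Finset (Fin K) → M → Prop} (hP : ∀ s, MeasurableSet {m | P s m}) :
    MeasurableSet {m | P (f m) m} := by
  have : {m | P (f m) m} = ⋃ s, {m | f m = s} ∩ {m | P s m} := by
    ext m
    simp
  rw [this]
  exact MeasurableSet.iUnion fun s => (hf.eq s).inter (hP s)

theorem FinsetMeasurable.measurable {f : M → Finset (Fin K)} (hf : FinsetMeasurable f)
    {F : Finset (Fin K) → M → β} (hF : ∀ s, Measurable (F s)) :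
    Measurable fun m => F (f m) m := fun t ht =>
  hf.setOf (P := fun s m => F s m ∈ t) fun s => hF s ht

theorem measurable_avg (s : Finset (Fin K)) :
    Measurable fun m : Fin K → Param d => (s.card : ℝ)⁻¹ • ∑ k ∈ s, m k :=
  (Finset.measurable_sum _ fun k _ => measurable_pi_apply k).const_smul (s.card : ℝ)⁻¹

theorem finsetMeasurable_medians (r : ℝ) :
    FinsetMeasurable (medians r : (Fin K → Param d) → Finset (Fin K)) := by
  classical
  intro k
  have hf : FinsetMeasurable fun m : Fin K → Param d =>
      ({k' | ‖m k' - m k‖ ≤ r} : Finset (Fin K)) := by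
    intro j
    simp only [Finset.mem_filter, Finset.mem_univ, true_and]
    exact measurableSet_le (by fun_prop) measurable_const
  have h := hf.setOf (P := fun s _ => (K : ℝ) / 2 < s.card) fun s => MeasurableSet.const _
  convert! h using 3 with m
  simp only [medians, Finset.mem_filter, Finset.mem_univ, true_and]

theorem measurable_medianMean (r : ℝ) :
    Measurable (medianMean r : (Fin K → Param d) → Param d) :=
  (finsetMeasurable_medians r).measurable measurable_avg

theorem finsetMeasurable_momCandidates (r : ℝ) :
    FinsetMeasurable (momCandidates r : (Fin K → Param d) → Finset (Fin K)) := by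
  intro k
  simp only [mem_momCandidates]
  have hM := measurable_medianMean (K := K) (d := d) r
  refine (finsetMeasurable_medians r).setOf (P := fun s m => k ∈ s ∧
    ∀ j ∈ s, ‖m k - medianMean r m‖ ≤ ‖m j - medianMean r m‖) fun s => ?_
  have e : {m : Fin K → Param d | ∀ j ∈ s, ‖m k - medianMean r m‖ ≤ ‖m j - medianMean r m‖} =
      ⋂ j, ⋂ _ : j ∈ s, {m | ‖m k - medianMean r m‖ ≤ ‖m j - medianMean r m‖} := by
    ext m
    simp
  have h : MeasurableSet {m : Fin K → Param d |
      ∀ j ∈ s, ‖m k - medianMean r m‖ ≤ ‖m j - medianMean r m‖} := by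
    rw [e]
    exact MeasurableSet.iInter fun j => MeasurableSet.iInter fun _ =>
      measurableSet_le ((measurable_pi_apply k).sub hM).norm
        ((measurable_pi_apply j).sub hM).norm
  exact (MeasurableSet.const _).inter h

theorem finsetMeasurable_accepted (pick : Finset (Fin K) → Fin K) (r : ℝ) :
    FinsetMeasurable (accepted pick r : (Fin K → Param d) → Finset (Fin K)) := by
  intro k
  simp only [mem_accepted]
  have h : ∀ s, MeasurableSet {m : Fin K → Param d | ‖m k - m (pick s)‖ ≤ r} := fun s =>
    measurableSet_le (by fun_prop) measurable_const
  exact (finsetMeasurable_momCandidates r).setOf (P := fun s m => s.Nonempty ∧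
    ‖m k - m (pick s)‖ ≤ r) fun s => (MeasurableSet.const _).inter (h s)

theorem finsetMeasurable_believedGood (pick : Finset (Fin K) → Fin K) (α s thr : ℝ) :
    FinsetMeasurable (believedGood pick α s thr : (Fin K → Param d) → Finset (Fin K)) := by
  classical
  intro k
  have h := (finsetMeasurable_accepted (d := d) pick thr).setOf (P := fun S m =>
    k ∈ if (S.card : ℝ) < (1 - α) * K then accepted pick (2 * s) m else S) fun S => by
      by_cases hS : (S.card : ℝ) < (1 - α) * K
      · simpa only [hS, if_true] using finsetMeasurable_accepted pick (2 * s) k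
      · simp only [hS, if_false, MeasurableSet.const]
  convert! h using 3 with m

theorem measurable_aggregate (pick : Finset (Fin K) → Fin K) (α s thr : ℝ) :
    Measurable (aggregate pick α s thr : (Fin K → Param d) → Param d) :=
  (finsetMeasurable_believedGood pick α s thr).measurable measurable_avg

end AggregateMeasurable

end FedPG

/-! ### Mean squared error of the aggregate. -/

namespace FedPG

section BatchError

variable {S A : Type*} [MeasurableSpace S] [MeasurableSpace A] {d K B : ℕ} {c : Constants}
  {X : Setting S A d c.H} (hX : Assumptions c X)

/-- The deviation of the batch gradient of one agent from the gradient. -/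
def batchDev (X : Setting S A d c.H) (θ : Param d) (τ : Fin B → Traj S A c.H) : Param d :=
  (B : ℝ)⁻¹ • ∑ i, (X.g c.γ (τ i) θ - gradient (X.J c.γ) θ)

theorem batchDev_eq (hB : 1 ≤ B) (X : Setting S A d c.H) (θ : Param d)
    (τ : Fin B → Traj S A c.H) : batchDev X θ τ =
      (B : ℝ)⁻¹ • ∑ i, X.g c.γ (τ i) θ - gradient (X.J c.γ) θ := by
  have hB' : (B : ℝ) ≠ 0 := by positivity
  rw [batchDev, Finset.sum_sub_distrib, smul_sub, Finset.sum_const, Finset.card_univ,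
    Fintype.card_fin, ← Nat.cast_smul_eq_nsmul ℝ, smul_smul, inv_mul_cancel₀ hB', one_smul]

include hX

theorem measurable_gDev (θ : Param d) :
    Measurable fun τ => X.g c.γ τ θ - gradient (X.J c.γ) θ :=
  (measurable_g_left hX θ).sub_const _

theorem norm_gDev_le (θ : Param d) (τ : Traj S A c.H) :
    ‖X.g c.γ τ θ - gradient (X.J c.γ) θ‖ ≤ c.gBound + c.gBound :=
  (norm_sub_le _ _).trans (add_le_add (norm_g_le hX τ θ) (norm_gradient_J_le hX θ))

theorem integral_gDev (θ : Param d) :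
    ∫ τ, (X.g c.γ τ θ - gradient (X.J c.γ) θ) ∂(X.trajLaw θ) = 0 := by
  have := trajLaw_prob hX θ
  have hi : Integrable (fun τ => X.g c.γ τ θ) (X.trajLaw θ) :=
    Integrable.of_bound (measurable_g_left hX θ).aestronglyMeasurable _
      (ae_of_all _ fun τ => norm_g_le hX τ θ)
  rw [integral_sub hi (integrable_const _), integral_g hX, integral_const, probReal_univ,
    one_smul, sub_self]

theorem integral_norm_gDev_sq_le (θ : Param d) :
    ∫ τ, ‖X.g c.γ τ θ - gradient (X.J c.γ) θ‖ ^ 2 ∂(X.trajLaw θ) ≤ c.σ ^ 2 := by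
  have := trajLaw_prob hX θ
  have hi : Integrable (fun τ => ‖X.g c.γ τ θ - gradient (X.J c.γ) θ‖ ^ 2) (X.trajLaw θ) :=
    Integrable.of_bound ((measurable_gDev hX θ).norm.pow_const 2).aestronglyMeasurable
      ((c.gBound + c.gBound) ^ 2) (ae_of_all _ fun τ => by
        rw [norm_pow, norm_norm]; exact pow_le_pow_left₀ (norm_nonneg _) (norm_gDev_le hX θ τ) 2)
  have h := integral_mono_ae hi (integrable_const (c.σ ^ 2)) ((hX.estimator_bound θ).mono
    fun τ h => pow_le_pow_left₀ (norm_nonneg _) h 2)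
  rwa [integral_const, probReal_univ, one_smul] at h

theorem measurable_batchDev (θ : Param d) :
    Measurable (batchDev X θ : (Fin B → Traj S A c.H) → Param d) := by
  have h : Measurable fun τ : Fin B → Traj S A c.H =>
      ∑ i, (X.g c.γ (τ i) θ - gradient (X.J c.γ) θ) :=
    Finset.measurable_sum Finset.univ fun i _ => (measurable_gDev hX θ).comp (measurable_pi_apply i)
  exact h.const_smul ((B : ℝ)⁻¹)

omit hX in
theorem norm_batchDev_le_of_forall {s : ℝ} (hB : 1 ≤ B) {θ : Param d} {τ : Fin B → Traj S A c.H}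
    (h : ∀ i, ‖X.g c.γ (τ i) θ - gradient (X.J c.γ) θ‖ ≤ s) : ‖batchDev X θ τ‖ ≤ s := by
  have hB' : (0 : ℝ) < B := by positivity
  rw [batchDev, norm_smul, Real.norm_of_nonneg (by positivity), inv_mul_le_iff₀ hB']
  refine (norm_sum_le_of_le _ fun i _ => h i).trans ?_
  simp

theorem integral_batchDev (θ : Param d) :
    ∫ τ, batchDev X θ τ ∂(Measure.pi fun _ : Fin B => X.trajLaw θ) = 0 := by
  have := trajLaw_prob hX θ
  simp only [batchDev]
  rw [integral_smul, integral_finsetSum]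
  · rw [Finset.sum_eq_zero, smul_zero]
    intro i _
    rw [integral_pi_coord i (measurable_gDev hX θ), integral_gDev hX]
  · intro i _
    exact Integrable.of_bound ((measurable_gDev hX θ).comp
      (measurable_pi_apply i)).aestronglyMeasurable _ (ae_of_all _ fun τ => norm_gDev_le hX θ (τ i))

theorem integral_norm_batchDev_sq_le (hB : 1 ≤ B) (θ : Param d) :
    ∫ τ, ‖batchDev X θ τ‖ ^ 2 ∂(Measure.pi fun _ : Fin B => X.trajLaw θ) ≤ c.σ ^ 2 / B := by
  have := trajLaw_prob hX θ
  have hB' : (0 : ℝ) < B := by positivity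
  have h := lintegral_norm_sum_sq_le (P := X.trajLaw θ) B
    (fun _ τ => X.g c.γ τ θ - gradient (X.J c.γ) θ) (fun _ => c.gBound + c.gBound)
    (fun _ => c.σ ^ 2) 0 (fun _ => measurable_gDev hX θ) (fun _ => norm_gDev_le hX θ)
    (fun _ => integral_gDev hX θ) (fun _ => integral_norm_gDev_sq_le hX θ)
  simp only [zero_add, norm_zero, ne_eq, OfNat.ofNat_ne_zero, not_false_eq_true, zero_pow,
    Finset.sum_const, Finset.card_univ, Fintype.card_fin, nsmul_eq_mul] at h
  have hm := (measurable_batchDev (B := B) hX θ).norm.pow_const 2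
  rw [integral_eq_lintegral_of_nonneg_ae (ae_of_all _ fun _ => by positivity)
    hm.aestronglyMeasurable]
  refine ENNReal.toReal_le_of_le_ofReal (by positivity) ?_
  have e : ∀ τ : Fin B → Traj S A c.H, ENNReal.ofReal (‖batchDev X θ τ‖ ^ 2) =
      ENNReal.ofReal (((B : ℝ)⁻¹) ^ 2) *
        ENNReal.ofReal (‖∑ i, (X.g c.γ (τ i) θ - gradient (X.J c.γ) θ)‖ ^ 2) := by
    intro τ
    rw [batchDev, norm_smul, Real.norm_of_nonneg (by positivity), mul_pow,
      ENNReal.ofReal_mul (by positivity)]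
  simp_rw [e]
  rw [lintegral_const_mul' _ _ ENNReal.ofReal_ne_top]
  refine (mul_le_mul_right h _).trans (le_of_eq ?_)
  rw [← ENNReal.ofReal_mul (by positivity)]
  congr 1
  field_simp

theorem measure_batchDev_gt_le (hB : 1 ≤ B) (θ : Param d) {t : ℝ} (ht : 0 ≤ t) :
    (Measure.pi fun _ : Fin B => X.trajLaw θ) {τ | c.σ * t / √B < ‖batchDev X θ τ‖} ≤
      ENNReal.ofReal (2 * Real.exp (-(t ^ 2 / 2))) := by
  have := trajLaw_prob hX θ
  have hB' : (0 : ℝ) < B := by positivity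
  have hs : 0 < √(B : ℝ) := Real.sqrt_pos.2 hB'
  refine le_trans (measure_mono fun τ hτ => ?_) (measure_norm_sum_gt_le (P := X.trajLaw θ)
    (measurable_gDev hX θ) (norm_gDev_le hX θ) c.σ_nonneg (hX.estimator_bound θ)
    (integral_gDev hX θ) B ht)
  have h : c.σ * t / √B < ‖batchDev X θ τ‖ := hτ
  rw [batchDev, norm_smul, Real.norm_of_nonneg (by positivity), inv_mul_eq_div, lt_div_iff₀ hB',
    div_mul_eq_mul_div, div_lt_iff₀ hs] at h
  have e : (B : ℝ) = √B * √B := (Real.mul_self_sqrt hB'.le).symm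
  refine lt_of_mul_lt_mul_right (a := √(B : ℝ)) ?_ hs.le
  refine lt_of_eq_of_lt ?_ h
  nth_rewrite 3 [e]
  ring

omit hX in
/-- The trajectories for which some good agent deviates by more than `s`. -/
def badSet (X : Setting S A d c.H) (good : Finset (Fin K)) (θ : Param d) (s : ℝ) :
    Set (Fin K → Fin B → Traj S A c.H) := ⋃ k ∈ good, {τ | s < ‖batchDev X θ (τ k)‖}

theorem measurableSet_badSet (good : Finset (Fin K)) (θ : Param d) (s : ℝ) :
    MeasurableSet (badSet (B := B) X good θ s) :=
  Finset.measurableSet_biUnion _ fun k _ => measurableSet_lt measurable_const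
    ((measurable_batchDev hX θ).comp (measurable_pi_apply k)).norm

theorem measure_badSet_le (hB : 1 ≤ B) (good : Finset (Fin K)) (θ : Param d) {t : ℝ}
    (ht : 0 ≤ t) :
    (Measure.pi fun _ : Fin K => Measure.pi fun _ : Fin B => X.trajLaw θ)
      (badSet X good θ (c.σ * t / √B)) ≤ ENNReal.ofReal (K * (2 * Real.exp (-(t ^ 2 / 2)))) := by
  have := trajLaw_prob hX θ
  refine (measure_biUnion_finset_le _ _).trans ?_
  refine (Finset.sum_le_card_nsmul _ _ (ENNReal.ofReal (2 * Real.exp (-(t ^ 2 / 2))))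
    fun k _ => ?_).trans ?_
  · have hmp := measurePreserving_eval
      (fun _ : Fin K => Measure.pi fun _ : Fin B => X.trajLaw θ) k
    have hms : MeasurableSet {τ : Fin B → Traj S A c.H | c.σ * t / √B < ‖batchDev X θ τ‖} :=
      measurableSet_lt measurable_const (measurable_batchDev hX θ).norm
    have h := hmp.measure_preimage hms.nullMeasurableSet
    exact h.le.trans (measure_batchDev_gt_le hX hB θ ht)
  · rw [nsmul_eq_mul, ENNReal.ofReal_mul (Nat.cast_nonneg K), ENNReal.ofReal_natCast]
    refine mul_le_mul_left ?_ _
    exact_mod_cast (Finset.card_le_univ good).trans (by simp)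

theorem lintegral_norm_sum_batchDev_sq_le (hB : 1 ≤ B) (good : Finset (Fin K)) (θ : Param d) :
    ∫⁻ τ, ENNReal.ofReal (‖∑ k ∈ good, batchDev X θ (τ k)‖ ^ 2)
      ∂(Measure.pi fun _ : Fin K => Measure.pi fun _ : Fin B => X.trajLaw θ) ≤
      ENNReal.ofReal (K * (c.σ ^ 2 / B)) := by
  classical
  have := trajLaw_prob hX θ
  have hbd : ∀ τ : Fin B → Traj S A c.H, ‖batchDev X θ τ‖ ≤ c.gBound + c.gBound := fun τ =>
    norm_batchDev_le_of_forall hB fun i => norm_gDev_le hX θ (τ i)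
  have h := lintegral_norm_sum_sq_le (P := Measure.pi fun _ : Fin B => X.trajLaw θ) K
    (fun k τ => if k ∈ good then batchDev X θ τ else 0) (fun _ => c.gBound + c.gBound)
    (fun _ => c.σ ^ 2 / B) 0
    (fun k => by
      split_ifs
      · exact measurable_batchDev hX θ
      · exact measurable_const)
    (fun k τ => by
      split_ifs
      · exact hbd τ
      · rw [norm_zero]; linarith [c.gBound_nonneg])
    (fun k => by
      split_ifs
      · exact integral_batchDev hX θ
      · simp)
    (fun k => by
      split_ifs
      · exact integral_norm_batchDev_sq_le hX hB θ
      · simp only [norm_zero, ne_eq, OfNat.ofNat_ne_zero, not_false_eq_true, zero_pow,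
          integral_zero]
        positivity)
  simp only [zero_add, norm_zero, ne_eq, OfNat.ofNat_ne_zero, not_false_eq_true, zero_pow,
    Finset.sum_const, Finset.card_univ, Fintype.card_fin, nsmul_eq_mul, Finset.sum_ite_mem,
    Finset.univ_inter] at h
  exact h

omit hX in
/-- A bound for the squared error of the aggregate, whatever the Byzantine messages are. -/
def batchErr (X : Setting S A d c.H) (good : Finset (Fin K)) (θ : Param d) (β ρ a : ℝ)
    (τ : Fin K → Fin B → Traj S A c.H) : ℝ≥0∞ :=
  ENNReal.ofReal (8 / (K : ℝ) ^ 2) * ENNReal.ofReal (‖∑ k ∈ good, batchDev X θ (τ k)‖ ^ 2) +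
    ENNReal.ofReal (128 * β ^ 2 * ρ ^ 2) +
    (badSet X good θ (a * ρ)).indicator (fun _ => ENNReal.ofReal (25 * c.σ ^ 2)) τ

/-- One null set serves all messages `m` simultaneously, so the Byzantine messages may depend on the
trajectories in any way. Off the bad event `(x + y)² ≤ 2x² + 2y²` turns the two terms of the
concentrated bound into the constants `8` and `128`; on it the crude bound `5σ` gives `25`. -/
theorem aggregate_err_le (hB : 1 ≤ B) (hK : 1 ≤ K) {good : Finset (Fin K)}
    {pick : Finset (Fin K) → Fin K} (hpick : ∀ s : Finset (Fin K), s.Nonempty → pick s ∈ s)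
    {α β ρ a : ℝ} (hα : α < 1 / 2) (hβ0 : 0 ≤ β) (hβ : β ≤ α)
    (hcard : (K : ℝ) - good.card ≤ β * K) (hρ : 0 ≤ ρ) (hρσ : ρ ≤ c.σ) (ha0 : 0 ≤ a)
    (ha : a ≤ (1 - 2 * β) / 2) (θ : Param d) :
    ∀ᵐ τ ∂(Measure.pi fun _ : Fin K => Measure.pi fun _ : Fin B => X.trajLaw θ),
      ∀ m : Fin K → Param d, ENNReal.ofReal (‖aggregate pick α c.σ (2 * ρ)
        (messages X c.γ good θ τ m) - gradient (X.J c.γ) θ‖ ^ 2) ≤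
          batchErr X good θ β ρ a τ := by
  have := trajLaw_prob hX θ
  have hK' : (1 : ℝ) ≤ K := by exact_mod_cast hK
  filter_upwards [ae_pi_of_ae (ι := Fin K) (ae_pi_of_ae (ι := Fin B) (hX.estimator_bound θ))]
    with τ hτ m
  have hmsg : ∀ k ∈ good, messages X c.γ good θ τ m k - gradient (X.J c.γ) θ =
      batchDev X θ (τ k) := fun k hk => by
    rw [messages, if_pos hk, batchDev_eq hB]
  rw [batchErr]
  by_cases hbad : τ ∈ badSet X good θ (a * ρ)
  · rw [Set.indicator_of_mem hbad]
    refine le_trans (ENNReal.ofReal_le_ofReal ?_) le_add_self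
    have h := norm_aggregate_sub_le hpick (m := messages X c.γ good θ τ m) (thr := 2 * ρ)
      hK hα (hcard.trans (mul_le_mul_of_nonneg_right hβ (by linarith)))
      (x := gradient (X.J c.γ) θ) c.σ_nonneg (by linarith) fun k hk => by
        rw [hmsg k hk]; exact norm_batchDev_le_of_forall hB (hτ k)
    have := pow_le_pow_left₀ (norm_nonneg _) h 2
    linarith
  · rw [Set.indicator_of_notMem hbad, add_zero]
    rw [← ENNReal.ofReal_mul (by positivity), ← ENNReal.ofReal_add (by positivity) (by positivity)]
    refine ENNReal.ofReal_le_ofReal ?_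
    have hconc : ∀ k ∈ good, ‖batchDev X θ (τ k)‖ ≤ a * ρ := fun k hk => by
      by_contra h
      exact hbad (Set.mem_biUnion hk (not_le.1 h))
    have h := norm_aggregate_sub_le_of_concentrated hpick (m := messages X c.γ good θ τ m)
      (s := c.σ) hK hα hβ0 hβ hcard (x := gradient (X.J c.γ) θ) hρ ha0 ha
      fun k hk => by rw [hmsg k hk]; exact hconc k hk
    rw [Finset.sum_congr rfl hmsg] at h
    set n := ‖∑ k ∈ good, batchDev X θ (τ k)‖
    refine (pow_le_pow_left₀ (norm_nonneg _) h 2).trans ?_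
    have e : 8 / (K : ℝ) ^ 2 * n ^ 2 = 2 * (2 / K * n) ^ 2 := by field_simp; ring
    rw [e]
    nlinarith [sq_nonneg (2 / K * n - 8 * β * ρ)]

theorem lintegral_batchErr_le (hB : 1 ≤ B) (hK : 1 ≤ K) (good : Finset (Fin K)) (θ : Param d)
    {β t a : ℝ} (ht : 0 ≤ t) (ha0 : 0 ≤ a) :
    ∫⁻ τ, batchErr X good θ β (c.σ * t / √B) a τ
      ∂(Measure.pi fun _ : Fin K => Measure.pi fun _ : Fin B => X.trajLaw θ) ≤
      ENNReal.ofReal (8 * c.σ ^ 2 / (K * B) + 128 * β ^ 2 * (c.σ * t / √B) ^ 2 +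
        25 * c.σ ^ 2 * (K * (2 * Real.exp (-((a * t) ^ 2 / 2))))) := by
  have := trajLaw_prob hX θ
  have hK' : (0 : ℝ) < K := by positivity
  have hB' : (0 : ℝ) < B := by positivity
  have hm1 : Measurable fun τ : Fin K → Fin B → Traj S A c.H =>
      ENNReal.ofReal (8 / (K : ℝ) ^ 2) *
        ENNReal.ofReal (‖∑ k ∈ good, batchDev X θ (τ k)‖ ^ 2) :=
    (ENNReal.measurable_ofReal.comp ((Finset.measurable_sum _ fun k _ =>
      (measurable_batchDev hX θ).comp (measurable_pi_apply k)).norm.pow_const 2)).const_mul _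
  have hm2 := hm1.add_const (ENNReal.ofReal (128 * β ^ 2 * (c.σ * t / √B) ^ 2))
  simp only [batchErr]
  rw [lintegral_add_left hm2, lintegral_add_left hm1,
    lintegral_const_mul' _ _ ENNReal.ofReal_ne_top, lintegral_const, measure_univ, mul_one,
    lintegral_indicator_const (measurableSet_badSet hX good θ _)]
  have e : a * (c.σ * t / √B) = c.σ * (a * t) / √B := by ring
  rw [e]
  refine (add_le_add (add_le_add (mul_le_mul_right
    (lintegral_norm_sum_batchDev_sq_le hX hB good θ) _) le_rfl) (mul_le_mul_right
    (measure_badSet_le hX hB good θ (mul_nonneg ha0 ht)) _)).trans (le_of_eq ?_)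
  rw [← ENNReal.ofReal_mul (by positivity), ← ENNReal.ofReal_mul (by positivity),
    ← ENNReal.ofReal_add (by positivity) (by positivity),
    ← ENNReal.ofReal_add (by positivity) (by positivity)]
  congr 3
  field_simp

end BatchError

end FedPG

/-! ### Measurability of the rounds and summation over them. -/

namespace FedPG

/-- Terms stay on both sides because subtraction in `ℝ≥0∞` is truncated. The lemma passes the
inner-loop inequality through the reply of the adversary and then through the trajectories. -/
theorem lintegral_add_le_of_ae {Ω : Type*} [MeasurableSpace Ω] {P : Measure Ω}
    [IsProbabilityMeasure P] {F G e : Ω → ℝ≥0∞} {a r : ℝ≥0∞} (he : Measurable e)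
    (hr : ∫⁻ ω, e ω ∂P ≤ r) (h : ∀ᵐ ω ∂P, F ω + a ≤ G ω + e ω) :
    ∫⁻ ω, F ω ∂P + a ≤ ∫⁻ ω, G ω ∂P + r := by
  have h1 := lintegral_mono_ae h
  rw [lintegral_add_right _ measurable_const, lintegral_add_right _ he, lintegral_const,
    measure_univ, mul_one] at h1
  exact h1.trans (add_le_add le_rfl hr)

section Rounds

variable {S A Z : Type*} [MeasurableSpace S] [MeasurableSpace A] [MeasurableSpace Z] {d K B : ℕ}
  {c : Constants} {X : Setting S A d c.H} (hX : Assumptions c X)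

instance (B : ℕ) : IsProbabilityMeasure (stepsLaw B) := by unfold stepsLaw; infer_instance

/-- The law of the server parameter after the inner loop, together with a memory `z`. -/
def loopLaw (X : Setting S A d c.H) (η : ℝ) (B : ℕ) (θ μ : Param d) (z : Z) :
    Measure (Param d × Z) :=
  (stepsLaw B).bind fun N => (innerLaw X c.γ η θ μ N).map fun θ' => (θ', z)

/-- The law of the result of a round, given the trajectories of the agents. -/
def replyLaw (X : Setting S A d c.H) (adv : Adversary S A Z d c.H K B) (good : Finset (Fin K))
    (pick : Finset (Fin K) → Fin K) (α η δ : ℝ) (t : ℕ) (x : Param d × Z)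
    (τ : Fin K → Fin B → Traj S A c.H) : Measure (Param d × Z) :=
  (adv.respond t (x.2, x.1, τ)).bind fun y =>
    loopLaw X η B x.1 (aggregate pick α c.σ (2 * c.σ * √(V K δ / B))
      (messages X c.γ good x.1 τ y.1)) y.2

theorem roundLaw_eq (X : Setting S A d c.H) (adv : Adversary S A Z d c.H K B)
    (good : Finset (Fin K)) (pick : Finset (Fin K) → Fin K) (α η δ : ℝ) (t : ℕ)
    (x : Param d × Z) : roundLaw c X adv good pick α η δ t x =
      (Measure.pi fun _ : Fin K => Measure.pi fun _ : Fin B => X.trajLaw x.1).bind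
        (replyLaw X adv good pick α η δ t x) := rfl

include hX

theorem measurable_map_innerLaw (η : ℝ) (N : ℕ) :
    Measurable fun q : Param d × Param d × Z =>
      (innerLaw X c.γ η q.1 q.2.1 N).map fun θ' => (θ', q.2.2) := by
  have hp := fun q : Param d × Param d × Z => innerLaw_prob hX η N q.1 q.2.1
  have hm := (innerLaw_prob_and_measurable hX η N).2.comp
    (by fun_prop : Measurable fun q : Param d × Param d × Z => (q.1, q.2.1))
  simp only [Function.comp_def] at hm
  refine measurable_map_param hm (k := fun (q : Param d × Param d × Z) θ' => (θ', q.2.2)) ?_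
  exact (by fun_prop : Measurable fun r : (Param d × Param d × Z) × Param d => (r.2, r.1.2.2))

theorem map_innerLaw_prob (η : ℝ) (N : ℕ) (θ μ : Param d) (z : Z) :
    IsProbabilityMeasure ((innerLaw X c.γ η θ μ N).map fun θ' => (θ', z)) := by
  have := innerLaw_prob hX η N θ μ
  exact Measure.isProbabilityMeasure_map (by fun_prop)

theorem loopLaw_prob (η : ℝ) (θ μ : Param d) (z : Z) :
    IsProbabilityMeasure (loopLaw X η B θ μ z) :=
  isProbabilityMeasure_bind_of_measurable (measurable_of_countable _)
    fun N => map_innerLaw_prob hX η N θ μ z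

theorem measurable_loopLaw (η : ℝ) :
    Measurable fun q : Param d × Param d × Z => loopLaw X η B q.1 q.2.1 q.2.2 := by
  refine measurable_bind_param (μ := fun _ : Param d × Param d × Z => stepsLaw B)
    measurable_const (k := fun (q : Param d × Param d × Z) N =>
      (innerLaw X c.γ η q.1 q.2.1 N).map fun θ' => (θ', q.2.2)) ?_
  exact measurable_from_prod_countable_left fun N => measurable_map_innerLaw hX η N

omit hX in
theorem lintegral_loopLaw (η : ℝ) (θ μ : Param d) (z : Z) {f : Param d → ℝ≥0∞}
    (hf : Measurable f) : ∫⁻ p, f p.1 ∂(loopLaw X η B θ μ z) =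
      ∫⁻ N, ∫⁻ θ', f θ' ∂(innerLaw X c.γ η θ μ N) ∂(stepsLaw B) := by
  have hf' : Measurable fun p : Param d × Z => f p.1 := hf.comp measurable_fst
  rw [loopLaw, lintegral_bind_map (measurable_of_countable _) hf']
  refine lintegral_congr fun N => ?_
  rw [lintegral_map hf' (by fun_prop)]

theorem measurable_messages (good : Finset (Fin K)) :
    Measurable fun q : Param d × (Fin K → Fin B → Traj S A c.H) × (Fin K → Param d) =>
      messages X c.γ good q.1 q.2.1 q.2.2 := by
  refine measurable_pi_iff.2 fun k => ?_
  by_cases hk : k ∈ good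
  · simp only [messages, if_pos hk]
    have h : Measurable fun q : Param d × (Fin K → Fin B → Traj S A c.H) × (Fin K → Param d) =>
        ∑ i, X.g c.γ (q.2.1 k i) q.1 := Finset.measurable_sum Finset.univ fun i _ => by
      have h := (measurable_g hX).comp (by fun_prop : Measurable fun q : Param d ×
        (Fin K → Fin B → Traj S A c.H) × (Fin K → Param d) => (q.2.1 k i, q.1))
      exact h
    exact h.const_smul ((B : ℝ)⁻¹)
  · simp only [messages, if_neg hk]
    fun_prop

variable (adv : Adversary S A Z d c.H K B) (good : Finset (Fin K))
  (pick : Finset (Fin K) → Fin K) (α η δ : ℝ) (t : ℕ)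

theorem measurable_loopLaw_reply :
    Measurable fun q : ((Param d × Z) × (Fin K → Fin B → Traj S A c.H)) ×
      ((Fin K → Param d) × Z) => loopLaw X η B q.1.1.1 (aggregate pick α c.σ
        (2 * c.σ * √(V K δ / B)) (messages X c.γ good q.1.1.1 q.1.2 q.2.1)) q.2.2 := by
  have hmsg := (measurable_messages (B := B) hX good).comp (by fun_prop :
    Measurable fun q : ((Param d × Z) × (Fin K → Fin B → Traj S A c.H)) ×
      ((Fin K → Param d) × Z) => (q.1.1.1, q.1.2, q.2.1))
  have hagg := (measurable_aggregate (d := d) pick α c.σ (2 * c.σ * √(V K δ / B))).comp hmsg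
  have h := (measurable_loopLaw (Z := Z) (B := B) hX η).comp
    ((by fun_prop : Measurable fun q : ((Param d × Z) × (Fin K → Fin B → Traj S A c.H)) ×
      ((Fin K → Param d) × Z) => q.1.1.1).prodMk (hagg.prodMk (by fun_prop :
        Measurable fun q : ((Param d × Z) × (Fin K → Fin B → Traj S A c.H)) ×
      ((Fin K → Param d) × Z) => q.2.2)))
  exact h

theorem measurable_loopLaw_reply_left (x : Param d × Z) (τ : Fin K → Fin B → Traj S A c.H) :
    Measurable fun y : (Fin K → Param d) × Z => loopLaw X η B x.1 (aggregate pick α c.σ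
        (2 * c.σ * √(V K δ / B)) (messages X c.γ good x.1 τ y.1)) y.2 := by
  have h := (measurable_loopLaw_reply hX good pick α η δ).comp
    (measurable_prodMk_left (x := (x, τ)))
  exact h

theorem measurable_replyLaw :
    Measurable fun q : (Param d × Z) × (Fin K → Fin B → Traj S A c.H) =>
      replyLaw X adv good pick α η δ t q.1 q.2 := by
  have hmk := adv.respond_markov t
  have hr := (adv.respond t).measurable.comp (by fun_prop :
    Measurable fun q : (Param d × Z) × (Fin K → Fin B → Traj S A c.H) => (q.1.2, q.1.1, q.2))
  have hp : ∀ q : (Param d × Z) × (Fin K → Fin B → Traj S A c.H),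
      IsProbabilityMeasure (adv.respond t (q.1.2, q.1.1, q.2)) := fun q => inferInstance
  exact measurable_bind_param (μ := fun q : (Param d × Z) × (Fin K → Fin B → Traj S A c.H) =>
    adv.respond t (q.1.2, q.1.1, q.2)) hr
    (k := fun (q : (Param d × Z) × (Fin K → Fin B → Traj S A c.H))
      (y : (Fin K → Param d) × Z) => loopLaw X η B q.1.1 (aggregate pick α c.σ
        (2 * c.σ * √(V K δ / B)) (messages X c.γ good q.1.1 q.2 y.1)) y.2)
    (measurable_loopLaw_reply hX good pick α η δ)

theorem measurable_replyLaw_left (x : Param d × Z) :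
    Measurable (replyLaw X adv good pick α η δ t x) := by
  have h := (measurable_replyLaw hX adv good pick α η δ t).comp
    (measurable_prodMk_left (x := x))
  exact h

theorem replyLaw_prob (x : Param d × Z) (τ : Fin K → Fin B → Traj S A c.H) :
    IsProbabilityMeasure (replyLaw X adv good pick α η δ t x τ) := by
  have hmk := adv.respond_markov t
  exact isProbabilityMeasure_bind_of_measurable
    (measurable_loopLaw_reply_left hX good pick α η δ x τ) fun y => loopLaw_prob hX η _ _ _

theorem measurable_roundLaw : Measurable (roundLaw c X adv good pick α η δ t) := by
  have h1 := trajLaw_prob hX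
  have h2 := (measurable_trajLaw hX).comp (by fun_prop : Measurable fun x : Param d × Z => x.1)
  simp only [Function.comp_def] at h2
  have h3 := measurable_pi_param (ι := Fin B) h2
  have h4 := measurable_pi_param (ι := Fin K) h3
  exact measurable_bind_param h4 (k := fun x τ => replyLaw X adv good pick α η δ t x τ)
    (measurable_replyLaw hX adv good pick α η δ t)

theorem roundLaw_prob (x : Param d × Z) :
    IsProbabilityMeasure (roundLaw c X adv good pick α η δ t x) := by
  have := trajLaw_prob hX x.1
  rw [roundLaw_eq]
  exact isProbabilityMeasure_bind_of_measurable
    (measurable_replyLaw_left hX adv good pick α η δ t x)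
    fun τ => replyLaw_prob hX adv good pick α η δ t x τ

theorem lintegral_replyLaw (x : Param d × Z) (τ : Fin K → Fin B → Traj S A c.H)
    {f : Param d → ℝ≥0∞} (hf : Measurable f) :
    ∫⁻ p, f p.1 ∂(replyLaw X adv good pick α η δ t x τ) =
      ∫⁻ y, ∫⁻ N, ∫⁻ θ', f θ' ∂(innerLaw X c.γ η x.1 (aggregate pick α c.σ
        (2 * c.σ * √(V K δ / B)) (messages X c.γ good x.1 τ y.1)) N) ∂(stepsLaw B)
        ∂(adv.respond t (x.2, x.1, τ)) := by
  have hf' : Measurable fun p : Param d × Z => f p.1 := hf.comp measurable_fst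
  rw [replyLaw, lintegral_bind_map (measurable_loopLaw_reply_left hX good pick α η δ x τ) hf']
  exact lintegral_congr fun y => lintegral_loopLaw η _ _ _ hf

theorem runLaw_prob (θ₀ : Param d) (t : ℕ) :
    IsProbabilityMeasure (runLaw c X adv good pick α η δ θ₀ t) := by
  induction t with
  | zero =>
    have := adv.start_prob
    exact Measure.isProbabilityMeasure_map (by fun_prop)
  | succ t ih =>
    exact isProbabilityMeasure_bind_of_measurable
      (measurable_roundLaw hX adv good pick α η δ (t + 1))
      fun x => roundLaw_prob hX adv good pick α η δ (t + 1) x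

theorem measurable_batchErr (θ : Param d) (β ρ a : ℝ) :
    Measurable (batchErr (B := B) X good θ β ρ a) := by
  have hm : Measurable fun τ : Fin K → Fin B → Traj S A c.H => ∑ k ∈ good, batchDev X θ (τ k) :=
    Finset.measurable_sum _ fun k _ => (measurable_batchDev hX θ).comp (measurable_pi_apply k)
  exact (((ENNReal.measurable_ofReal.comp (hm.norm.pow_const 2)).const_mul _).add_const _).add
    (measurable_const.indicator (measurableSet_badSet hX good θ _))

/-- The error that remains in every round. -/
def Constants.roundErr (c : Constants) (K B : ℕ) (β v a : ℝ) : ℝ :=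
  8 * c.σ ^ 2 / (K * B) + 128 * β ^ 2 * (c.σ * √v / √B) ^ 2 +
    25 * c.σ ^ 2 * (K * (2 * Real.exp (-((a * √v) ^ 2 / 2))))

omit hX in
theorem Constants.roundErr_nonneg (c : Constants) (K B : ℕ) (β v a : ℝ) :
    0 ≤ c.roundErr K B β v a := by unfold Constants.roundErr; positivity

variable {adv good pick α η δ}

/-- The bound `batchErr` depends on the trajectories but not on the reply, so integrating over the
reply removes the adversary; only then are the trajectories averaged. -/
theorem lintegral_roundLaw_le (hK : 1 ≤ K) (hB : 1 ≤ B)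
    (hpick : ∀ s : Finset (Fin K), s.Nonempty → pick s ∈ s) {β a : ℝ} (hα : α < 1 / 2)
    (hβ0 : 0 ≤ β) (hβ : β ≤ α) (hcard : (K : ℝ) - good.card ≤ β * K) (ha0 : 0 ≤ a)
    (ha : a ≤ (1 - 2 * β) / 2) (hV : V K δ ≤ B) (hη : 0 < η) (hx1 : c.smooth * η ≤ 1 / 4)
    (hx2 : (c.smooth * η) ^ 2 * B ≤ 1 / 16) (hx3 : (c.smooth * η) ^ 3 * (B : ℝ) ^ 2 ≤ 1 / 64)
    (x : Param d × Z) :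
    ∫⁻ p, ENNReal.ofReal (‖gradient (X.J c.γ) p.1‖ ^ 2) ∂(roundLaw c X adv good pick α η δ t x) +
        ENNReal.ofReal (2 / (η * B) * X.J c.γ x.1) ≤
      ∫⁻ p, ENNReal.ofReal (2 / (η * B) * X.J c.γ p.1) ∂(roundLaw c X adv good pick α η δ t x) +
        ENNReal.ofReal (c.roundErr K B β (V K δ) a) := by
  have := trajLaw_prob hX x.1
  have hmk := adv.respond_markov t
  have hB' : (0 : ℝ) < B := by positivity
  have hm1 : Measurable fun θ : Param d => ENNReal.ofReal (‖gradient (X.J c.γ) θ‖ ^ 2) :=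
    ENNReal.measurable_ofReal.comp ((continuous_gradient_J hX).measurable.norm.pow_const 2)
  have hm2 : Measurable fun θ : Param d => ENNReal.ofReal (2 / (η * B) * X.J c.γ θ) :=
    ENNReal.measurable_ofReal.comp ((continuous_J hX).measurable.const_mul _)
  have hr := measurable_replyLaw_left hX adv good pick α η δ t x
  have hm1' : Measurable fun p : Param d × Z => ENNReal.ofReal (‖gradient (X.J c.γ) p.1‖ ^ 2) :=
    hm1.comp measurable_fst
  have hm2' : Measurable fun p : Param d × Z => ENNReal.ofReal (2 / (η * B) * X.J c.γ p.1) :=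
    hm2.comp measurable_fst
  rw [roundLaw_eq, lintegral_bind_map hr hm1', lintegral_bind_map hr hm2']
  simp only [fun τ => lintegral_replyLaw hX adv good pick α η δ t x τ hm1,
    fun τ => lintegral_replyLaw hX adv good pick α η δ t x τ hm2]
  set P := Measure.pi fun _ : Fin K => Measure.pi fun _ : Fin B => X.trajLaw x.1
  -- This is where `V ≤ B` enters: the threshold of rule R1 does not exceed `2σ`, as the crude bound
  -- on the bad event requires.
  have hρσ : c.σ * √(V K δ) / √B ≤ c.σ := by
    rw [mul_div_assoc]
    refine mul_le_of_le_one_right c.σ_nonneg ?_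
    rw [div_le_one (Real.sqrt_pos.2 hB')]
    exact Real.sqrt_le_sqrt hV
  have hρ : 0 ≤ c.σ * √(V K δ) / √B := by have := c.σ_nonneg; positivity
  have hthr : 2 * c.σ * √(V K δ / B) = 2 * (c.σ * √(V K δ) / √B) := by
    rw [Real.sqrt_div' _ hB'.le]; ring
  have hagg := aggregate_err_le hX hB hK hpick hα hβ0 hβ hcard hρ hρσ ha0 ha x.1
  have herr := lintegral_batchErr_le hX hB hK good x.1 (β := β) (Real.sqrt_nonneg (V K δ)) ha0
  have hbm := measurable_batchErr (B := B) hX good x.1 β (c.σ * √(V K δ) / √B) a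
  refine lintegral_add_le_of_ae hbm herr (hagg.mono fun τ hτ => ?_)
  rw [hthr]
  exact lintegral_add_le_of_ae measurable_const (by rw [lintegral_const, measure_univ, mul_one])
    (ae_of_all _ fun y => (inner_loop hX x.1 _ hη hB hx1 hx2 hx3).trans
      (add_le_add le_rfl (hτ y.1)))

/-- The potential `j` telescopes over the rounds; its nonnegative initial value is dropped. -/
theorem lintegral_runLaw_le {r : ℝ≥0∞} {f j : Param d → ℝ≥0∞} (hf : Measurable f)
    (hj : Measurable j)
    (h : ∀ t x, ∫⁻ p, f p.1 ∂(roundLaw c X adv good pick α η δ t x) + j x.1 ≤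
      ∫⁻ p, j p.1 ∂(roundLaw c X adv good pick α η δ t x) + r) (θ₀ : Param d) (T : ℕ) :
    ∑ t ∈ Finset.Icc 1 T, ∫⁻ p, f p.1 ∂(runLaw c X adv good pick α η δ θ₀ t) ≤
      ∫⁻ p, j p.1 ∂(runLaw c X adv good pick α η δ θ₀ T) + T * r := by
  induction T with
  | zero => simp
  | succ T ih =>
    have hp := runLaw_prob hX adv good pick α η δ θ₀ T
    rw [Finset.sum_Icc_succ_top (by omega)]
    refine (add_le_add ih le_rfl).trans ?_
    have hm := measurable_roundLaw hX adv good pick α η δ (T + 1)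
    have hf' : Measurable fun p : Param d × Z => f p.1 := hf.comp measurable_fst
    have hj' : Measurable fun p : Param d × Z => j p.1 := hj.comp measurable_fst
    rw [runLaw, lintegral_bind_map hm hf', lintegral_bind_map hm hj']
    have h1 := lintegral_mono (μ := runLaw c X adv good pick α η δ θ₀ T) fun x => h (T + 1) x
    rw [lintegral_add_right _ hj', lintegral_add_right _ measurable_const, lintegral_const,
      measure_univ, mul_one] at h1
    calc _ = (∫⁻ x, ∫⁻ p, f p.1 ∂(roundLaw c X adv good pick α η δ (T + 1) x)
            ∂(runLaw c X adv good pick α η δ θ₀ T) +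
          ∫⁻ x, j x.1 ∂(runLaw c X adv good pick α η δ θ₀ T)) + T * r := by ring
      _ ≤ _ := add_le_add h1 le_rfl
      _ = _ := by push_cast; ring

theorem outputLaw_prob (θ₀ : Param d) {T : ℕ} (hT : 1 ≤ T) :
    IsProbabilityMeasure (outputLaw c X adv good pick α η δ θ₀ T) := by
  refine ⟨?_⟩
  have hp := runLaw_prob hX adv good pick α η δ θ₀
  have h1 : ∀ t, (runLaw c X adv good pick α η δ θ₀ t).map Prod.fst Set.univ = 1 := fun t => by
    rw [Measure.map_apply measurable_fst .univ, Set.preimage_univ, measure_univ]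
  rw [outputLaw, Measure.smul_apply, Measure.finsetSum_apply, Finset.sum_congr rfl fun t _ => h1 t]
  rw [Finset.sum_const, Nat.card_Icc, Nat.add_sub_cancel, nsmul_eq_mul, mul_one, smul_eq_mul]
  exact ENNReal.inv_mul_cancel (by exact_mod_cast (by omega : T ≠ 0)) (ENNReal.natCast_ne_top T)

omit hX in
theorem lintegral_outputLaw (θ₀ : Param d) (T : ℕ) {f : Param d → ℝ≥0∞} (hf : Measurable f) :
    ∫⁻ θ, f θ ∂(outputLaw c X adv good pick α η δ θ₀ T) =
      (T : ℝ≥0∞)⁻¹ * ∑ t ∈ Finset.Icc 1 T,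
        ∫⁻ p, f p.1 ∂(runLaw c X adv good pick α η δ θ₀ t) := by
  rw [outputLaw, lintegral_smul_measure, lintegral_finsetSum_measure, smul_eq_mul]
  simp_rw [lintegral_map hf measurable_fst]

theorem lintegral_outputLaw_le (hK : 1 ≤ K) (hB : 1 ≤ B)
    (hpick : ∀ s : Finset (Fin K), s.Nonempty → pick s ∈ s) {β a : ℝ} (hα : α < 1 / 2)
    (hβ0 : 0 ≤ β) (hβ : β ≤ α) (hcard : (K : ℝ) - good.card ≤ β * K) (ha0 : 0 ≤ a)
    (ha : a ≤ (1 - 2 * β) / 2) (hV : V K δ ≤ B) (hη : 0 < η) (hx1 : c.smooth * η ≤ 1 / 4)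
    (hx2 : (c.smooth * η) ^ 2 * B ≤ 1 / 16) (hx3 : (c.smooth * η) ^ 3 * (B : ℝ) ^ 2 ≤ 1 / 64)
    (θ₀ : Param d) {T : ℕ} (hT : 1 ≤ T) :
    ∫⁻ θ, ENNReal.ofReal (‖gradient (X.J c.γ) θ‖ ^ 2)
        ∂(outputLaw c X adv good pick α η δ θ₀ T) ≤
      ENNReal.ofReal (2 * (c.H * c.R) / (η * B * T) + c.roundErr K B β (V K δ) a) := by
  have hB' : (0 : ℝ) < B := by positivity
  have hT' : (0 : ℝ) < T := by positivity
  have hR := c.R_pos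
  have hm1 : Measurable fun θ : Param d => ENNReal.ofReal (‖gradient (X.J c.γ) θ‖ ^ 2) :=
    ENNReal.measurable_ofReal.comp ((continuous_gradient_J hX).measurable.norm.pow_const 2)
  have hm2 : Measurable fun θ : Param d => ENNReal.ofReal (2 / (η * B) * X.J c.γ θ) :=
    ENNReal.measurable_ofReal.comp ((continuous_J hX).measurable.const_mul _)
  have h := lintegral_runLaw_le hX hm1 hm2 (fun t x => lintegral_roundLaw_le (adv := adv) hX t hK hB
    hpick hα hβ0 hβ hcard ha0 ha hV hη hx1 hx2 hx3 x) θ₀ T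
  have hp := runLaw_prob hX adv good pick α η δ θ₀ T
  have hj : ∫⁻ p, ENNReal.ofReal (2 / (η * B) * X.J c.γ p.1)
      ∂(runLaw c X adv good pick α η δ θ₀ T) ≤ ENNReal.ofReal (2 / (η * B) * (c.H * c.R)) := by
    have h0 : 0 ≤ 2 / (η * B) := by positivity
    have hJ : ∀ p : Param d × Z, ENNReal.ofReal (2 / (η * B) * X.J c.γ p.1) ≤
        ENNReal.ofReal (2 / (η * B) * (c.H * c.R)) := fun p =>
      ENNReal.ofReal_le_ofReal (mul_le_mul_of_nonneg_left (J_mem hX p.1).2 h0)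
    refine (lintegral_mono hJ).trans ?_
    rw [lintegral_const, measure_univ, mul_one]
  have he := c.roundErr_nonneg K B β (V K δ) a
  rw [lintegral_outputLaw θ₀ T hm1]
  refine (mul_le_mul_right (h.trans (add_le_add hj le_rfl)) _).trans (le_of_eq ?_)
  generalize c.roundErr K B β (V K δ) a = r at he
  rw [← ENNReal.ofReal_natCast T, ← ENNReal.ofReal_mul hT'.le,
    ← ENNReal.ofReal_add (by positivity) (by positivity), ← ENNReal.ofReal_inv_of_pos hT',
    ← ENNReal.ofReal_mul (by positivity)]
  congr 1
  field_simp

end Rounds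

end FedPG

/-! ### Choice of the batch size and of the confidence parameter. -/

namespace FedPG

section Parameters

/-- Used to choose the exponent `p` in `δ = Z ^ (-(p + 3))`, when constants that are quadratic in
`p` have to be beaten by `2 ^ p`. -/
theorem exists_forall_mul_sq_le_two_pow (A : ℝ) :
    ∃ N : ℕ, ∀ n ≥ N, A * ((n : ℝ) + 1) ^ 2 ≤ 2 ^ n := by
  have h := (tendsto_pow_const_div_const_pow_of_one_lt 2 (one_lt_two (α := ℝ))).const_mul |A * 4|
  rw [mul_zero] at h
  obtain ⟨N, hN⟩ := Filter.eventually_atTop.1 (h.eventually (gt_mem_nhds one_pos))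
  refine ⟨max N 1, fun n hn => ?_⟩
  have h1 : (1 : ℝ) ≤ n := by exact_mod_cast (le_max_right _ _).trans hn
  have h2 := (hN n ((le_max_left _ _).trans hn)).le
  rw [← mul_div_assoc, div_le_one (by positivity)] at h2
  have h3 : ((n : ℝ) + 1) ^ 2 ≤ 4 * n ^ 2 := by nlinarith
  have h4 : A * 4 ≤ |A * 4| := le_abs_self _
  have h5 : A ≤ |A * 4| / 4 := by linarith
  calc A * ((n : ℝ) + 1) ^ 2 ≤ |A * 4| / 4 * ((n : ℝ) + 1) ^ 2 := by gcongr
    _ ≤ |A * 4| / 4 * (4 * n ^ 2) := by gcongr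
    _ = |A * 4| * (n : ℝ) ^ 2 := by ring
    _ ≤ 2 ^ n := h2

/-- `εK log(2 + K/ε)` is bounded when `εK log(2K)` is. -/
theorem mul_log_add_div_le {K ε κ w₀ : ℝ} (hK : 1 ≤ K) (hε : 0 < ε)
    (hκ : ε * (K * Real.log (2 * K)) ≤ κ) (hw : ε * K ≤ w₀) :
    ε * K * Real.log (2 + K / ε) ≤ 2 * κ + w₀ + 1 := by
  have hK0 : 0 < K := by linarith
  have hw0 : 0 < ε * K := by positivity
  have h1 : Real.log (2 + K / ε) ≤ 2 * Real.log (2 * K) + (1 + 1 / (ε * K)) := by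
    have h2 : 2 + K / ε ≤ (2 * K) ^ 2 * (2 + 1 / (ε * K)) := by
      have : (2 * K) ^ 2 * (2 + 1 / (ε * K)) = 8 * K ^ 2 + 4 * (K / ε) := by field_simp; ring
      rw [this]
      have : 0 ≤ K / ε := by positivity
      nlinarith
    have h3 := Real.log_le_log (by positivity) h2
    rw [Real.log_mul (by positivity) (by positivity), Real.log_pow] at h3
    have h4 := Real.log_le_sub_one_of_pos (by positivity : 0 < 2 + 1 / (ε * K))
    push_cast at h3
    linarith
  calc ε * K * Real.log (2 + K / ε) ≤ ε * K * (2 * Real.log (2 * K) + (1 + 1 / (ε * K))) := by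
        gcongr
    _ = 2 * (ε * (K * Real.log (2 * K))) + ε * K + 1 := by field_simp; ring
    _ ≤ _ := by linarith

/-- A quantity that dominates `K`, `1/ε` and a given constant, and whose logarithm is controlled. -/
theorem exists_scale {κ : ℝ} (hκ : 0 < κ) {m : ℝ} (hm : 0 ≤ m) :
    ∃ w E l : ℝ, 0 < w ∧ 0 < E ∧ 0 < l ∧
    ∀ (K : ℕ) (ε : ℝ), 1 ≤ K → 0 < ε → ε * (K * Real.log (2 * K)) ≤ κ → ε * K ≤ w ∧
      ∃ Z : ℝ, 2 ≤ Z ∧ m ≤ Z ∧ 2 * K ≤ Z ∧ 1 ≤ ε * Z ∧ ε * K * Real.log Z ≤ E ∧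
        Real.log Z ≤ l * Real.log (2 + K / ε) := by
  have hl2 : 0 < Real.log 2 := Real.log_pos one_lt_two
  -- As `log (2K) ≥ log 2`, the hypothesis bounds `ε K` itself by `κ / log 2`.
  obtain ⟨w, hw⟩ : ∃ w, w = κ / Real.log 2 := ⟨_, rfl⟩
  have hwpos : 0 < w := hw ▸ div_pos hκ hl2
  obtain ⟨D, hD⟩ : ∃ D, D = 2 + 2 * w + m := ⟨_, rfl⟩
  have hD2 : 2 ≤ D := by linarith
  have hlD : 0 < Real.log D := Real.log_pos (by linarith)
  refine ⟨w, w * Real.log D + (2 * κ + w + 1), Real.log D / Real.log 2 + 1, hwpos, by positivity,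
    by positivity, fun K ε hK hε hκε => ?_⟩
  have hK1 : (1 : ℝ) ≤ K := by exact_mod_cast hK
  have hw' : ε * K ≤ w := by
    rw [hw, le_div_iff₀ hl2]
    refine le_trans ?_ hκε
    rw [mul_assoc]
    have : Real.log 2 ≤ Real.log (2 * K) := Real.log_le_log two_pos (by linarith)
    gcongr
  have hKε : 0 < (K : ℝ) / ε := by positivity
  have h := mul_log_add_div_le hK1 hε hκε hw'
  obtain ⟨Y, hY⟩ : ∃ Y : ℝ, Y = 2 + K / ε := ⟨_, rfl⟩
  rw [← hY] at h ⊢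
  have hY2 : 2 ≤ Y := by linarith
  have hlY : Real.log 2 ≤ Real.log Y := Real.log_le_log two_pos hY2
  have hlZ : Real.log (D * Y) = Real.log D + Real.log Y :=
    Real.log_mul (by linarith) (by linarith)
  have hDY : D ≤ D * Y := le_mul_of_one_le_right (by linarith) (by linarith)
  have hYD : Y ≤ D * Y := le_mul_of_one_le_left (by linarith) (by linarith)
  -- The scale is a constant multiple of `2 + K/ε`: this dominates `K` and `1/ε` once the bound on
  -- `ε K` is known.
  refine ⟨hw', D * Y, hD2.trans hDY, by linarith, ?_, ?_, ?_, ?_⟩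
  · calc 2 * (K : ℝ) = 2 * (ε * K) * (1 / ε) := by field_simp
      _ ≤ 2 * w * (K / ε) := by gcongr
      _ ≤ D * Y := by gcongr <;> linarith
  · calc (1 : ℝ) ≤ K := hK1
      _ = ε * (K / ε) := by field_simp
      _ ≤ ε * (D * Y) := by gcongr; linarith
  · rw [hlZ, mul_add]
    exact add_le_add (mul_le_mul_of_nonneg_right hw' hlD.le) h
  · rw [hlZ, add_mul, one_mul, div_mul_eq_mul_div]
    gcongr
    rw [le_div_iff₀ hl2]
    gcongr

/-- Since `v ≥ 2 q log Z` and `a² q ≥ 3`, the exponential is at most `Z ^ (-3)`. The three powers of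
`Z` pay for the constant `m`, for `K` and for `1/ε`. -/
theorem mul_exp_neg_log_le {K ε Z v a q m : ℝ} (hK : 1 ≤ K) (hε : 0 < ε) (hm : 0 ≤ m)
    (hmZ : 8 * m ≤ Z) (hZ2 : 2 ≤ Z) (h2K : 2 * K ≤ Z) (h1ε : 1 ≤ ε * Z) (hqa : 3 ≤ a ^ 2 * q)
    (hv : v = 2 * (Real.log (2 * K) + q * Real.log Z)) (hv0 : 0 ≤ v) :
    m * (K * (2 * Real.exp (-((a * √v) ^ 2 / 2)))) ≤ ε / 4 := by
  have hZpos : 0 < Z := by linarith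
  have hlZ : 0 ≤ Real.log Z := Real.log_nonneg (by linarith)
  have hlK : 0 ≤ Real.log (2 * K) := Real.log_nonneg (by linarith)
  have e1 : Real.exp (-((a * √v) ^ 2 / 2)) ≤ (Z ^ 3)⁻¹ := by
    rw [Real.exp_neg]
    refine inv_anti₀ (by positivity) ?_
    rw [← Real.exp_log (by positivity : 0 < Z ^ 3), Real.exp_le_exp, Real.log_pow, mul_pow,
      Real.sq_sqrt hv0, hv]
    push_cast
    calc 3 * Real.log Z ≤ a ^ 2 * q * Real.log Z := by gcongr
      _ ≤ a ^ 2 * q * Real.log Z + a ^ 2 * Real.log (2 * K) :=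
          le_add_of_nonneg_right (by positivity)
      _ = _ := by ring
  have e2 : 8 * m * K ≤ Z * Z * (ε * Z) := by
    have e3 : 8 * m * K ≤ Z * Z := mul_le_mul hmZ (by linarith) (by linarith) hZpos.le
    exact e3.trans (le_mul_of_one_le_right (by positivity) h1ε)
  calc m * (K * (2 * Real.exp (-((a * √v) ^ 2 / 2)))) ≤ m * (K * (2 * (Z ^ 3)⁻¹)) := by gcongr
    _ = 8 * m * K / (4 * Z ^ 3) := by field_simp; ring
    _ ≤ Z * Z * (ε * Z) / (4 * Z ^ 3) :=
        div_le_div_of_nonneg_right e2 (by positivity)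
    _ = ε / 4 := by field_simp

/-- This breaks a circularity: `δ` must be at most `1 / (5KB)`, while `B` depends on `δ` through
`v`, hence on `p`. The bound for `B` is quadratic in `p` times `Z ^ 2`, and `Z ^ p ≥ 2 ^ p` wins. -/
theorem batch_le_pow {K ε Z v β q s B C₃ C₅ : ℝ} {p : ℕ} (hK : 1 ≤ K) (hε : 0 < ε) (hβ0 : 0 ≤ β)
    (hβ1 : β ≤ 1) (hZ2 : 2 ≤ Z) (h2K : 2 * K ≤ Z) (h1ε : 1 ≤ ε * Z) (hq : q = p + 3)
    (hv0 : 0 ≤ v) (hv : v ≤ (2 + 2 * q) * Real.log Z)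
    (hs : s = 1 / (ε * K) + β ^ 2 * v / ε) (hs0 : 0 ≤ s) (hC₅ : 1 ≤ C₅) (hC : C₃ ≤ C₅ * (q + 1))
    (hB : B ≤ C₃ * s + 1)
    (hp : 320 * C₅ * ((p : ℝ) + 1) ^ 2 ≤ 2 ^ p) : 5 * K * B ≤ Z ^ (p + 3) := by
  have hZpos : 0 < Z := by linarith
  have hp0 := Nat.cast_nonneg (α := ℝ) p
  have hq0 : 0 ≤ q := by linarith
  have hlZ : Real.log Z ≤ Z := by linarith [Real.log_le_sub_one_of_pos hZpos]
  have hs3 : s ≤ 3 * (q + 1) * Z ^ 2 := by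
    have e1 : 1 / (ε * K) ≤ Z ^ 2 := by
      rw [div_le_iff₀ (by positivity)]
      calc (1 : ℝ) ≤ ε * Z := h1ε
        _ ≤ ε * Z * (Z * K) := le_mul_of_one_le_right (by positivity)
            (one_le_mul_of_one_le_of_one_le (by linarith) hK)
        _ = _ := by ring
    have e2 : β ^ 2 * v / ε ≤ (2 + 2 * q) * Z ^ 2 := by
      rw [div_le_iff₀ hε]
      calc β ^ 2 * v ≤ 1 * ((2 + 2 * q) * Z) := by
            gcongr
            · exact pow_le_one₀ hβ0 hβ1
            · exact hv.trans (by gcongr)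
        _ ≤ (2 + 2 * q) * Z * (ε * Z) := by
            rw [one_mul]; exact le_mul_of_one_le_right (by positivity) h1ε
        _ = _ := by ring
    have e3 : 0 ≤ q * Z ^ 2 := by positivity
    calc s ≤ Z ^ 2 + (2 + 2 * q) * Z ^ 2 := hs ▸ add_le_add e1 e2
      _ ≤ _ := by linarith
  have hB4 : B ≤ 4 * C₅ * (q + 1) ^ 2 * Z ^ 2 := by
    have e1 : C₃ * s ≤ C₅ * (q + 1) * (3 * (q + 1) * Z ^ 2) := by gcongr
    have e2 : 1 ≤ C₅ * (q + 1) ^ 2 * Z ^ 2 :=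
      one_le_mul_of_one_le_of_one_le (one_le_mul_of_one_le_of_one_le hC₅
        (one_le_pow₀ (by linarith))) (one_le_pow₀ (by linarith))
    calc B ≤ C₅ * (q + 1) * (3 * (q + 1) * Z ^ 2) + C₅ * (q + 1) ^ 2 * Z ^ 2 :=
          hB.trans (add_le_add e1 e2)
      _ = _ := by ring
  calc 5 * K * B ≤ 5 * K * (4 * C₅ * (q + 1) ^ 2 * Z ^ 2) := by gcongr
    _ ≤ 5 * Z * (4 * C₅ * (q + 1) ^ 2 * Z ^ 2) := by gcongr; linarith
    _ = 20 * C₅ * (q + 1) ^ 2 * Z ^ 3 := by ring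
    _ ≤ 20 * C₅ * (16 * ((p : ℝ) + 1) ^ 2) * Z ^ 3 := by
        have : (q + 1) ^ 2 ≤ 16 * ((p : ℝ) + 1) ^ 2 := by rw [hq]; nlinarith
        gcongr
    _ = 320 * C₅ * ((p : ℝ) + 1) ^ 2 * Z ^ 3 := by ring
    _ ≤ 2 ^ p * Z ^ 3 := by gcongr
    _ ≤ Z ^ p * Z ^ 3 := by gcongr
    _ = _ := by rw [pow_add]

/-- Keeps `B ε ^ 3` bounded, so that later rounding the number of rounds up to an integer costs only
a constant factor. -/
theorem mul_pow_three_le {K ε v β s w E' : ℝ} (hK : 1 ≤ K) (hε : 0 < ε) (hβ0 : 0 ≤ β) (hβ1 : β ≤ 1)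
    (hv0 : 0 ≤ v) (hs : s = 1 / (ε * K) + β ^ 2 * v / ε) (hvE : v * (ε * K) ≤ E')
    (hw : ε * K ≤ w) : s * ε ^ 3 ≤ w ^ 2 + E' * w := by
  have hεK : ε ≤ ε * K := le_mul_of_one_le_right hε.le hK
  have e2 : s * ε ^ 3 = ε ^ 2 / K + β ^ 2 * (v * ε) * ε := by rw [hs]; field_simp
  have e3 : ε ^ 2 / K ≤ w ^ 2 := by
    rw [div_le_iff₀ (by positivity)]
    calc ε ^ 2 ≤ w ^ 2 := pow_le_pow_left₀ hε.le (hεK.trans hw) 2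
      _ ≤ w ^ 2 * K := le_mul_of_one_le_right (sq_nonneg w) hK
  have e4 : v * ε ≤ E' := (mul_le_mul_of_nonneg_left hεK hv0).trans hvE
  have e0 : 0 ≤ E' := le_trans (by positivity) e4
  have e6 : β ^ 2 * (v * ε) * ε ≤ 1 * E' * w := by
    gcongr
    · exact pow_le_one₀ hβ0 hβ1
    · exact hεK.trans hw
  rw [e2]
  linarith

/-- The batch size is `C₃ s` rounded up, with `s = 1 / (ε K) + β ^ 2 * v / ε`. The first part of `s`
controls the sampling error of the good agents, the second the Byzantine bias. The exponential term
is made small by `δ`, whose exponent grows with `1 / a ^ 2`. -/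
theorem exists_batch (c : Constants) {F κ a : ℝ} (hF : 0 ≤ F) (hκ : 0 < κ) (ha : 0 < a) :
    ∃ C : ℝ, 0 < C ∧ ∀ (K : ℕ) (β ε : ℝ), 1 ≤ K → 0 ≤ β → β ≤ 1 → 0 < ε →
      ε * (K * Real.log (2 * K)) ≤ κ → ∃ (B : ℕ) (δ : ℝ), 1 ≤ B ∧ F ≤ B ∧ 0 < δ ∧
        δ ≤ 1 / (5 * K * B) ∧ 0 ≤ V K δ ∧ V K δ ≤ B ∧ V K δ ≤ C * Real.log (2 + K / ε) ∧
        c.roundErr K B β (V K δ) a ≤ 3 * ε / 4 ∧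
        (B : ℝ) ≤ C * (1 / (ε * K) + β ^ 2 * V K δ / ε) ∧ B * ε ^ 3 ≤ C := by
  have hσ2 := sq_nonneg c.σ
  obtain ⟨w₀, E, l, hw₀pos, hEpos, hlpos, hscale⟩ := exists_scale hκ
    (m := 8 * (25 * c.σ ^ 2)) (by positivity)
  have hwF : 0 ≤ w₀ * F := by positivity
  -- `C₅` does not involve `p`, whereas `C₃` does; `C₃ ≤ C₅ * (q + 1)` lets `p` be fixed before
  -- `C₃`.
  obtain ⟨C₅, hC₅⟩ : ∃ C₅, C₅ = w₀ * F + 512 * c.σ ^ 2 + 2 * E + 1 := ⟨_, rfl⟩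
  have hC₅1 : 1 ≤ C₅ := by linarith
  obtain ⟨N, hN⟩ := exists_forall_mul_sq_le_two_pow (320 * C₅)
  obtain ⟨N', hN'⟩ := exists_nat_ge (3 / a ^ 2)
  obtain ⟨p, hp⟩ : ∃ p, p = max N N' := ⟨_, rfl⟩
  have hpow := hN p (hp ▸ le_max_left _ _)
  obtain ⟨q, hq⟩ : ∃ q : ℝ, q = (p : ℝ) + 3 := ⟨_, rfl⟩
  have hq3 : 3 ≤ q := by rw [hq]; linarith [Nat.cast_nonneg (α := ℝ) p]
  have hqa : 3 ≤ a ^ 2 * q := by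
    have h : 3 / a ^ 2 ≤ p := hN'.trans (by exact_mod_cast hp ▸ le_max_right _ _)
    rw [div_le_iff₀' (by positivity)] at h
    exact h.trans (mul_le_mul_of_nonneg_left (by linarith) (sq_nonneg a))
  obtain ⟨E', hE'⟩ : ∃ E', E' = (2 + 2 * q) * E := ⟨_, rfl⟩
  have hE'pos : 0 < E' := by rw [hE']; positivity
  -- The summands serve `F ≤ B`, the two polynomial error terms, and `v ≤ B`, in this order.
  obtain ⟨C₃, hC₃⟩ : ∃ C₃, C₃ = w₀ * F + 512 * c.σ ^ 2 + E' + 1 := ⟨_, rfl⟩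
  have hC₃pos : 0 < C₃ := by linarith
  have hC₃5 : C₃ ≤ C₅ * (q + 1) := by
    have e : C₅ * (q + 1) = C₃ + (w₀ * F + 512 * c.σ ^ 2 + 1) * q := by rw [hC₃, hC₅, hE']; ring
    rw [e]
    exact le_add_of_nonneg_right (by positivity)
  have hC₃σ : 512 * c.σ ^ 2 ≤ C₃ := by linarith
  have hC₃F : w₀ * F ≤ C₃ := by linarith
  have hC₃E : E' ≤ C₃ := by linarith
  obtain ⟨C₆, hC₆⟩ : ∃ C₆, C₆ = (C₃ + w₀) * (w₀ ^ 2 + E' * w₀) := ⟨_, rfl⟩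
  have hC₆pos : 0 < C₆ := by rw [hC₆]; positivity
  obtain ⟨CV, hCV⟩ : ∃ CV, CV = (2 + 2 * q) * l := ⟨_, rfl⟩
  have hCVpos : 0 < CV := by rw [hCV]; positivity
  refine ⟨CV + (C₃ + w₀) + C₆, by positivity, fun K β ε hK hβ0 hβ1 hε hκε => ?_⟩
  have hK1 : (1 : ℝ) ≤ K := by exact_mod_cast hK
  obtain ⟨hw, Z, hZ2, hσZ, h2K, h1ε, hEZ, hlZl⟩ := hscale K ε hK hε hκε
  clear hscale hC₃ hC₅ hN hN' hp
  have hZpos : 0 < Z := by linarith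
  have hlZpos : 0 < Real.log Z := Real.log_pos (by linarith)
  obtain ⟨δ, hδ⟩ : ∃ δ : ℝ, δ = (Z ^ (p + 3))⁻¹ := ⟨_, rfl⟩
  have hδpos : 0 < δ := by rw [hδ]; positivity
  have hVeq : V K δ = 2 * (Real.log (2 * K) + q * Real.log Z) := by
    rw [V, hδ, div_inv_eq_mul, Real.log_mul (by positivity) (by positivity), Real.log_pow, hq]
    push_cast; ring
  have hl2K0 : 0 ≤ Real.log (2 * K) := Real.log_nonneg (by linarith)
  have hl2K : Real.log (2 * K) ≤ Real.log Z := Real.log_le_log (by positivity) h2K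
  obtain ⟨v, hv⟩ : ∃ v, v = V K δ := ⟨_, rfl⟩
  rw [← hv] at hVeq
  have hv0 : 0 ≤ v := by rw [hVeq]; positivity
  have hvZ : v ≤ (2 + 2 * q) * Real.log Z := by rw [hVeq, add_mul, mul_add, mul_assoc]; gcongr
  have hvE : v * (ε * K) ≤ E' :=
    calc v * (ε * K) ≤ (2 + 2 * q) * Real.log Z * (ε * K) := by gcongr
      _ = (2 + 2 * q) * (ε * K * Real.log Z) := by ring
      _ ≤ E' := by rw [hE']; gcongr
  obtain ⟨s, hs⟩ : ∃ s, s = 1 / (ε * K) + β ^ 2 * v / ε := ⟨_, rfl⟩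
  have hs1 : 1 / (ε * K) ≤ s := by rw [hs]; exact le_add_of_nonneg_right (by positivity)
  have hs2 : β ^ 2 * v / ε ≤ s := by rw [hs]; exact le_add_of_nonneg_left (by positivity)
  have hspos : 0 < s := lt_of_lt_of_le (by positivity) hs1
  have hsεK : 1 ≤ s * (ε * K) := by rwa [div_le_iff₀ (by positivity)] at hs1
  have hsw : 1 ≤ w₀ * s := by
    rw [mul_comm]; exact hsεK.trans (by gcongr)
  obtain ⟨B, hB⟩ : ∃ B, B = ⌈C₃ * s⌉₊ := ⟨_, rfl⟩
  have hBle : C₃ * s ≤ B := hB ▸ Nat.le_ceil _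
  have hBlt : (B : ℝ) ≤ C₃ * s + 1 := hB ▸ (Nat.ceil_lt_add_one (by positivity)).le
  have hBpos : 1 ≤ B := by rw [hB, Nat.one_le_ceil_iff]; positivity
  have hB1 : (1 : ℝ) ≤ B := by exact_mod_cast hBpos
  have hBs : (B : ℝ) ≤ (C₃ + w₀) * s := by rw [add_mul]; linarith
  -- The bound on `ε K log (2K)` is decisive here: it bounds `v * (ε * K)`, whereas `B` is at least
  -- `C₃ / (ε * K)`.
  have hvB : v ≤ B := by
    refine le_trans ?_ hBle
    refine le_of_mul_le_mul_right (a := ε * K) ?_ (by positivity)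
    calc v * (ε * K) ≤ C₃ * 1 := by rw [mul_one]; exact hvE.trans hC₃E
      _ ≤ C₃ * (s * (ε * K)) := by gcongr
      _ = _ := by ring
  have h1 : 128 * β ^ 2 * (c.σ * √v / √B) ^ 2 ≤ ε / 4 := by
    rw [div_pow, mul_pow, Real.sq_sqrt hv0, Real.sq_sqrt (by positivity), mul_div_assoc',
      div_le_iff₀ (by positivity)]
    have h3 : β ^ 2 * v ≤ s * ε := by rwa [div_le_iff₀ hε] at hs2
    calc 128 * β ^ 2 * (c.σ ^ 2 * v) = 128 * c.σ ^ 2 * (β ^ 2 * v) := by ring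
      _ ≤ 128 * c.σ ^ 2 * (s * ε) := by gcongr
      _ = ε / 4 * (512 * c.σ ^ 2 * s) := by ring
      _ ≤ ε / 4 * (C₃ * s) := by gcongr
      _ ≤ _ := by gcongr
  have h2 : 8 * c.σ ^ 2 / (K * B) ≤ ε / 4 := by
    rw [div_le_iff₀ (by positivity)]
    calc 8 * c.σ ^ 2 ≤ C₃ / 4 * 1 := by linarith
      _ ≤ C₃ / 4 * (s * (ε * K)) := by gcongr
      _ = ε / 4 * (K * (C₃ * s)) := by ring
      _ ≤ _ := by gcongr
  have h3 := mul_exp_neg_log_le (m := 25 * c.σ ^ 2) hK1 hε (by positivity) hσZ hZ2 h2K h1ε hqa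
    hVeq hv0
  refine ⟨B, δ, hBpos, ?_, hδpos, ?_, hv ▸ hv0, hv ▸ hvB, ?_, ?_, ?_, ?_⟩
  · calc F = F * 1 := (mul_one F).symm
      _ ≤ F * (w₀ * s) := by gcongr
      _ = w₀ * F * s := by ring
      _ ≤ C₃ * s := by gcongr
      _ ≤ B := hBle
  · rw [hδ, one_div]
    exact inv_anti₀ (by positivity) (batch_le_pow hK1 hε hβ0 hβ1 hZ2 h2K h1ε hq hv0 hvZ hs hspos.le
      hC₅1 hC₃5 hBlt hpow)
  · rw [← hv]
    have hlY : 0 ≤ Real.log (2 + K / ε) :=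
      Real.log_nonneg (by linarith [div_pos (by linarith : (0 : ℝ) < K) hε])
    calc v ≤ (2 + 2 * q) * Real.log Z := hvZ
      _ ≤ (2 + 2 * q) * (l * Real.log (2 + K / ε)) := by gcongr
      _ = CV * Real.log (2 + K / ε) := by rw [hCV]; ring
      _ ≤ _ := by gcongr; linarith
  · rw [← hv, Constants.roundErr]
    linarith
  · rw [← hv, ← hs]
    exact hBs.trans (mul_le_mul_of_nonneg_right (by linarith) hspos.le)
  · calc (B : ℝ) * ε ^ 3 ≤ (C₃ + w₀) * s * ε ^ 3 := by gcongr
      _ = (C₃ + w₀) * (s * ε ^ 3) := by ring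
      _ ≤ (C₃ + w₀) * (w₀ ^ 2 + E' * w₀) := by
          gcongr
          exact mul_pow_three_le hK1 hε hβ0 hβ1 hv0 hs hvE hw
      _ = C₆ := hC₆.symm
      _ ≤ _ := by linarith

end Parameters

end FedPG

/-! ### Counting trajectories and conclusion. -/

namespace FedPG

section Complexity

theorem lintegral_natCast_stepsLaw (B : ℕ) : ∫⁻ n, (n : ℝ≥0∞) ∂(stepsLaw B) = B := by
  have hB : (0 : ℝ) < (B : ℝ) + 1 := by positivity
  have hΓ0 : 0 ≤ (B : ℝ) / (B + 1) := by positivity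
  have hΓ1 : (B : ℝ) / (B + 1) < 1 := by rw [div_lt_one hB]; linarith
  have h := (hasSum_coe_mul_geometric_of_norm_lt_one
    (by rwa [Real.norm_of_nonneg hΓ0] : ‖(B : ℝ) / (B + 1)‖ < 1)).mul_right (1 / ((B : ℝ) + 1))
  have e : (B : ℝ) / (B + 1) / (1 - (B : ℝ) / (B + 1)) ^ 2 * (1 / ((B : ℝ) + 1)) = B := by
    have : 1 - (B : ℝ) / (B + 1) = 1 / (B + 1) := by field_simp; ring
    rw [this]; field_simp
  rw [e] at h
  have h' := ENNReal.ofReal_tsum_of_nonneg (fun n => by positivity) h.summable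
  rw [h.tsum_eq, ENNReal.ofReal_natCast] at h'
  rw [lintegral_stepsLaw, h']
  refine tsum_congr fun n => ?_
  rw [← ENNReal.ofReal_natCast n, ← ENNReal.ofReal_mul (by positivity)]
  congr 1
  ring

theorem expectedTraj_eq (T B : ℕ) : expectedTraj T B = ENNReal.ofReal (T * (2 * B)) := by
  rw [expectedTraj, lintegral_natCast_stepsLaw, Finset.sum_const, Nat.card_Icc, Nat.add_sub_cancel,
    nsmul_eq_mul, ← two_mul, ENNReal.ofReal_mul (by positivity), ENNReal.ofReal_mul (by positivity)]
  simp

/-- With `b` the cube root of `B` and `T` the ceiling of `C₁ / (b ε)`, the cost `2TB` is at most `(2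
C₁ + 2 b ε) b² / ε`. Here `b ε` is bounded because `B ε ^ 3` is, and subadditivity of the power
`2/3` splits `b² = B ^ (2/3)` into the two terms of the claim. -/
theorem exists_rounds {C C₁ : ℝ} (hC : 0 < C) (hC₁ : 0 < C₁) : ∃ C' : ℝ, 0 < C' ∧
    ∀ (B : ℕ) (ε x y b : ℝ), 0 < ε → 0 ≤ x → 0 ≤ y → 1 ≤ b → b ^ 3 = B → B ≤ C * (x + y) →
      B * ε ^ 3 ≤ C → ∃ T : ℕ, 1 ≤ T ∧ C₁ / (b * T) ≤ ε ∧
        T * (2 * (B : ℝ)) ≤ C' * (x ^ (2 / 3 : ℝ) / ε + y ^ (2 / 3 : ℝ) / ε) := by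
  refine ⟨(2 * C₁ + 2 * (1 + C)) * C ^ (2 / 3 : ℝ), by positivity,
    fun B ε x y b hε hx hy hb hbB hB hBε => ?_⟩
  have hb0 : 0 < b := by linarith
  have hT0 : 0 < C₁ / (b * ε) := by positivity
  obtain ⟨T, hT⟩ : ∃ T, T = ⌈C₁ / (b * ε)⌉₊ := ⟨_, rfl⟩
  have hT1 : 1 ≤ T := by rw [hT, Nat.one_le_ceil_iff]; exact hT0
  have hTle : C₁ / (b * ε) ≤ T := hT ▸ Nat.le_ceil _
  have hTlt : (T : ℝ) ≤ C₁ / (b * ε) + 1 := hT ▸ (Nat.ceil_lt_add_one hT0.le).le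
  have hT1' : (1 : ℝ) ≤ T := by exact_mod_cast hT1
  refine ⟨T, hT1, ?_, ?_⟩
  · rw [div_le_iff₀ (by positivity)] at hTle ⊢
    linarith
  have hbε : b * ε ≤ 1 + C := by
    rw [← hbB, ← mul_pow] at hBε
    by_contra h
    have h1 : 1 ≤ b * ε := by linarith
    have := le_self_pow₀ h1 (three_ne_zero)
    linarith
  have hb2 : b ^ 2 ≤ C ^ (2 / 3 : ℝ) * (x ^ (2 / 3 : ℝ) + y ^ (2 / 3 : ℝ)) := by
    have e : b ^ 2 = (B : ℝ) ^ (2 / 3 : ℝ) := by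
      rw [← hbB, ← Real.rpow_natCast b 3, ← Real.rpow_mul hb0.le, ← Real.rpow_natCast b 2]
      norm_num
    rw [e]
    calc (B : ℝ) ^ (2 / 3 : ℝ) ≤ (C * (x + y)) ^ (2 / 3 : ℝ) := by gcongr
      _ = C ^ (2 / 3 : ℝ) * (x + y) ^ (2 / 3 : ℝ) := Real.mul_rpow hC.le (by positivity)
      _ ≤ _ := by
        gcongr
        exact Real.rpow_add_le_add_rpow hx hy (by norm_num) (by norm_num)
  calc T * (2 * (B : ℝ)) ≤ (C₁ / (b * ε) + 1) * (2 * b ^ 3) := by rw [hbB]; gcongr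
    _ = (2 * C₁ + 2 * (b * ε)) * (b ^ 2 / ε) := by field_simp
    _ ≤ (2 * C₁ + 2 * (1 + C)) *
        (C ^ (2 / 3 : ℝ) * (x ^ (2 / 3 : ℝ) + y ^ (2 / 3 : ℝ)) / ε) := by gcongr
    _ = _ := by ring

theorem rpow_two_thirds_div_eq {K ε : ℝ} (hK : 0 < K) (hε : 0 < ε) :
    (1 / (ε * K)) ^ (2 / 3 : ℝ) / ε = 1 / (ε ^ (5 / 3 : ℝ) * K ^ (2 / 3 : ℝ)) := by
  have e : ε ^ (5 / 3 : ℝ) = ε ^ (2 / 3 : ℝ) * ε := by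
    rw [← Real.rpow_add_one hε.ne']; norm_num
  rw [Real.div_rpow zero_le_one (by positivity), Real.one_rpow, Real.mul_rpow hε.le hK.le, e]
  field_simp

theorem rpow_two_thirds_div_eq' {β v ε : ℝ} (hβ : 0 ≤ β) (hv : 0 ≤ v) (hε : 0 < ε) :
    (β ^ 2 * v / ε) ^ (2 / 3 : ℝ) / ε =
      β ^ (4 / 3 : ℝ) * v ^ (2 / 3 : ℝ) / ε ^ (5 / 3 : ℝ) := by
  have e : ε ^ (5 / 3 : ℝ) = ε ^ (2 / 3 : ℝ) * ε := by
    rw [← Real.rpow_add_one hε.ne']; norm_num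
  have e' : (β ^ 2) ^ (2 / 3 : ℝ) = β ^ (4 / 3 : ℝ) := by
    rw [← Real.rpow_natCast β 2, ← Real.rpow_mul hβ]; norm_num
  rw [Real.div_rpow (by positivity) hε.le, Real.mul_rpow (by positivity) hv, e, e']
  field_simp

theorem Constants.L_pos (c : Constants) : 0 < c.L := by
  have h1 := c.R_pos
  have h2 := c.M_pos
  have h3 : (0 : ℝ) < c.H := by exact_mod_cast c.one_le_H
  have h4 : 0 < 1 - c.γ := sub_pos.2 c.γ_lt_one
  unfold Constants.L
  positivity

theorem Constants.Phi_pos (c : Constants) : 0 < c.Phi := by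
  have h1 := c.R_pos
  have h2 := c.M_pos
  have h3 : (0 : ℝ) < c.H := by exact_mod_cast c.one_le_H
  have h4 : 0 < 1 - c.γ := sub_pos.2 c.γ_lt_one
  have h5 := c.Cb_nonneg
  have h6 := c.W_nonneg
  unfold Constants.Phi Constants.Lg Constants.Cw
  positivity

theorem Constants.Psi_pos (c : Constants) : 0 < c.Psi :=
  Real.rpow_pos_of_pos (mul_pos c.L_pos c.Phi_pos) _

/-- Since `δ B ≤ 1/5`, the exponent in `δ_lower` is at most `1`, and `e < 3 ≤ 2K/δ`. The condition
`δ_upper` is `V ≤ B` in exponential form. -/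
theorem admissible_of_bounds {c : Constants} {K B : ℕ} {η δ : ℝ} (hK : 1 ≤ K) (hB : 1 ≤ B)
    (hΦ : 4 * c.Phi * (c.L ^ 2)⁻¹ ≤ B) (hη : 0 < η)
    (hη' : η ≤ 1 / (2 * c.Psi * (B : ℝ) ^ (2 / 3 : ℝ))) (hδ : 0 < δ)
    (hδ' : δ ≤ 1 / (5 * K * B)) (hV : V K δ ≤ B) : Admissible c K B η δ := by
  have hK1 : (1 : ℝ) ≤ K := by exact_mod_cast hK
  have hB1 : (1 : ℝ) ≤ B := by exact_mod_cast hB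
  have hδB : δ * B ≤ 1 / 5 := by
    rw [le_div_iff₀ (by positivity)] at hδ'
    have : δ * B * 1 ≤ δ * B * K := by gcongr
    linarith
  have hδ5 : δ ≤ 1 / 5 := le_trans (le_mul_of_one_le_right hδ.le hB1) hδB
  refine ⟨hB, hΦ, hη, hη', ⟨hδ, by linarith⟩, ?_, ?_, hδ'⟩
  · have h1 : δ * B / (2 * (1 - 2 * δ)) ≤ 1 := by
      rw [div_le_one (by linarith)]; linarith
    have h2 : (3 : ℝ) ≤ 2 * K / δ := by
      rw [le_div_iff₀ hδ]; linarith
    exact (Real.exp_le_exp.2 h1).trans (by linarith [Real.exp_one_lt_d9])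
  · rw [← Real.exp_log (by positivity : 0 < 2 * (K : ℝ) / δ), Real.exp_le_exp]
    rw [V] at hV
    linarith

/-- The choice of the parameters, when only a fraction `β` of the agents is Byzantine in fact and
the server is run with a fraction `α`. -/
theorem exists_parameters (c : Constants) {κ β₀ : ℝ} (hκ : 0 < κ)
    (hβ₀ : β₀ < 1 / 2) : ∃ C : ℝ, 0 < C ∧ ∀ (K : ℕ) (β ε : ℝ), 1 ≤ K → 0 ≤ β → β ≤ β₀ → 0 < ε →
      ε * (K * Real.log (2 * K)) ≤ κ → ∃ (T B : ℕ) (η δ : ℝ), 1 ≤ T ∧ Admissible c K B η δ ∧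
        V K δ ≤ C * Real.log (2 + K / ε) ∧
        expectedTraj T B ≤ ENNReal.ofReal
          (C * (1 / (ε ^ (5 / 3 : ℝ) * (K : ℝ) ^ (2 / 3 : ℝ)) +
            β ^ (4 / 3 : ℝ) * V K δ ^ (2 / 3 : ℝ) / ε ^ (5 / 3 : ℝ))) ∧
        ∀ α, β ≤ α → α < 1 / 2 → (∀ good : Finset (Fin K), (K : ℝ) - good.card ≤ α * K →
          (K : ℝ) - good.card ≤ β * K) → Achieves.{u, v, w} c K α T B η δ ε := by
  have hR := c.R_pos
  have hH : (0 : ℝ) < c.H := by exact_mod_cast c.one_le_H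
  have hΛ := c.smooth_pos
  have hΨ := c.Psi_pos
  have hF : 0 ≤ 4 * c.Phi * (c.L ^ 2)⁻¹ := by have := c.Phi_pos; positivity
  -- The value of `a` at `β₀` is admissible for every `β ≤ β₀`, which makes the constant uniform in
  -- `β`.
  obtain ⟨Ca, hCa, hbatch⟩ := exists_batch c hF hκ (by linarith : 0 < (1 - 2 * β₀) / 2)
  -- The first entry makes `η₀ / B ^ (2/3)` admissible, the second satisfies the step-size
  -- conditions of the inner loop.
  obtain ⟨η₀, hη₀⟩ : ∃ η₀, η₀ = min (1 / (2 * c.Psi)) (1 / (4 * c.smooth)) := ⟨_, rfl⟩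
  have hη₀pos : 0 < η₀ := by rw [hη₀]; positivity
  have hη₀Ψ : η₀ ≤ 1 / (2 * c.Psi) := hη₀ ▸ min_le_left _ _
  have hη₀Λ : c.smooth * η₀ ≤ 1 / 4 := by
    calc c.smooth * η₀ ≤ c.smooth * (1 / (4 * c.smooth)) := by
          gcongr; exact hη₀ ▸ min_le_right _ _
      _ = 1 / 4 := by field_simp
  -- The factor `8` in place of `2` brings the telescoped term down to `ε / 4`; `roundErr` uses the
  -- other `3ε / 4`.
  obtain ⟨C', hC', hrounds⟩ := exists_rounds hCa
    (by positivity : 0 < 8 * (c.H * c.R) / η₀)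
  refine ⟨Ca + C', by positivity, fun K β ε hK hβ0 hβ hε hκε => ?_⟩
  have hK1 : (1 : ℝ) ≤ K := by exact_mod_cast hK
  obtain ⟨B, δ, hB, hFB, hδ, hδ', hV0, hVB, hVlog, herr, hBle, hBε⟩ :=
    hbatch K β ε hK hβ0 (by linarith) hε hκε
  have hB1 : (1 : ℝ) ≤ B := by exact_mod_cast hB
  obtain ⟨b, hb⟩ : ∃ b : ℝ, b = (B : ℝ) ^ (1 / 3 : ℝ) := ⟨_, rfl⟩
  have hb1 : 1 ≤ b := by rw [hb]; exact Real.one_le_rpow hB1 (by norm_num)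
  have hb3 : b ^ 3 = B := by
    rw [hb, ← Real.rpow_natCast, ← Real.rpow_mul (by positivity)]; norm_num
  have hb2 : (B : ℝ) ^ (2 / 3 : ℝ) = b ^ 2 := by
    rw [hb, ← Real.rpow_natCast, ← Real.rpow_mul (by positivity)]; norm_num
  obtain ⟨T, hT, hTε, hTB⟩ := hrounds B ε _ _ b hε (by positivity)
    (by positivity : 0 ≤ β ^ 2 * V K δ / ε) hb1 hb3 hBle hBε
  rw [rpow_two_thirds_div_eq (by linarith) hε, rpow_two_thirds_div_eq' hβ0 hV0 hε] at hTB
  have hb0 : 0 < b := by linarith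
  have hT0 : (0 : ℝ) < T := by positivity
  have hη : 0 < η₀ / b ^ 2 := by positivity
  -- As `B = b ^ 3` and `b ≥ 1`, this single inequality implies all three step-size conditions; the
  -- third is its cube.
  have hx : c.smooth * (η₀ / b ^ 2) * b ^ 2 ≤ 1 / 4 := by
    rw [mul_assoc, div_mul_cancel₀ _ (by positivity)]; exact hη₀Λ
  refine ⟨T, B, η₀ / b ^ 2, δ, hT, ?_, ?_, ?_, ?_⟩
  · refine admissible_of_bounds hK hB hFB hη ?_ hδ hδ' hVB
    rw [hb2, ← div_div]
    gcongr
  · have hlog : 0 ≤ Real.log (2 + K / ε) :=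
      Real.log_nonneg (by linarith [div_pos (by linarith : (0 : ℝ) < K) hε])
    exact hVlog.trans (mul_le_mul_of_nonneg_right (by linarith) hlog)
  · rw [expectedTraj_eq]
    refine ENNReal.ofReal_le_ofReal (hTB.trans (mul_le_mul_of_nonneg_right (by linarith) ?_))
    positivity
  · intro α hβα hα hgood S A Z _ _ _ d X adv good pick θ₀ hX hcard hpick
    refine ⟨outputLaw_prob hX θ₀ hT, ?_⟩
    have hxpos : 0 ≤ c.smooth * (η₀ / b ^ 2) := by positivity
    have hx1 : c.smooth * (η₀ / b ^ 2) ≤ 1 / 4 :=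
      (le_mul_of_one_le_right hxpos (one_le_pow₀ hb1)).trans hx
    have hx2 : (c.smooth * (η₀ / b ^ 2)) ^ 2 * B ≤ 1 / 16 := by
      rw [← hb3]
      calc (c.smooth * (η₀ / b ^ 2)) ^ 2 * b ^ 3
          ≤ (c.smooth * (η₀ / b ^ 2)) ^ 2 * b ^ 4 := by gcongr; norm_num
        _ = (c.smooth * (η₀ / b ^ 2) * b ^ 2) ^ 2 := by ring
        _ ≤ (1 / 4) ^ 2 := by gcongr
        _ = 1 / 16 := by norm_num
    have hx3 : (c.smooth * (η₀ / b ^ 2)) ^ 3 * (B : ℝ) ^ 2 ≤ 1 / 64 := by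
      rw [← hb3]
      calc (c.smooth * (η₀ / b ^ 2)) ^ 3 * (b ^ 3) ^ 2
          = (c.smooth * (η₀ / b ^ 2) * b ^ 2) ^ 3 := by ring
        _ ≤ (1 / 4) ^ 3 := by gcongr
        _ = 1 / 64 := by norm_num
    refine (lintegral_outputLaw_le hX hK hB hpick hα hβ0 hβα (hgood good hcard)
      (by linarith : 0 ≤ (1 - 2 * β₀) / 2) (by linarith) hVB hη hx1 hx2 hx3 θ₀ hT).trans
      (ENNReal.ofReal_le_ofReal ?_)
    have e : 2 * (c.H * c.R) / (η₀ / b ^ 2 * B * T) = 8 * (c.H * c.R) / η₀ / (b * T) / 4 := by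
      rw [← hb3]; field_simp; ring
    rw [e]
    linarith

end Complexity

end FedPG

end

theorem corollary1 (c : FedPG.Constants) :
    -- (i) the general case
    (∀ (κ : ℝ) (α₀ : ℝ), 0 < κ → α₀ < 1 / 2 → ∃ C : ℝ, 0 < C ∧
      ∀ (K : ℕ) (α ε : ℝ), 1 ≤ K → 0 ≤ α → α ≤ α₀ → 0 < ε →
        ε * (K * Real.log (2 * K)) ≤ κ →
        ∃ (T B : ℕ) (η δ : ℝ), 1 ≤ T ∧ FedPG.Admissible c K B η δ ∧
          FedPG.Achieves.{u, v, w} c K α T B η δ ε ∧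
          FedPG.V K δ ≤ C * Real.log (2 + K / ε) ∧
          FedPG.expectedTraj T B ≤ ENNReal.ofReal
            (C * (1 / (ε ^ (5 / 3 : ℝ) * (K : ℝ) ^ (2 / 3 : ℝ)) +
              α ^ (4 / 3 : ℝ) * FedPG.V K δ ^ (2 / 3 : ℝ) / ε ^ (5 / 3 : ℝ)))) ∧
    -- (ii) no Byzantine agents
    (∀ κ : ℝ, 0 < κ → ∃ C : ℝ, 0 < C ∧
      ∀ (K : ℕ) (ε : ℝ), 1 ≤ K → 0 < ε → ε * (K * Real.log (2 * K)) ≤ κ →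
        ∃ (T B : ℕ) (η δ : ℝ), 1 ≤ T ∧ FedPG.Admissible c K B η δ ∧
          FedPG.Achieves.{u, v, w} c K 0 T B η δ ε ∧
          FedPG.expectedTraj T B ≤ ENNReal.ofReal
            (C * (1 / (ε ^ (5 / 3 : ℝ) * (K : ℝ) ^ (2 / 3 : ℝ))))) ∧
    -- (iii) a single agent
    (∀ κ : ℝ, 0 < κ → ∃ C : ℝ, 0 < C ∧
      ∀ (α ε : ℝ), 0 ≤ α → α < 1 / 2 → 0 < ε → ε ≤ κ →
        ∃ (T B : ℕ) (η δ : ℝ), 1 ≤ T ∧ FedPG.Admissible c 1 B η δ ∧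
          FedPG.Achieves.{u, v, w} c 1 α T B η δ ε ∧
          FedPG.expectedTraj T B ≤ ENNReal.ofReal
            (C * (1 / ε ^ (5 / 3 : ℝ)))) := by
  refine ⟨fun κ α₀ hκ hα₀ => ?_, fun κ hκ => ?_, fun κ hκ => ?_⟩
  · obtain ⟨C, hC, h⟩ := FedPG.exists_parameters.{u, v, w} c hκ hα₀
    refine ⟨C, hC, fun K α ε hK hα0 hα hε hκε => ?_⟩
    obtain ⟨T, B, η, δ, hT, had, hV, htraj, hach⟩ :=
      h K α ε hK hα0 hα hε hκε
    exact ⟨T, B, η, δ, hT, had, hach α le_rfl (hα.trans_lt hα₀) fun _ h => h, hV, htraj⟩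
  · obtain ⟨C, hC, h⟩ := FedPG.exists_parameters.{u, v, w} c hκ (β₀ := 0) (by norm_num)
    refine ⟨C, hC, fun K ε hK hε hκε => ?_⟩
    obtain ⟨T, B, η, δ, hT, had, -, htraj, hach⟩ := h K 0 ε hK le_rfl le_rfl hε hκε
    refine ⟨T, B, η, δ, hT, had, hach 0 le_rfl (by norm_num) fun _ h => h, ?_⟩
    rwa [Real.zero_rpow (by norm_num), zero_mul, zero_div, add_zero] at htraj
  · have hl2 : 0 < Real.log 2 := Real.log_pos one_lt_two
    obtain ⟨C, hC, h⟩ := FedPG.exists_parameters.{u, v, w} c (mul_pos hκ hl2) (β₀ := 0)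
      (by norm_num)
    refine ⟨C, hC, fun α ε hα0 hα hε hεκ => ?_⟩
    -- For one agent the parameters are those for a true Byzantine fraction `0`, whatever `α` the
    -- server uses. The hypothesis becomes `ε log 2 ≤ κ log 2`.
    obtain ⟨T, B, η, δ, hT, had, -, htraj, hach⟩ := h 1 0 ε le_rfl le_rfl le_rfl hε (by
      rw [Nat.cast_one, one_mul, mul_one]
      exact mul_le_mul_of_nonneg_right hεκ hl2.le)
    refine ⟨T, B, η, δ, hT, had, hach α hα0 hα fun good hgood => ?_, ?_⟩
    · have hg : 1 ≤ good.card := by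
        by_contra hcard
        have : good.card = 0 := by omega
        rw [this] at hgood
        norm_num at hgood
        linarith
      have : (1 : ℝ) ≤ good.card := by exact_mod_cast hg
      rw [Nat.cast_one, zero_mul]
      linarith
    · rwa [Real.zero_rpow (by norm_num), zero_mul, zero_div, add_zero, Nat.cast_one,
        Real.one_rpow, mul_one] at htraj
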